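/- Let $\mathbb{E}/\mathbb{F}$ be a quadratic extension of non-archimedean local fields, $\mathbb{E}=\mathbb{F}(\alpha)$ with $\alpha\notin\mathbb{F}$ and $\alpha^2\in\mathbb{F}$. Let $|\cdot|_{\mathbb{F}}$, $|\cdot|_{\mathbb{E}}$ be the normalized absolute values. Fix a Haar measure $dy$ on $\mathbb{F}$, use the measure $dx=dx_1\,dx_2$ on $\mathbb{E}\ni x=x_1+x_2\alpha$, fix a non-trivial continuous additive character $\psi:\mathbb{F}\to S^1$, and put $\psi(x_1+x_2\alpha):=\psi(x_1)$ on $\mathbb{E}$. For $K\in\{\mathbb{F},\mathbb{E}\}$ and $f\in C_c^\infty(K)$ (locally constant with compact support) let $\widehat f(x)=\int_K\psi(xy)f(y)\,dy$; for a linear functional $u$ on $C_c^\infty(K)$ let $\langle\widehat u,f\rangle=\langle u,\widehat f\rangle$. A multiplicative character of $K^\times$ is a continuous homomorphism $\xi:K^\times\to\mathbb{C}^\times$. If $\xi\neq1$, there is a unique distribution $u$ on $K$ that is homogeneous of degree $\xi|\cdot|_K^{-1}$ (that is, $\langle u,f(a^{-1}\cdot)\rangle=\xi(a)\langle u,f\rangle$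 for $a\in K^\times$, $f\in C_c^\infty(K)$) and is given on $K^\times$ by the function $\xi|\cdot|_K^{-1}$. The gamma factor $\Gamma(\xi)\in\mathbb{C}$ is defined by $\widehat u=\Gamma(\xi)\,\xi^{-1}$ on $K^\times$. There is a constant $c_{\mathbb{F}}>0$ with $f(x)=c_{\mathbb{F}}\int_{\mathbb{F}}\psi(-xy)\widehat f(y)\,dy$ for all $f\in C_c^\infty(\mathbb{F})$, $x\in\mathbb{F}$, and with this constant the following holds for every multiplicative character $\chi$ of $\mathbb{E}^\times$. (a) If $\chi|_{\mathbb{F}^\times}\neq|\cdot|_{\mathbb{F}}^{-1}$ and $\chi\neq|\cdot|_{\mathbb{E}}^{-1}$, then $$\int_{\mathbb{F}}\chi(1+y\alpha)\,dy=c_{\mathbb{F}}\,\chi(-1)\,\Gamma(\chi^{-1}|_{\mathbb{F}^\times}|\cdot|_{\mathbb{F}}^{-1})\,\Gamma(\chi|\cdot|_{\mathbb{E}}),$$ $$\int_{\mathbb{F}}\chi(y+\alpha)\,dy=c_{\mathbb{F}}\,\chi(-\alpha)\,|\alpha^2|_{\mathbb{F}}\,\Gamma(\chi^{-1}|_{\mathbb{F}^\times}|\cdot|_{\mathbb{F}}^{-1})\,\Gamma(\chi|\cdot|_{\mathbb{E}}).$$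 Here the integrals are the values at $s=0$ of the analytic continuations of the integrals for $\chi|\cdot|_{\mathbb{E}}^s$, which converge absolutely for $\operatorname{Re}s$ sufficiently negative, extend to meromorphic functions on $\mathbb{C}$, and are regular at $s=0$. The formulas also hold with the ordinary integrals whenever these converge absolutely, and with the improper integrals $\lim_{n\to\infty}\int_{|y|_{\mathbb{F}}\le q_{\mathbb{F}}^n}$ (where $q_{\mathbb{F}}$ is the cardinality of the residue field of $\mathbb{F}$) whenever these limits exist. (b) If $\chi=|\cdot|_{\mathbb{E}}^{-1}$, then both formulas hold with the right-hand sides replaced by the limits for $s\to0$, $s\neq0$, of the same expressions for $\chi|\cdot|_{\mathbb{E}}^s$. (c) There is $\sigma\in\mathbb{R}$ with $|\chi(x)|=|x|_{\mathbb{E}}^\sigma$ for all $x\in\mathbb{E}^\times$. Each of the two integrals converges absolutely if and only if $\sigma<-\frac12$, and exists as an improper integral if and only if $\sigma<-\frac12$ or $\chi$ is non-trivial on $\mathcal{O}_{\mathbb{F}}^\times$. -/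

import Mathlib

open MeasureTheory Filter Topology ValuativeRel

noncomputable section

namespace LocalGamma

section LocalField

variable (K : Type*) [Field K] [ValuativeRel K] [TopologicalSpace K] [IsNonarchimedeanLocalField K]

/-- The cardinality `q_K` of the residue field. -/
def resCard : ℕ := Nat.card 𝓀[K]

variable {K}

/-- The normalized absolute value `|x|_K = q_K ^ (-ν_K(x))`, `|0|_K = 0`.  (Mathlib's valuation is
multiplicative: under the unique ordered isomorphism of the value group with `ℤᵐ⁰` a uniformizer
has logarithm `-1`, so that the logarithm of `x` is `-ν_K(x)`.) -/
def nabs (x : K) : ℝ :=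
  open scoped Classical in
  if x = 0 then 0 else
    (resCard K : ℝ) ^
      (WithZero.log (IsNonarchimedeanLocalField.valueGroupWithZeroIsoInt K (valuation K x)))

lemma resCard_pos : 0 < resCard K := Nat.card_pos

lemma nabs_pos {x : K} (hx : x ≠ 0) : 0 < nabs x := by
  have h : (0 : ℝ) < resCard K := by exact_mod_cast resCard_pos (K := K)
  rw [nabs, if_neg hx]
  exact zpow_pos h _

lemma nabs_one : nabs (1 : K) = 1 := by
  simp [nabs]

lemma nabs_mul (x y : K) : nabs (x * y) = nabs x * nabs y := by
  have h : (resCard K : ℝ) ≠ 0 := by exact_mod_cast (resCard_pos (K := K)).ne'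
  by_cases hx : x = 0
  · simp [nabs, hx]
  by_cases hy : y = 0
  · simp [nabs, hy]
  rw [nabs, nabs, nabs, if_neg hx, if_neg hy, if_neg (mul_ne_zero hx hy), map_mul, map_mul,
    WithZero.log_mul (by simpa using hx) (by simpa using hy), zpow_add₀ h]

variable (K) in
/-- The multiplicative character `x ↦ |x|_K ^ s` of `Kˣ`, for complex `s`. -/
def absChar (s : ℂ) : Kˣ →* ℂˣ where
  toFun x := Units.mk0 ((nabs (x : K) : ℂ) ^ s) (by
    have h : (nabs (x : K) : ℂ) ≠ 0 := by exact_mod_cast (nabs_pos x.ne_zero).ne'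
    simp [Complex.cpow_eq_zero_iff, h])
  map_one' := by ext; simp [nabs_one]
  map_mul' x y := by
    ext
    simp only [Units.val_mul, Units.val_mk0, nabs_mul, Complex.ofReal_mul]
    exact Complex.mul_cpow_ofReal_nonneg (nabs_pos x.ne_zero).le (nabs_pos y.ne_zero).le s

/-- A multiplicative character of `Kˣ` viewed as a function on `K`, with value `0` at `0`. -/
def charFun (χ : Kˣ →* ℂˣ) (x : K) : ℂ :=
  open scoped Classical in
  if h : x = 0 then 0 else (χ (Units.mk0 x h) : ℂ)

variable (K) in
/-- The space `C_c^∞(K)` of locally constant, compactly supported functions `K → ℂ`. -/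
def testFunctions : Submodule ℂ (K → ℂ) where
  carrier := {f | IsLocallyConstant f ∧ HasCompactSupport f}
  add_mem' := fun hf hg => ⟨hf.1.add hg.1, hf.2.add hg.2⟩
  zero_mem' := ⟨IsLocallyConstant.const 0, HasCompactSupport.zero⟩
  smul_mem' := fun c _ hf => ⟨hf.1.comp fun z => c • z, hf.2.smul_left (f := fun _ => c)⟩

/-- The dilated test function `x ↦ f (a⁻¹ x)`. -/
def dilate (a : Kˣ) (f : testFunctions K) : testFunctions K :=
  ⟨fun x => f.1 ((a⁻¹ : Kˣ) * x),
    f.2.1.comp_continuous (continuous_const.mul continuous_id),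
    f.2.2.comp_homeomorph (Homeomorph.mulLeft₀ ((a⁻¹ : Kˣ) : K) (a⁻¹).ne_zero)⟩

/-- A distribution `u` on `K` is homogeneous of degree `ξ` if
`⟨u, f (a⁻¹ ·)⟩ = ξ(a) |a|_K ⟨u, f⟩` for all test functions `f` and all `a ∈ Kˣ`. -/
def IsHomogeneous (u : testFunctions K →ₗ[ℂ] ℂ) (ξ : Kˣ →* ℂˣ) : Prop :=
  ∀ (a : Kˣ) (f : testFunctions K), u (dilate a f) = (ξ a : ℂ) * (nabs (a : K) : ℂ) * u f

variable [MeasurableSpace K]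

/-- The Fourier transform `x ↦ ∫ ψ(xy) f(y) dμ(y)` of a function on `K`. -/
def fourier (μ : Measure K) (ψ : AddChar K Circle) (f : K → ℂ) (x : K) : ℂ :=
  ∫ y, (ψ (x * y) : ℂ) * f y ∂μ

/-- `c` is the constant of Fourier inversion on `K` with respect to `ψ` and `μ`:
`f(x) = c ∫ ψ(-xy) f^(y) dμ(y)` for all test functions `f`. -/
def IsInversionConstant (μ : Measure K) (ψ : AddChar K Circle) (c : ℝ) : Prop :=
  ∀ f ∈ testFunctions K, ∀ x : K,
    f x = c * ∫ y, (ψ (-(x * y)) : ℂ) * fourier μ ψ f y ∂μ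

/-- `γ` is a gamma factor of the multiplicative character `χ` of `Kˣ`:
the function `χ |·|⁻¹` on `Kˣ` extends to a homogeneous distribution `u` on `K` of degree
`χ |·|⁻¹` whose Fourier transform (defined by `⟨û, f⟩ = ⟨u, f^⟩`) is, on `Kˣ`, equal to
`γ • χ⁻¹`.  A test function on `Kˣ` is a test function on `K` that vanishes at `0`. For `χ ≠ 1`
the distribution `u` and the number `γ` exist and are unique; for `χ = 1` there is no such `u`. -/
def IsGammaFactor (μ : Measure K) (ψ : AddChar K Circle) (χ : Kˣ →* ℂˣ) (γ : ℂ) : Prop :=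
  ∃ u : testFunctions K →ₗ[ℂ] ℂ,
    IsHomogeneous u (χ * absChar K (-1)) ∧
    (∀ f : testFunctions K, f.1 0 = 0 → u f = ∫ x, charFun (χ * absChar K (-1)) x * f.1 x ∂μ) ∧
    (∀ f : testFunctions K, f.1 0 = 0 →
      ∃ g : testFunctions K, (g.1 = fourier μ ψ f.1) ∧ u g = γ * ∫ x, charFun χ⁻¹ x * f.1 x ∂μ)

/-- The gamma factor `Γ(χ)` of a multiplicative character `χ ≠ 1` of `Kˣ`
(with the default value `0` at the pole `χ = 1`). -/
def gammaFactor (μ : Measure K) (ψ : AddChar K Circle) (χ : Kˣ →* ℂˣ) : ℂ :=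
  open scoped Classical in
  if h : ∃ γ, IsGammaFactor μ ψ χ γ then h.choose else 0

/-- The improper integral `lim_{n → ∞} ∫_{|y| ≤ q^n} g(y) dμ(y)` exists and equals `I`. -/
def HasImproperIntegral (μ : Measure K) (g : K → ℂ) (I : ℂ) : Prop :=
  Tendsto (fun n : ℕ => ∫ y in {y : K | nabs y ≤ (resCard K : ℝ) ^ n}, g y ∂μ) atTop (𝓝 I)

/-- `I` is the value at `s = 0` of the analytic continuation of `s ↦ ∫ g s y dμ(y)`: the integral
converges absolutely for `Re s` sufficiently negative, extends from there to a meromorphic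
function on `ℂ`, and this function is regular at `0` with value `I`. -/
def HasRegularizedIntegral (μ : Measure K) (g : ℂ → K → ℂ) (I : ℂ) : Prop :=
  ∃ Φ : ℂ → ℂ, MeromorphicOn Φ Set.univ ∧
    (∃ σ₀ : ℝ, ∀ s : ℂ, s.re < σ₀ → Integrable (g s) μ ∧ Φ s = ∫ y, g s y ∂μ) ∧
    AnalyticAt ℂ Φ 0 ∧ Φ 0 = I

/-- The integral of `g 0` has value `I`, in every sense in which it has a value: by
analytic continuation in `s`, as an absolutely convergent integral if it converges absolutely, and
as an improper integral if it exists as such. -/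
def IntegralHasValue (μ : Measure K) (g : ℂ → K → ℂ) (I : ℂ) : Prop :=
  HasRegularizedIntegral μ g I ∧
  (Integrable (g 0) μ → ∫ y, g 0 y ∂μ = I) ∧
  (∀ L : ℂ, HasImproperIntegral μ (g 0) L → L = I)

end LocalField

section Quadratic

variable {F E : Type*} [Field F] [Field E] [Algebra F E]

/-- The basis `(1, α)` of a quadratic extension `E / F`, for `α ∈ E ∖ F`. -/
def quadBasis (hdim : Module.finrank F E = 2) {α : E} (hα : α ∉ (algebraMap F E).range) :
    Module.Basis (Fin 2) F E :=
  basisOfLinearIndependentOfCardEqFinrank (b := ![1, α])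
    (by
      rw [LinearIndependent.pair_iff]
      intro s t h
      have ht : t = 0 := by
        by_contra ht
        apply hα
        refine ⟨-s / t, ?_⟩
        have ht' : algebraMap F E t ≠ 0 := by simpa using ht
        rw [Algebra.smul_def, Algebra.smul_def, mul_one] at h
        rw [map_div₀, map_neg, div_eq_iff ht']
        linear_combination -h
      subst ht
      simpa [Algebra.smul_def] using h)
    (by simp [hdim])

/-- The extension of `ψ` to `E`: `x₁ + x₂ α ↦ ψ(x₁)`. -/
def extendAddChar (hdim : Module.finrank F E = 2) {α : E} (hα : α ∉ (algebraMap F E).range)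
    (ψ : AddChar F Circle) : AddChar E Circle :=
  ψ.compAddMonoidHom ((quadBasis hdim hα).coord 0).toAddMonoidHom

/-- The measure `dx₁ dx₂` on `E ∋ x = x₁ + x₂ α`. -/
def prodMeasure [MeasurableSpace F] [MeasurableSpace E] (μ : Measure F) (α : E) : Measure E :=
  (μ.prod μ).map (fun x : F × F => algebraMap F E x.1 + algebraMap F E x.2 * α)

variable [ValuativeRel F] [TopologicalSpace F] [IsNonarchimedeanLocalField F]

/-- The character `χ⁻¹|_{Fˣ} |·|_F⁻¹` of `Fˣ` attached to a character `χ` of `Eˣ`. -/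
def restrictedDual (χ : Eˣ →* ℂˣ) : Fˣ →* ℂˣ :=
  (χ⁻¹).comp (Units.map (algebraMap F E : F →* E)) * absChar F (-1)

variable [ValuativeRel E] [TopologicalSpace E] [IsNonarchimedeanLocalField E]
  [MeasurableSpace F] [MeasurableSpace E]

/-- The product `Γ(χ⁻¹|_{Fˣ} |·|_F⁻¹) Γ(χ |·|_E)`. -/
def gammaProduct (hdim : Module.finrank F E = 2) {α : E} (hα : α ∉ (algebraMap F E).range)
    (μ : Measure F) (ψ : AddChar F Circle) (χ : Eˣ →* ℂˣ) : ℂ :=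
  gammaFactor μ ψ (restrictedDual χ) *
    gammaFactor (prodMeasure μ α) (extendAddChar hdim hα ψ) (χ * absChar E 1)

end Quadratic

end LocalGamma

end

/-! Put ξ = χ⁻¹|_{Fˣ} |·|_F⁻¹ and compare two evaluations of one pairing on E = F ⊕ Fα. Choose a
test function h on F with h(0) = 0, ∫ h = 0 and S = ∫ ξ⁻¹h ≠ 0, and let g be its Fourier transform,
so that g(0) = ∫ h = 0. The gamma factor on F gives ∫ ξ|·|_F⁻¹ g = Γ(ξ) S. On E take G = g ⊗ 1_B
with B a small ball, a thin strip along F. Since α² = d lies in F, Fourier transforms respect such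
tensor products (`fourier_tensor`), and the transform of G is c_F⁻¹ μ(B) times h(-·) ⊗ 1_{B'} with
B' a large ball.

The gamma factor on E equates the integral of χ against the transform of G with Γ(χ|·|_E) times the
integral of (χ|·|_E)⁻¹ against G. On the thin strip the character depends only on the coordinate in
F, where it is ξ|·|_F⁻¹ because |x|_E = |x|_F² on F (`nabs_algebraMap`). So this side is Γ(χ|·|_E)
μ(B) Γ(ξ) S. The other side contains the integrals of χ(x + yα) over y in B', which are χ(x)|x|_F
times integrals of χ(1 + yα) over large balls.

For large y one has χ(1 + yα) = χ(y)χ(α). Hence the integral over the ball of radius q^n is A + C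
r^n for large n, where r = q χ(ϖ)⁻¹ and C = 0 if χ is non-trivial on the units of F
(`partialIntegral_eq`); only r = 1 with χ trivial on these units is excluded. The number A is the
regularized integral. After multiplication by χ(x)|x|_F the tail no longer depends on x
(`mul_partialIntegral_eq`), so ∫ h = 0 removes it and A χ(-1) S remains. This proves the formula for
A (`regularizedValue_eq_gammaProduct`) at every χ off the two poles, without starting from a domain
of convergence. All test functions and transforms involved vanish at 0, so the extension of the
distributions across 0 plays no role.

The rest is the study of A. Twisting χ by |·|_E^s replaces r by r q^{2s}; the integral over a fixed
ball is a finite sum of exponentials in s and the tail is a rational expression in exponentials. So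
A is meromorphic in s, and it equals the integral once |r q^{2s}| < 1. The same tail decides
convergence, as |r| = q^{1+2σ}; absolute convergence is the case of the character |χ|. At χ =
|·|_E^{-1} the formula follows from continuity of A at s = 0. Finally y + α = α(1 + d⁻¹yα) reduces
the second integral to the first. -/

noncomputable section

set_option linter.unusedSectionVars false

namespace LocalGamma

/-! ### The normalized absolute value, balls and the topology. -/

section Basic

variable {K : Type*} [Field K] [ValuativeRel K] [TopologicalSpace K] [IsNonarchimedeanLocalField K]

variable (K) in
lemma one_lt_resCard : (1 : ℝ) < resCard K := by
  have : 1 < Nat.card 𝓀[K] := Finite.one_lt_card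
  exact_mod_cast this

variable (K) in
lemma resCard_pos' : (0 : ℝ) < resCard K := zero_lt_one.trans (one_lt_resCard K)

variable (K) in
lemma resCard_ne_zero : (resCard K : ℝ) ≠ 0 := (resCard_pos' K).ne'

/-- The integer `v` with `|x|_K = q ^ v`, for `x ≠ 0`. -/
def logAbs (x : K) : ℤ :=
  WithZero.log (IsNonarchimedeanLocalField.valueGroupWithZeroIsoInt K (valuation K x))

lemma nabs_zero : nabs (0 : K) = 0 := by simp [nabs]

lemma nabs_eq_zpow {x : K} (hx : x ≠ 0) : nabs x = (resCard K : ℝ) ^ logAbs x := by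
  rw [nabs, if_neg hx, logAbs]

lemma nabs_nonneg (x : K) : 0 ≤ nabs x := by
  by_cases hx : x = 0
  · simp [hx, nabs_zero]
  · exact (nabs_pos hx).le

variable (K) in
/-- The normalized absolute value as a homomorphism. -/
def nabsHom : K →*₀ ℝ where
  toFun := nabs
  map_zero' := nabs_zero
  map_one' := nabs_one
  map_mul' := nabs_mul

lemma nabs_inv (x : K) : nabs x⁻¹ = (nabs x)⁻¹ := map_inv₀ (nabsHom K) x

lemma nabs_div (x y : K) : nabs (x / y) = nabs x / nabs y := map_div₀ (nabsHom K) x y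

lemma nabs_pow (x : K) (n : ℕ) : nabs (x ^ n) = nabs x ^ n := map_pow (nabsHom K) x n

lemma nabs_zpow (x : K) (n : ℤ) : nabs (x ^ n) = nabs x ^ n := map_zpow₀ (nabsHom K) x n

lemma nabs_le_nabs_iff {x y : K} : nabs x ≤ nabs y ↔ valuation K x ≤ valuation K y := by
  by_cases hx : x = 0
  · simp [hx, nabs_zero, nabs_nonneg]
  by_cases hy : y = 0
  · simp only [hy, nabs_zero, map_zero, le_zero_iff, Valuation.zero_iff, hx, iff_false, not_le]
    exact nabs_pos hx
  rw [nabs_eq_zpow hx, nabs_eq_zpow hy, zpow_le_zpow_iff_right₀ (one_lt_resCard K), logAbs, logAbs,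
    WithZero.log_le_log (by simpa using hx) (by simpa using hy)]
  exact map_le_map_iff (IsNonarchimedeanLocalField.valueGroupWithZeroIsoInt K)

lemma nabs_lt_nabs_iff {x y : K} : nabs x < nabs y ↔ valuation K x < valuation K y := by
  rw [← not_le, ← not_le, nabs_le_nabs_iff]

lemma nabs_eq_nabs_iff {x y : K} : nabs x = nabs y ↔ valuation K x = valuation K y := by
  rw [le_antisymm_iff, le_antisymm_iff, nabs_le_nabs_iff, nabs_le_nabs_iff]

lemma nabs_neg (x : K) : nabs (-x) = nabs x := by
  rw [nabs_eq_nabs_iff, Valuation.map_neg]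

lemma nabs_add_le_max (x y : K) : nabs (x + y) ≤ max (nabs x) (nabs y) := by
  rcases le_total (nabs x) (nabs y) with h | h
  · rw [max_eq_right h, nabs_le_nabs_iff]
    exact Valuation.map_add_le _ (nabs_le_nabs_iff.1 h) le_rfl
  · rw [max_eq_left h, nabs_le_nabs_iff]
    exact Valuation.map_add_le _ le_rfl (nabs_le_nabs_iff.1 h)

lemma nabs_add_le {x y : K} {r : ℝ} (hx : nabs x ≤ r) (hy : nabs y ≤ r) : nabs (x + y) ≤ r :=
  (nabs_add_le_max x y).trans (max_le hx hy)

lemma nabs_eq_of_sub_lt {x y : K} (h : nabs (y - x) < nabs x) : nabs y = nabs x := by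
  rw [nabs_eq_nabs_iff]
  exact Valuation.map_eq_of_sub_lt _ (nabs_lt_nabs_iff.1 h)

variable (K) in
lemma exists_nabs_eq (n : ℤ) : ∃ x : K, x ≠ 0 ∧ nabs x = (resCard K : ℝ) ^ n := by
  obtain ⟨x, hx⟩ := valuation_surjective
    ((IsNonarchimedeanLocalField.valueGroupWithZeroIsoInt K).symm (WithZero.exp n))
  have hx0 : x ≠ 0 := by
    rintro rfl
    rw [map_zero, eq_comm, ← map_zero (IsNonarchimedeanLocalField.valueGroupWithZeroIsoInt K).symm,
      EmbeddingLike.apply_eq_iff_eq] at hx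
    exact WithZero.exp_ne_zero hx
  refine ⟨x, hx0, ?_⟩
  rw [nabs_eq_zpow hx0, logAbs, hx]
  simp

lemma logAbs_eq {x : K} {n : ℤ} (h : nabs x = (resCard K : ℝ) ^ n) : logAbs x = n := by
  have hx : x ≠ 0 := by
    rintro rfl
    rw [nabs_zero] at h
    exact (zpow_pos (resCard_pos' K) n).ne h
  rw [nabs_eq_zpow hx] at h
  exact zpow_right_injective₀ (resCard_pos' K) (one_lt_resCard K).ne' h

lemma nabs_lt_zpow_iff {x : K} {n : ℤ} :
    nabs x < (resCard K : ℝ) ^ n ↔ nabs x ≤ (resCard K : ℝ) ^ (n - 1) := by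
  by_cases hx : x = 0
  · simp [hx, nabs_zero, zpow_pos (resCard_pos' K), (zpow_pos (resCard_pos' K) _).le]
  rw [nabs_eq_zpow hx, zpow_lt_zpow_iff_right₀ (one_lt_resCard K),
    zpow_le_zpow_iff_right₀ (one_lt_resCard K)]
  omega

variable (K) in
lemma exists_zpow_lt {r : ℝ} (hr : 0 < r) : ∃ n : ℤ, (resCard K : ℝ) ^ n < r := by
  obtain ⟨n, hn⟩ := exists_pow_lt_of_lt_one hr (inv_lt_one_of_one_lt₀ (one_lt_resCard K))
  exact ⟨-n, by simpa using hn⟩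

variable (K) in
lemma exists_lt_zpow (r : ℝ) : ∃ n : ℤ, r < (resCard K : ℝ) ^ n := by
  obtain ⟨n, hn⟩ := pow_unbounded_of_one_lt r (one_lt_resCard K)
  exact ⟨n, by simpa using hn⟩

variable (K) in
/-- The ball of radius `q ^ n` as an additive subgroup. -/
def ball (n : ℤ) : AddSubgroup K where
  carrier := {x | nabs x ≤ (resCard K : ℝ) ^ n}
  add_mem' := nabs_add_le
  zero_mem' := by
    rw [Set.mem_ofPred_eq, nabs_zero]
    exact (zpow_pos (resCard_pos' K) n).le
  neg_mem' := fun {x} hx => by rwa [Set.mem_ofPred_eq, nabs_neg]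

lemma mem_ball {x : K} {n : ℤ} : x ∈ ball K n ↔ nabs x ≤ (resCard K : ℝ) ^ n := Iff.rfl

lemma ball_mono {m n : ℤ} (h : m ≤ n) : ball K m ≤ ball K n := fun _ hx =>
  le_trans (mem_ball.1 hx) (zpow_le_zpow_right₀ (one_lt_resCard K).le h)

variable (K) in
lemma ball_eq_valuation (n : ℤ) : ∃ γ : ValueGroupWithZero K, γ ≠ 0 ∧
    (ball K n : Set K) = {x | valuation K x ≤ γ} := by
  obtain ⟨a, ha, h⟩ := exists_nabs_eq K n
  refine ⟨valuation K a, by simpa using ha, ?_⟩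
  ext x
  rw [SetLike.mem_coe, mem_ball, ← h, nabs_le_nabs_iff]
  rfl

lemma isCompact_ball (n : ℤ) : IsCompact (ball K n : Set K) := by
  obtain ⟨γ, -, h⟩ := ball_eq_valuation K n
  rw [h]
  exact IsNonarchimedeanLocalField.isCompact_closedBall K γ

lemma ball_mem_nhds_zero (n : ℤ) : (ball K n : Set K) ∈ 𝓝 0 := by
  obtain ⟨γ, h0, h⟩ := ball_eq_valuation K n
  rw [h, IsValuativeTopology.mem_nhds_zero_iff]
  exact ⟨Units.mk0 γ h0, fun x hx => by
    rw [Set.mem_ofPred_eq] at hx ⊢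
    exact hx.le⟩

lemma isOpen_ball (n : ℤ) : IsOpen (ball K n : Set K) :=
  (ball K n).isOpen_of_mem_nhds (ball_mem_nhds_zero n)

lemma mem_nhds_zero_iff_ball {s : Set K} : s ∈ 𝓝 0 ↔ ∃ n : ℤ, (ball K n : Set K) ⊆ s := by
  refine ⟨fun h => ?_, fun ⟨n, hn⟩ => mem_of_superset (ball_mem_nhds_zero n) hn⟩
  rw [IsValuativeTopology.mem_nhds_zero_iff] at h
  obtain ⟨γ, hγ⟩ := h
  obtain ⟨a, ha⟩ := valuation_surjective (γ : ValueGroupWithZero K)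
  have ha0 : a ≠ 0 := by
    rintro rfl
    exact γ.ne_zero (by rw [← ha, map_zero])
  -- The basic neighbourhoods of zero are given by strict inequalities, the balls by weak ones;
  -- hence the shift by one.
  refine ⟨logAbs a - 1, fun x hx => hγ ?_⟩
  rw [Set.mem_ofPred_eq, ← ha, ← nabs_lt_nabs_iff, nabs_eq_zpow ha0, nabs_lt_zpow_iff]
  exact hx

lemma mem_nhds_iff_ball {s : Set K} {x : K} :
    s ∈ 𝓝 x ↔ ∃ n : ℤ, ∀ y, nabs (y - x) ≤ (resCard K : ℝ) ^ n → y ∈ s := by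
  rw [← add_zero x, ← map_add_left_nhds, mem_map, mem_nhds_zero_iff_ball]
  refine exists_congr fun n => ⟨fun h y hy => ?_, fun h b hb => ?_⟩
  · have := h (show y - x ∈ ball K n by simpa [mem_ball] using hy)
    simpa using this
  · exact h _ (by simpa using mem_ball.1 hb)

instance : T2Space K := by
  refine IsTopologicalAddGroup.t2Space_of_zero_sep fun x hx => ?_
  obtain ⟨n, hn⟩ := exists_zpow_lt K (nabs_pos hx)
  exact ⟨ball K n, ball_mem_nhds_zero n, fun h => absurd (mem_ball.1 h) (not_le.2 hn)⟩

lemma eventually_nabs_eq {x : K} (hx : x ≠ 0) : ∀ᶠ y in 𝓝 x, nabs y = nabs x := by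
  obtain ⟨n, hn⟩ := exists_zpow_lt K (nabs_pos hx)
  exact mem_nhds_iff_ball.2 ⟨n, fun y hy => nabs_eq_of_sub_lt (lt_of_le_of_lt hy hn)⟩

lemma continuous_nabs : Continuous (nabs : K → ℝ) := by
  rw [continuous_iff_continuousAt]
  intro x
  by_cases hx : x = 0
  · subst hx
    rw [ContinuousAt, nabs_zero, Metric.tendsto_nhds]
    intro ε hε
    obtain ⟨n, hn⟩ := exists_zpow_lt K hε
    filter_upwards [ball_mem_nhds_zero n] with y hy
    rw [Real.dist_eq, sub_zero, abs_of_nonneg (nabs_nonneg y)]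
    exact lt_of_le_of_lt hy hn
  · exact (continuousAt_const (y := nabs x)).congr
      ((eventually_nabs_eq hx).mono fun y hy => hy.symm)

lemma exists_mem_ball (x : K) : ∃ n : ℕ, x ∈ ball K n := by
  obtain ⟨n, hn⟩ := pow_unbounded_of_one_lt (nabs x) (one_lt_resCard K)
  exact ⟨n, by simpa [mem_ball] using hn.le⟩

lemma IsCompact.exists_subset_ball {C : Set K} (hC : IsCompact C) :
    ∃ n : ℤ, C ⊆ ball K n := by
  obtain ⟨b, hb⟩ := (hC.image continuous_nabs).bddAbove
  obtain ⟨n, hn⟩ := exists_lt_zpow K b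
  exact ⟨n, fun x hx => (hb ⟨x, hx, rfl⟩).trans hn.le⟩

/-- Needed for the open mapping theorem behind `quadHomeomorph`. -/
instance : SigmaCompactSpace K :=
  ⟨⟨fun n => ball K n, fun n => isCompact_ball _, by
    ext x
    simpa using exists_mem_ball x⟩⟩

instance : FirstCountableTopology K := by
  refine ⟨fun x => ?_⟩
  have h : (𝓝 x).HasBasis (fun _ : ℤ => True) fun n => {y | nabs (y - x) ≤ (resCard K : ℝ) ^ n} :=
    ⟨fun s => by simp [mem_nhds_iff_ball, Set.subset_def]⟩
  exact h.isCountablyGenerated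

/-- The uniformity is countably generated, so K is pseudometrizable, and σ-compactness then gives a
countable base. This makes the product σ-algebra on F × F the Borel one. -/
instance : SecondCountableTopology K := by
  let := IsTopologicalAddGroup.rightUniformSpace K
  have := isUniformAddGroup_of_addCommGroup (G := K)
  have : (uniformity K).IsCountablyGenerated := by
    rw [uniformity_eq_comap_nhds_zero]
    infer_instance
  let := UniformSpace.pseudoMetricSpace K
  infer_instance

end Basic

/-! ### Haar measure scales by the normalized absolute value. -/

section Modulus

variable {K : Type*} [Field K] [ValuativeRel K] [TopologicalSpace K] [IsNonarchimedeanLocalField K]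
  [MeasurableSpace K] [BorelSpace K]

lemma measurableSet_ball (n : ℤ) : MeasurableSet (ball K n : Set K) :=
  (isOpen_ball n).measurableSet

variable (μ : Measure K) [μ.IsAddHaarMeasure]

lemma measure_ball_ne_top (n : ℤ) : μ (ball K n) ≠ ⊤ := (isCompact_ball n).measure_lt_top.ne

lemma measure_ball_ne_zero (n : ℤ) : μ (ball K n) ≠ 0 :=
  ((isOpen_ball n).measure_pos μ ⟨0, (ball K n).zero_mem⟩).ne'

open scoped Pointwise

lemma smul_ball (a : Kˣ) (n : ℤ) :
    a • (ball K n : Set K) = ball K (n + logAbs (a : K)) := by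
  ext x
  rw [Set.mem_smul_set_iff_inv_smul_mem, SetLike.mem_coe, SetLike.mem_coe, mem_ball, mem_ball,
    Units.smul_def, smul_eq_mul, nabs_mul, Units.val_inv_eq_inv_val, nabs_inv,
    zpow_add₀ (resCard_ne_zero K), ← nabs_eq_zpow a.ne_zero, inv_mul_le_iff₀ (nabs_pos a.ne_zero),
    mul_comm]

lemma measure_smul (a : Kˣ) (s : Set K) :
    μ (a • s) = distribHaarChar K a * μ s := (distribHaarChar_mul μ a s).symm

lemma mem_integer_iff {x : K} : x ∈ 𝒪[K] ↔ nabs x ≤ 1 := by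
  rw [Valuation.mem_integer_iff, ← map_one (valuation K), ← nabs_le_nabs_iff, nabs_one]

lemma mem_maximalIdeal_iff {x : 𝒪[K]} : x ∈ 𝓂[K] ↔ (x : K) ∈ ball K (-1) := by
  have h1 : nabs (x : K) ≤ 1 := mem_integer_iff.1 x.2
  have hlt : (x : K) ∈ ball K (-1) ↔ nabs (x : K) < 1 := by
    rw [mem_ball, ← zpow_zero (resCard K : ℝ), nabs_lt_zpow_iff, zero_sub]
  rw [hlt, IsLocalRing.mem_maximalIdeal, mem_nonunits_iff, ← not_le, not_iff_not]
  constructor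
  · rintro ⟨u, rfl⟩
    have h2 : nabs ((u⁻¹ : 𝒪[K]ˣ) : K) ≤ 1 := mem_integer_iff.1 (u⁻¹ : 𝒪[K]ˣ).1.2
    have h3 : nabs ((u : 𝒪[K]) : K) * nabs ((u⁻¹ : 𝒪[K]ˣ) : K) = 1 := by
      rw [← nabs_mul, ← nabs_one (K := K)]
      congr 1
      exact_mod_cast congrArg (Subtype.val) u.mul_inv
    nlinarith [nabs_nonneg ((u : 𝒪[K]) : K)]
  · intro h
    have hx : nabs (x : K) = 1 := le_antisymm h1 h
    have hx0 : (x : K) ≠ 0 := by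
      intro h0
      rw [h0, nabs_zero] at hx
      exact zero_ne_one hx
    refine IsUnit.of_mul_eq_one ⟨(x : K)⁻¹, mem_integer_iff.2 ?_⟩ (Subtype.ext ?_)
    · rw [nabs_inv, hx, inv_one]
    · simp [hx0]

/-- The ring of integers is the disjoint union of the cosets of its maximal ideal, one for each
element of the residue field. -/
lemma measure_ball_zero : μ (ball K 0) = resCard K * μ (ball K (-1)) := by
  classical
  have : Fintype 𝓀[K] := Fintype.ofFinite _
  choose r hr using IsLocalRing.residue_surjective (R := 𝒪[K])
  have hU : (ball K 0 : Set K) = ⋃ c : 𝓀[K], (fun x : K => (r c : K) + x) '' (ball K (-1)) := by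
    ext x
    simp only [Set.mem_iUnion, Set.image_add_left, Set.mem_preimage, SetLike.mem_coe]
    constructor
    · intro hx
      have hx' : x ∈ 𝒪[K] := mem_integer_iff.2 (by simpa using mem_ball.1 hx)
      refine ⟨IsLocalRing.residue _ ⟨x, hx'⟩, ?_⟩
      have h : (⟨x, hx'⟩ - r (IsLocalRing.residue _ ⟨x, hx'⟩) : 𝒪[K]) ∈ 𝓂[K] := by
        rw [← IsLocalRing.residue_eq_zero_iff, map_sub, hr, sub_self]
      rw [mem_maximalIdeal_iff] at h
      rw [neg_add_eq_sub]
      exact h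
    · rintro ⟨c, hc⟩
      have h1 : ((r c : 𝒪[K]) : K) ∈ ball K 0 := by
        simpa [mem_ball] using mem_integer_iff.1 (r c).2
      have := (ball K 0).add_mem h1 (ball_mono (by norm_num) hc)
      simpa using this
  have hd : Pairwise (Function.onFun Disjoint
      fun c : 𝓀[K] => (fun x : K => (r c : K) + x) '' (ball K (-1) : Set K)) := by
    intro c c' hcc
    rw [Function.onFun, Set.disjoint_left]
    intro x hx hx'
    rw [Set.image_add_left, Set.mem_preimage, SetLike.mem_coe] at hx hx'
    apply hcc
    have h : (r c - r c' : 𝒪[K]) ∈ 𝓂[K] := by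
      rw [mem_maximalIdeal_iff]
      have := (ball K (-1)).sub_mem hx' hx
      have e : (-(r c' : K) + x) - (-(r c : K) + x) = ((r c - r c' : 𝒪[K]) : K) := by
        push_cast; ring
      rwa [e] at this
    rw [← IsLocalRing.residue_eq_zero_iff, map_sub, hr, hr, sub_eq_zero] at h
    exact h
  rw [hU, measure_iUnion hd]
  · simp only [Set.image_add_left, measure_preimage_add, tsum_fintype, Finset.sum_const,
      Finset.card_univ, nsmul_eq_mul, resCard, Nat.card_eq_fintype_card]
  · intro c
    rw [Set.image_add_left]
    exact (measurableSet_ball _).preimage (measurable_const_add _)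

-- Both sides are multiplicative. Units preserve the unit ball, so their modulus is 1; the modulus
-- of a uniformizer is read off from `measure_ball_zero`.
variable (K) in
omit [MeasurableSpace K] [BorelSpace K] in
lemma coe_distribHaarChar (a : Kˣ) : (distribHaarChar K a : ℝ) = nabs (a : K) := by
  borelize K
  let μ : Measure K := Measure.addHaar
  obtain ⟨b, hb0, hb⟩ := exists_nabs_eq K (-1)
  have hunif : (distribHaarChar K (Units.mk0 b hb0) : ℝ) = (resCard K : ℝ)⁻¹ := by
    have h := measure_smul μ (Units.mk0 b hb0) (ball K 0)
    rw [smul_ball, Units.val_mk0, logAbs_eq hb, zero_add, measure_ball_zero, ← mul_assoc] at h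
    have h' := congrArg ENNReal.toReal h
    rw [ENNReal.toReal_mul, ENNReal.toReal_mul, ENNReal.coe_toReal, ENNReal.toReal_natCast] at h'
    have hm : (μ (ball K (-1))).toReal ≠ 0 :=
      ENNReal.toReal_ne_zero.2 ⟨measure_ball_ne_zero μ _, measure_ball_ne_top μ _⟩
    have : (distribHaarChar K (Units.mk0 b hb0) : ℝ) * resCard K = 1 :=
      mul_right_cancel₀ hm (by rw [← h', one_mul])
    exact eq_inv_of_mul_eq_one_left this
  have hunit : ∀ u : Kˣ, logAbs (u : K) = 0 → distribHaarChar K u = 1 := by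
    intro u hu
    refine distribHaarChar_eq_of_measure_smul_eq_mul (measure_ball_ne_zero μ 0)
      (measure_ball_ne_top μ 0) ?_
    rw [smul_ball, hu]
    simp
  set ϖ := Units.mk0 b hb0 with hϖ
  -- Since |ϖ| = q⁻¹, the power `logAbs a` of ϖ cancels the absolute value of a.
  have hlog : logAbs (((a * ϖ ^ (logAbs (a : K)) : Kˣ)) : K) = 0 := by
    refine logAbs_eq ?_
    rw [Units.val_mul, Units.val_zpow_eq_zpow_val, nabs_mul, nabs_zpow, hϖ, Units.val_mk0, hb,
      nabs_eq_zpow a.ne_zero, ← zpow_mul, ← zpow_add₀ (resCard_ne_zero K)]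
    congr 1
    ring
  have h := hunit _ hlog
  rw [map_mul, map_zpow] at h
  have h' := congrArg NNReal.toReal h
  rw [NNReal.coe_mul, NNReal.coe_zpow, hunif, NNReal.coe_one, inv_zpow, ← nabs_eq_zpow a.ne_zero] at h'
  exact (mul_inv_eq_one₀ (nabs_pos a.ne_zero).ne').1 h'

lemma measure_ball (n : ℤ) : μ.real (ball K n) = (resCard K : ℝ) ^ n * μ.real (ball K 0) := by
  obtain ⟨a, ha0, ha⟩ := exists_nabs_eq K n
  have h := measure_smul μ (Units.mk0 a ha0) (ball K 0)
  rw [smul_ball, Units.val_mk0, logAbs_eq ha, zero_add] at h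
  rw [Measure.real, h, ENNReal.toReal_mul, ENNReal.coe_toReal, coe_distribHaarChar, Units.val_mk0,
    ha, Measure.real]

lemma measureReal_ball_pos (n : ℤ) : 0 < μ.real (ball K n) :=
  ENNReal.toReal_pos (measure_ball_ne_zero μ n) (measure_ball_ne_top μ n)

lemma map_mul_left_measure (a : Kˣ) :
    μ.map (fun x => (a : K) * x) = ENNReal.ofReal (nabs (a : K))⁻¹ • μ := by
  ext s hs
  have h : (fun x => (a : K) * x) ⁻¹' s = a⁻¹ • s := by
    ext x
    rw [Set.mem_smul_set_iff_inv_smul_mem, inv_inv, Units.smul_def, smul_eq_mul, Set.mem_preimage]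
  rw [Measure.map_apply (measurable_const_mul _) hs, h, measure_smul, Measure.smul_apply,
    smul_eq_mul, ← nabs_inv, ← Units.val_inv_eq_inv_val, ← coe_distribHaarChar,
    ENNReal.ofReal_coe_nnreal]

lemma measurableEmbedding_mul_left (a : Kˣ) : MeasurableEmbedding (fun x : K => (a : K) * x) :=
  (Homeomorph.mulLeft₀ (a : K) a.ne_zero).measurableEmbedding

variable {G : Type*} [NormedAddCommGroup G] [NormedSpace ℝ G]

lemma integral_comp_mul_left (a : Kˣ) (f : K → G) :
    ∫ x, f (a * x) ∂μ = (nabs (a : K))⁻¹ • ∫ x, f x ∂μ := by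
  rw [← (measurableEmbedding_mul_left a).integral_map, map_mul_left_measure, integral_smul_measure,
    ENNReal.toReal_ofReal (inv_nonneg.2 (nabs_nonneg _))]

lemma integrable_comp_mul_left_iff (a : Kˣ) (f : K → G) :
    Integrable (fun x => f (a * x)) μ ↔ Integrable f μ := by
  have h := (measurableEmbedding_mul_left a).integrable_map_iff (μ := μ) (g := f)
  rw [map_mul_left_measure, integrable_smul_measure] at h
  · exact h.symm
  · simpa using nabs_pos a.ne_zero
  · exact ENNReal.ofReal_ne_top

end Modulus

/-! ### Finite fibre decompositions and the absence of small subgroups. -/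

/-- A function that factors through a map which is locally constant near a compact set containing
its support is a finite combination of indicator functions of fibres; the finite set of
representatives depends only on the map and on the compact set. -/
lemma exists_finset_fiber_decomposition {X β : Type*} [TopologicalSpace X] {C : Set X}
    (hC : IsCompact C) (Φ : X → β) (hΦ : ∀ x ∈ C, ∀ᶠ y in 𝓝 x, Φ y = Φ x) :
    ∃ t : Finset X, ↑t ⊆ C ∧ ∀ f : X → ℂ, (∀ x y, Φ x = Φ y → f x = f y) →
      (∀ x, f x ≠ 0 → x ∈ C) → ∀ x, f x = ∑ a ∈ t, f a * Set.indicator {y | Φ y = Φ a} 1 x := by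
  classical
  have hfin : (Φ '' C).Finite := by
    refine hC.induction_on (p := fun s => (Φ '' s).Finite) (by simp)
      (fun s t hst ht => ht.subset (Set.image_mono hst))
      (fun s t hs ht => by rw [Set.image_union]; exact hs.union ht) fun x hx => ?_
    refine ⟨_, mem_nhdsWithin_of_mem_nhds (hΦ x hx), (Set.finite_singleton (Φ x)).subset ?_⟩
    rintro _ ⟨y, hy, rfl⟩
    exact hy
  obtain ⟨s, hsC, hbij⟩ := (Set.surjOn_image Φ C).exists_bijOn_subset
  have hs : s.Finite := hbij.finite_iff_finite.2 hfin
  refine ⟨hs.toFinset, by simpa using hsC, fun f hf hsupp x => ?_⟩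
  by_cases hx : f x = 0
  · rw [hx, eq_comm]
    refine Finset.sum_eq_zero fun a _ => ?_
    by_cases h : Φ x = Φ a
    · rw [← hf x a h, hx, zero_mul]
    · rw [Set.indicator_of_notMem (by simpa using h), mul_zero]
  · obtain ⟨a, has, ha⟩ := hbij.surjOn ⟨x, hsupp x hx, rfl⟩
    rw [Finset.sum_eq_single a]
    · rw [Set.indicator_of_mem (by simpa using ha.symm), Pi.one_apply, mul_one, hf a x ha]
    · intro b hb hba
      rw [Set.indicator_of_notMem, mul_zero]
      intro hxb
      exact hba (hbij.injOn (by simpa using hb) has (by rw [ha]; exact hxb.symm))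
    · intro h
      exact absurd (by simpa using has) h

/-- There are no small subgroups near `1`. -/
lemma eq_one_of_norm_pow_sub_one_le {z : ℂ} (h : ∀ n : ℕ, ‖z ^ n - 1‖ ≤ 1 / 2) : z = 1 := by
  -- Squaring expands the distance to 1: w² - 1 = (w - 1)(w + 1) and |w + 1| ≥ 2 - 1/2. Unless z = 1
  -- the distance would become unbounded.
  have key : ∀ n : ℕ, (3 / 2 : ℝ) ^ n * ‖z - 1‖ ≤ ‖z ^ 2 ^ n - 1‖ := by
    intro n
    induction n with
    | zero => simp
    | succ n ih =>
      set w := z ^ 2 ^ n with hw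
      have e : z ^ 2 ^ (n + 1) - 1 = (w - 1) * (w + 1) := by rw [hw, pow_succ, pow_mul]; ring
      have h2 : (3 / 2 : ℝ) ≤ ‖w + 1‖ := by
        have h3 : ‖(2 : ℂ)‖ ≤ ‖w + 1‖ + ‖w - 1‖ := by
          calc ‖(2 : ℂ)‖ = ‖(w + 1) - (w - 1)‖ := by ring_nf
            _ ≤ _ := norm_sub_le _ _
        have h4 := h (2 ^ n)
        rw [Complex.norm_ofNat] at h3
        linarith
      rw [e, norm_mul, pow_succ]
      nlinarith [norm_nonneg (w - 1), norm_nonneg (z - 1)]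
  by_contra hz
  have hpos : 0 < ‖z - 1‖ := norm_pos_iff.2 (sub_ne_zero.2 hz)
  obtain ⟨n, hn⟩ := pow_unbounded_of_one_lt (1 / ‖z - 1‖) (by norm_num : (1 : ℝ) < 3 / 2)
  rw [div_lt_iff₀ hpos] at hn
  linarith [key n, h (2 ^ n)]

/-! ### Multiplicative characters and their local constancy. -/

section Characters

variable {K : Type*} [Field K] [ValuativeRel K] [TopologicalSpace K] [IsNonarchimedeanLocalField K]

lemma nabs_eq_one_of_sub_one_mem {k : ℤ} (hk : k < 0) {x : K} (hx : x - 1 ∈ ball K k) :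
    nabs x = 1 := by
  rw [← nabs_one (K := K)]
  refine nabs_eq_of_sub_lt (lt_of_le_of_lt (mem_ball.1 hx) ?_)
  rw [nabs_one]
  exact zpow_lt_one_of_neg₀ (one_lt_resCard K) hk

lemma mul_mem_ball {m n : ℤ} {x y : K} (hx : nabs x ≤ (resCard K : ℝ) ^ m) (hy : y ∈ ball K n) :
    x * y ∈ ball K (m + n) := by
  rw [mem_ball, nabs_mul, zpow_add₀ (resCard_ne_zero K)]
  exact mul_le_mul hx hy (nabs_nonneg _) (zpow_pos (resCard_pos' K) _).le

lemma mul_mem_ball_of_nabs_le_one {n : ℤ} {x y : K} (hx : nabs x ≤ 1) (hy : y ∈ ball K n) :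
    x * y ∈ ball K n := by
  simpa using mul_mem_ball (m := 0) (by simpa using hx) hy

variable (K) in
/-- The group of units congruent to `1` modulo the ball of radius `q ^ k`, for `k < 0`. -/
def unitBall (k : ℤ) (hk : k < 0) : Subgroup Kˣ where
  carrier := {u | (u : K) - 1 ∈ ball K k}
  mul_mem' := fun {u v} hu hv => by
    have e : ((u * v : Kˣ) : K) - 1 = u * (v - 1) + (u - 1) := by rw [Units.val_mul]; ring
    rw [Set.mem_ofPred_eq] at hu hv ⊢
    rw [e]
    exact (ball K k).add_mem
      (mul_mem_ball_of_nabs_le_one (nabs_eq_one_of_sub_one_mem hk hu).le hv) hu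
  one_mem' := by simp [(ball K k).zero_mem]
  inv_mem' := fun {u} hu => by
    have e : ((u⁻¹ : Kˣ) : K) - 1 = (u⁻¹ : Kˣ) * (1 - u) := by
      rw [mul_sub, Units.inv_mul, mul_one]
    rw [Set.mem_ofPred_eq] at hu ⊢
    rw [e]
    refine mul_mem_ball_of_nabs_le_one ?_ ?_
    · rw [Units.val_inv_eq_inv_val, nabs_inv, nabs_eq_one_of_sub_one_mem hk hu, inv_one]
    · rw [← neg_sub]
      exact (ball K k).neg_mem hu

lemma mem_unitBall {k : ℤ} {hk : k < 0} {u : Kˣ} :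
    u ∈ unitBall K k hk ↔ (u : K) - 1 ∈ ball K k := Iff.rfl

/-- By continuity a small group of units maps into the disc of radius 1/2 around 1, and such an
image is trivial by `eq_one_of_norm_pow_sub_one_le`. -/
lemma exists_trivial_on_unitBall {ξ : Kˣ →* ℂˣ} (hξ : Continuous ξ) :
    ∃ (k : ℤ) (hk : k < 0), ∀ u ∈ unitBall K k hk, ξ u = 1 := by
  have h1 : ContinuousAt (fun u : Kˣ => (ξ u : ℂ)) 1 :=
    (Units.continuous_val.comp hξ).continuousAt
  have h2 : {u : Kˣ | ‖(ξ u : ℂ) - 1‖ ≤ 1 / 2} ∈ 𝓝 (1 : Kˣ) := by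
    have := h1 (Metric.closedBall_mem_nhds _ (by norm_num : (0 : ℝ) < 1 / 2))
    simpa [dist_eq_norm, Metric.closedBall, Set.preimage] using this
  rw [Units.isEmbedding_val₀.isInducing.nhds_eq_comap, mem_comap] at h2
  obtain ⟨t, ht, hts⟩ := h2
  obtain ⟨n, hn⟩ := mem_nhds_iff_ball.1 ht
  refine ⟨min n (-1), (min_le_right _ _).trans_lt (by norm_num), fun u hu => ?_⟩
  refine Units.ext (eq_one_of_norm_pow_sub_one_le fun m => ?_)
  have hm : u ^ m ∈ unitBall K (min n (-1)) ((min_le_right _ _).trans_lt (by norm_num)) :=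
    Subgroup.pow_mem _ hu m
  have := hts (hn _ (ball_mono (min_le_left _ _) (mem_unitBall.1 hm)))
  rw [Set.mem_ofPred_eq, map_pow, Units.val_pow_eq_pow_val] at this
  exact this

lemma charFun_zero (ξ : Kˣ →* ℂˣ) : charFun ξ 0 = 0 := by simp [charFun]

lemma charFun_of_ne_zero (ξ : Kˣ →* ℂˣ) {x : K} (hx : x ≠ 0) :
    charFun ξ x = ξ (Units.mk0 x hx) := by simp [charFun, hx]

lemma charFun_units (ξ : Kˣ →* ℂˣ) (u : Kˣ) : charFun ξ (u : K) = ξ u := by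
  rw [charFun_of_ne_zero ξ u.ne_zero, Units.mk0_val]

lemma charFun_ne_zero (ξ : Kˣ →* ℂˣ) {x : K} (hx : x ≠ 0) : charFun ξ x ≠ 0 := by
  rw [charFun_of_ne_zero ξ hx]
  exact Units.ne_zero _

lemma charFun_mul (ξ : Kˣ →* ℂˣ) (x y : K) : charFun ξ (x * y) = charFun ξ x * charFun ξ y := by
  by_cases hx : x = 0
  · simp [hx, charFun_zero]
  by_cases hy : y = 0
  · simp [hy, charFun_zero]
  rw [charFun_of_ne_zero ξ hx, charFun_of_ne_zero ξ hy, charFun_of_ne_zero ξ (mul_ne_zero hx hy),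
    ← Units.val_mul, ← map_mul]
  congr 2
  ext
  rfl

lemma charFun_one (ξ : Kˣ →* ℂˣ) : charFun ξ 1 = 1 := by
  rw [← Units.val_one, charFun_units, map_one, Units.val_one]

lemma charFun_mul_char (ξ η : Kˣ →* ℂˣ) (x : K) :
    charFun (ξ * η) x = charFun ξ x * charFun η x := by
  by_cases hx : x = 0
  · simp [hx, charFun_zero]
  simp [charFun_of_ne_zero _ hx]

lemma charFun_inv_char (ξ : Kˣ →* ℂˣ) (x : K) : charFun ξ⁻¹ x = (charFun ξ x)⁻¹ := by
  by_cases hx : x = 0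
  · simp [hx, charFun_zero]
  simp [charFun_of_ne_zero _ hx]

lemma charFun_inv (ξ : Kˣ →* ℂˣ) (x : K) : charFun ξ x⁻¹ = (charFun ξ x)⁻¹ := by
  by_cases hx : x = 0
  · simp [hx, charFun_zero]
  · refine eq_inv_of_mul_eq_one_left ?_
    rw [← charFun_mul, inv_mul_cancel₀ hx, charFun_one]

lemma charFun_absChar (s : ℂ) {x : K} (hx : x ≠ 0) :
    charFun (absChar K s) x = (nabs x : ℂ) ^ s := by
  rw [charFun_of_ne_zero _ hx]
  rfl

lemma charFun_absChar_neg_one (x : K) : charFun (absChar K (-1)) x = (nabs x : ℂ)⁻¹ := by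
  by_cases hx : x = 0
  · simp [hx, charFun_zero, nabs_zero]
  · rw [charFun_absChar _ hx, Complex.cpow_neg_one]

lemma charFun_absChar_one (x : K) : charFun (absChar K 1) x = (nabs x : ℂ) := by
  by_cases hx : x = 0
  · simp [hx, charFun_zero, nabs_zero]
  · rw [charFun_absChar _ hx, Complex.cpow_one]

lemma absChar_apply_of_nabs_eq_one (s : ℂ) {u : Kˣ} (hu : nabs (u : K) = 1) :
    absChar K s u = 1 := by
  ext
  rw [← charFun_units, charFun_absChar _ u.ne_zero, hu]
  simp

lemma absChar_add (s t : ℂ) : absChar K (s + t) = absChar K s * absChar K t := by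
  ext u
  rw [MonoidHom.mul_apply, Units.val_mul, ← charFun_units, ← charFun_units, ← charFun_units,
    charFun_absChar _ u.ne_zero, charFun_absChar _ u.ne_zero, charFun_absChar _ u.ne_zero]
  exact Complex.cpow_add _ _ (by exact_mod_cast (nabs_pos u.ne_zero).ne')

lemma absChar_zero : absChar K 0 = 1 := by
  ext u
  rw [← charFun_units, charFun_absChar _ u.ne_zero]
  simp

/-- The quotient y / x lies in the group of units on which ξ is trivial. The radius of constancy
depends on ξ only through k, which is what makes later bounds uniform in twists. -/
lemma charFun_eq_of_sub_mem {ξ : Kˣ →* ℂˣ} {k : ℤ} {hk : k < 0}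
    (hξ : ∀ u ∈ unitBall K k hk, ξ u = 1) {x y : K} (hx : x ≠ 0)
    (hy : y - x ∈ ball K (logAbs x + k)) : charFun ξ y = charFun ξ x := by
  have h1 : y / x - 1 ∈ ball K k := by
    rw [div_sub_one hx, mem_ball, nabs_div, nabs_eq_zpow hx, div_le_iff₀
      (zpow_pos (resCard_pos' K) _), ← zpow_add₀ (resCard_ne_zero K), add_comm]
    exact hy
  have h0 : y / x ≠ 0 := by
    intro h
    have := nabs_eq_one_of_sub_one_mem hk h1
    rw [h, nabs_zero] at this
    exact zero_ne_one this
  have e : y = y / x * x := (div_mul_cancel₀ y hx).symm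
  rw [e, charFun_mul, charFun_of_ne_zero ξ h0, hξ _ (mem_unitBall.2 h1), Units.val_one, one_mul]

lemma eventually_charFun_eq {ξ : Kˣ →* ℂˣ} (hξ : Continuous ξ) {x : K} (hx : x ≠ 0) :
    ∀ᶠ y in 𝓝 x, charFun ξ y = charFun ξ x := by
  obtain ⟨k, hk, h⟩ := exists_trivial_on_unitBall hξ
  exact mem_nhds_iff_ball.2 ⟨logAbs x + k, fun y hy => charFun_eq_of_sub_mem h hx hy⟩

lemma continuous_of_trivial_on_unitBall {ξ : Kˣ →* ℂˣ} {k : ℤ} {hk : k < 0}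
    (hξ : ∀ u ∈ unitBall K k hk, ξ u = 1) : Continuous ξ := by
  refine continuous_of_continuousAt_one ξ ?_
  rw [ContinuousAt, map_one]
  refine tendsto_const_nhds.congr' (EventuallyEq.symm ?_)
  have h : ∀ᶠ x in 𝓝 ((1 : Kˣ) : K), x - 1 ∈ ball K k :=
    mem_nhds_iff_ball.2 ⟨k, fun y hy => by simpa [mem_ball] using hy⟩
  filter_upwards [Units.continuous_val.continuousAt.eventually h] with u hu
  exact hξ u hu

lemma continuous_absChar (s : ℂ) : Continuous (absChar K s) :=
  continuous_of_trivial_on_unitBall (k := -1) (hk := by norm_num) fun _ hu =>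
    absChar_apply_of_nabs_eq_one s (nabs_eq_one_of_sub_one_mem (by norm_num) hu)

end Characters

/-! ### Test functions, dilations and integrals against characters. -/

section TestFunctions

variable {K : Type*} [Field K] [ValuativeRel K] [TopologicalSpace K] [IsNonarchimedeanLocalField K]

lemma add_mem_ball_iff {n : ℤ} {x b : K} (hb : b ∈ ball K n) : x + b ∈ ball K n ↔ x ∈ ball K n :=
  (ball K n).add_mem_cancel_right hb

lemma mem_testFunctions_of_invariant {f : K → ℂ} {k M : ℤ}
    (hk : ∀ x, ∀ b ∈ ball K k, f (x + b) = f x) (hM : ∀ x, f x ≠ 0 → x ∈ ball K M) :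
    f ∈ testFunctions K := by
  refine ⟨(IsLocallyConstant.iff_eventually_eq f).2 fun x => ?_,
    HasCompactSupport.intro (isCompact_ball M) fun x hx => by_contra fun h => hx (hM x h)⟩
  refine mem_nhds_iff_ball.2 ⟨k, fun y hy => ?_⟩
  rw [Set.mem_ofPred_eq, ← hk x (y - x) hy, add_sub_cancel]

/-- Compactness makes the radius of local constancy uniform. In this form the Fourier transform
simply exchanges the invariance radius and the support radius. -/
lemma exists_invariant_of_mem_testFunctions {f : K → ℂ} (hf : f ∈ testFunctions K) :
    ∃ k M : ℤ, (∀ x, ∀ b ∈ ball K k, f (x + b) = f x) ∧ ∀ x, f x ≠ 0 → x ∈ ball K M := by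
  obtain ⟨M, hM⟩ := IsCompact.exists_subset_ball (HasCompactSupport.isCompact hf.2)
  have hM' : ∀ x, f x ≠ 0 → x ∈ ball K M := fun x hx => hM (subset_tsupport f hx)
  have key : ∃ k : ℤ, ∀ x ∈ (ball K M : Set K), ∀ b ∈ ball K k, f (x + b) = f x := by
    refine (isCompact_ball M).induction_on
      (p := fun s => ∃ k : ℤ, ∀ x ∈ s, ∀ b ∈ ball K k, f (x + b) = f x) ⟨0, by simp⟩
      (fun s t hst ⟨k, hk⟩ => ⟨k, fun x hx => hk x (hst hx)⟩) ?_ fun x _ => ?_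
    · rintro s t ⟨k, hk⟩ ⟨l, hl⟩
      refine ⟨min k l, fun x hx b hb => ?_⟩
      rcases hx with hx | hx
      · exact hk x hx b (ball_mono (min_le_left _ _) hb)
      · exact hl x hx b (ball_mono (min_le_right _ _) hb)
    · obtain ⟨n, hn⟩ := mem_nhds_iff_ball.1 (((IsLocallyConstant.iff_eventually_eq f).1 hf.1) x)
      refine ⟨{y | y - x ∈ ball K n}, mem_nhdsWithin_of_mem_nhds
        (mem_nhds_iff_ball.2 ⟨n, fun y hy => hy⟩), n, fun y hy b hb => ?_⟩
      have h1 : f y = f x := hn y hy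
      have h2 : f (y + b) = f x := hn (y + b) (by
        rw [add_sub_right_comm]
        exact (ball K n).add_mem hy hb)
      rw [h1, h2]
  obtain ⟨k, hk⟩ := key
  -- With a radius of at most q^M, translations also preserve the complement of the support ball,
  -- where f vanishes.
  refine ⟨min k M, M, fun x b hb => ?_, hM'⟩
  by_cases hx : x ∈ ball K M
  · exact hk x hx b (ball_mono (min_le_left _ _) hb)
  · have h1 : f x = 0 := by_contra fun h => hx (hM' x h)
    have h2 : f (x + b) = 0 := by_contra fun h =>
      hx ((add_mem_ball_iff (ball_mono (min_le_right _ _) hb)).1 (hM' _ h))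
    rw [h1, h2]

lemma charFun_mul_mem_testFunctions {ξ : Kˣ →* ℂˣ} (hξ : Continuous ξ) {f : K → ℂ}
    (hf : f ∈ testFunctions K) (h0 : f 0 = 0) : (fun x => charFun ξ x * f x) ∈ testFunctions K := by
  refine ⟨(IsLocallyConstant.iff_eventually_eq _).2 fun x => ?_, hf.2.mul_left⟩
  have hfx := (IsLocallyConstant.iff_eventually_eq f).1 hf.1 x
  by_cases hx : x = 0
  · filter_upwards [hfx] with y hy
    rw [hy, hx, h0, mul_zero, mul_zero]
  · filter_upwards [hfx, eventually_charFun_eq hξ hx] with y hy hy'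
    rw [hy, hy']

lemma indicator_mem_testFunctions {s : Set K} (ho : IsOpen s) (hc : IsCompact s) :
    s.indicator (1 : K → ℂ) ∈ testFunctions K := by
  classical
  refine ⟨(IsLocallyConstant.iff_eventually_eq _).2 fun x => ?_,
    HasCompactSupport.intro hc fun x hx => Set.indicator_of_notMem hx _⟩
  by_cases hx : x ∈ s
  · filter_upwards [ho.mem_nhds hx] with y hy
    rw [Set.indicator_of_mem hx, Set.indicator_of_mem hy, Pi.one_apply, Pi.one_apply]
  · filter_upwards [hc.isClosed.isOpen_compl.mem_nhds hx] with y hy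
    rw [Set.indicator_of_notMem hx, Set.indicator_of_notMem hy]

lemma dilate_apply (a : Kˣ) (f : testFunctions K) (x : K) :
    (dilate a f).1 x = f.1 ((a⁻¹ : Kˣ) * x) := rfl

lemma dilate_apply_zero (a : Kˣ) (f : testFunctions K) : (dilate a f).1 0 = f.1 0 := by
  rw [dilate_apply, mul_zero]

lemma dilate_dilate (a b : Kˣ) (f : testFunctions K) :
    dilate a (dilate b f) = dilate b (dilate a f) := by
  ext x
  simp only [dilate_apply, ← mul_assoc, mul_comm]

lemma dilate_sub (a : Kˣ) (f g : testFunctions K) : dilate a (f - g) = dilate a f - dilate a g :=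
  rfl

variable [MeasurableSpace K] [BorelSpace K] (μ : Measure K) [μ.IsAddHaarMeasure]

lemma integrable_of_mem_testFunctions {f : K → ℂ} (hf : f ∈ testFunctions K) : Integrable f μ :=
  hf.1.continuous.integrable_of_hasCompactSupport hf.2

lemma integrable_charFun_mul {ξ : Kˣ →* ℂˣ} (hξ : Continuous ξ) {f : K → ℂ}
    (hf : f ∈ testFunctions K) (h0 : f 0 = 0) : Integrable (fun x => charFun ξ x * f x) μ :=
  integrable_of_mem_testFunctions μ (charFun_mul_mem_testFunctions hξ hf h0)

lemma integral_comp_mul_left' (a : Kˣ) (f : K → ℂ) :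
    ∫ x, f ((a⁻¹ : Kˣ) * x) ∂μ = (nabs (a : K) : ℂ) * ∫ x, f x ∂μ := by
  rw [integral_comp_mul_left, Units.val_inv_eq_inv_val, nabs_inv, inv_inv, Complex.real_smul]

lemma integral_charFun_mul_dilate (ξ : Kˣ →* ℂˣ) (a : Kˣ) (f : testFunctions K) :
    ∫ x, charFun ξ x * (dilate a f).1 x ∂μ =
      (ξ a : ℂ) * (nabs (a : K) : ℂ) * ∫ x, charFun ξ x * f.1 x ∂μ := by
  have h := integral_comp_mul_left' μ a (fun x => charFun ξ x * f.1 x)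
  rw [mul_assoc, ← h, ← integral_const_mul]
  refine integral_congr_ae (.of_forall fun x => ?_)
  simp only [dilate_apply]
  rw [charFun_mul, charFun_units, ← mul_assoc, ← mul_assoc, ← Units.val_mul, ← map_mul,
    mul_inv_cancel, map_one, Units.val_one, one_mul]

end TestFunctions

/-! ### The Fourier transform on test functions and its inversion constant. -/

section Fourier

variable {K : Type*} [Field K] [ValuativeRel K] [TopologicalSpace K] [IsNonarchimedeanLocalField K]

/-- `ψ` is trivial on the ball of radius `q ^ e`, but not on that of radius `q ^ (e + 1)`. -/
def IsConductor (ψ : AddChar K Circle) (e : ℤ) : Prop :=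
  (∀ b ∈ ball K e, ψ b = 1) ∧ ∃ b ∈ ball K (e + 1), ψ b ≠ 1

/-- ψ is trivial on some ball because the circle has no small subgroups, and a point with ψ(y) ≠ 1
bounds the radii of such balls; e is the largest exponent. -/
lemma exists_isConductor {ψ : AddChar K Circle} (hψ : Continuous ψ) (h1 : ψ ≠ 1) :
    ∃ e, IsConductor ψ e := by
  obtain ⟨y, hy⟩ := (AddChar.ne_one_iff).1 h1
  obtain ⟨m, hm⟩ := exists_mem_ball y
  have h2 : {b : K | ‖((ψ b : Circle) : ℂ) - 1‖ ≤ 1 / 2} ∈ 𝓝 (0 : K) := by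
    have h3 : ContinuousAt (fun b : K => ((ψ b : Circle) : ℂ)) 0 :=
      (continuous_subtype_val.comp hψ).continuousAt
    have h4 : ((ψ 0 : Circle) : ℂ) = 1 := by simp
    have := h3 (Metric.closedBall_mem_nhds _ (by norm_num : (0 : ℝ) < 1 / 2))
    simpa only [h4, dist_eq_norm, Metric.closedBall, Set.preimage, mem_map, Set.mem_ofPred_eq]
      using this
  obtain ⟨k, hk⟩ := mem_nhds_zero_iff_ball.1 h2
  have hk' : ∀ b ∈ ball K k, ψ b = 1 := by
    intro b hb
    refine Subtype.ext (eq_one_of_norm_pow_sub_one_le fun n => ?_)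
    have := hk ((ball K k).nsmul_mem hb n)
    rw [Set.mem_ofPred_eq, AddChar.map_nsmul_eq_pow] at this
    exact this
  obtain ⟨e, he, hmax⟩ := Int.exists_greatest_of_bdd (P := fun k => ∀ b ∈ ball K k, ψ b = 1)
    ⟨m, fun z hz => by
      by_contra hzm
      exact hy (hz y (ball_mono (not_le.1 hzm).le hm))⟩ ⟨k, hk'⟩
  refine ⟨e, he, ?_⟩
  by_contra h
  push Not at h
  exact absurd (hmax _ h) (by omega)

lemma IsConductor.exists_ne_one {ψ : AddChar K Circle} {e : ℤ} (h : IsConductor ψ e) {k : ℤ}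
    {x : K} (hx : x ∉ ball K (e - k)) : ∃ b ∈ ball K k, ψ (x * b) ≠ 1 := by
  obtain ⟨b, hb, hψ⟩ := h.2
  have hx0 : x ≠ 0 := by
    rintro rfl
    exact hx (ball K _).zero_mem
  refine ⟨b / x, ?_, by rwa [mul_div_cancel₀ _ hx0]⟩
  rw [mem_ball, not_le, nabs_eq_zpow hx0, zpow_lt_zpow_iff_right₀ (one_lt_resCard K)] at hx
  rw [mem_ball, nabs_div, nabs_eq_zpow hx0, div_le_iff₀ (zpow_pos (resCard_pos' K) _),
    ← zpow_add₀ (resCard_ne_zero K)]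
  exact (mem_ball.1 hb).trans (zpow_le_zpow_right₀ (one_lt_resCard K).le (by omega))

lemma IsConductor.eq_one {ψ : AddChar K Circle} {e : ℤ} (h : IsConductor ψ e) {k : ℤ}
    {x b : K} (hx : x ∈ ball K (e - k)) (hb : b ∈ ball K k) : ψ (x * b) = 1 :=
  h.1 _ (by simpa using mul_mem_ball (mem_ball.1 hx) hb)

variable [MeasurableSpace K] [BorelSpace K] (μ : Measure K) [μ.IsAddHaarMeasure]

lemma integral_indicator_one_complex {s : Set K} (hs : MeasurableSet s) :
    ∫ x, s.indicator (1 : K → ℂ) x ∂μ = μ.real s := by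
  simp [integral_indicator hs]

/-- Substitute y + b for y. As a consequence the transform vanishes wherever ψ(xb) ≠ 1 for some
period b of f. -/
lemma fourier_eq_mul_fourier {ψ : AddChar K Circle} {f : K → ℂ} {b : K}
    (hb : ∀ x, f (x + b) = f x) (x : K) :
    fourier μ ψ f x = ψ (x * b) * fourier μ ψ f x := by
  conv_lhs => rw [fourier, ← integral_add_right_eq_self _ b]
  rw [fourier, ← integral_const_mul]
  refine integral_congr_ae (.of_forall fun y => ?_)
  simp only
  rw [hb, mul_add, AddChar.map_add_eq_mul, Circle.coe_mul]
  ring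

lemma fourier_eq_zero_of_notMem {ψ : AddChar K Circle} {e : ℤ} (hψ : IsConductor ψ e)
    {f : K → ℂ} {k : ℤ} (hk : ∀ x, ∀ b ∈ ball K k, f (x + b) = f x) {x : K}
    (hx : x ∉ ball K (e - k)) : fourier μ ψ f x = 0 := by
  obtain ⟨b, hb, hne⟩ := hψ.exists_ne_one hx
  have h := fourier_eq_mul_fourier μ (ψ := ψ) (fun x => hk x b hb) x
  by_contra h0
  exact hne (Subtype.ext (mul_right_cancel₀ h0 (by rw [← h]; simp)))

lemma fourier_add_eq {ψ : AddChar K Circle} {e : ℤ} (hψ : IsConductor ψ e)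
    {f : K → ℂ} {M : ℤ} (hM : ∀ x, f x ≠ 0 → x ∈ ball K M) (x : K) {b : K}
    (hb : b ∈ ball K (e - M)) : fourier μ ψ f (x + b) = fourier μ ψ f x := by
  refine integral_congr_ae (.of_forall fun y => ?_)
  by_cases hy : f y = 0
  · simp [hy]
  · simp only
    rw [add_mul, AddChar.map_add_eq_mul, hψ.eq_one hb (hM y hy), mul_one]

lemma fourier_mem_testFunctions {ψ : AddChar K Circle} {e : ℤ} (hψ : IsConductor ψ e)
    {f : K → ℂ} (hf : f ∈ testFunctions K) : fourier μ ψ f ∈ testFunctions K := by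
  obtain ⟨k, M, hk, hM⟩ := exists_invariant_of_mem_testFunctions hf
  exact mem_testFunctions_of_invariant (fun x b hb => fourier_add_eq μ hψ hM x hb)
    (fun x hx => by_contra fun h => hx (fourier_eq_zero_of_notMem μ hψ hk h))

lemma ball_indicator_add (k : ℤ) (x : K) {b : K} (hb : b ∈ ball K k) :
    Set.indicator (ball K k : Set K) (1 : K → ℂ) (x + b) =
      Set.indicator (ball K k : Set K) 1 x := by
  classical
  simp only [Set.indicator_apply, SetLike.mem_coe, add_mem_ball_iff hb, Pi.one_apply]

lemma fourier_indicator_ball {ψ : AddChar K Circle} {e : ℤ} (hψ : IsConductor ψ e) (k : ℤ) (x : K) :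
    fourier μ ψ (Set.indicator (ball K k : Set K) 1) x =
      μ.real (ball K k) * Set.indicator (ball K (e - k) : Set K) 1 x := by
  by_cases hx : x ∈ ball K (e - k)
  · rw [Set.indicator_of_mem (by exact hx), Pi.one_apply, mul_one, fourier]
    calc ∫ y, (ψ (x * y) : ℂ) * Set.indicator (ball K k : Set K) 1 y ∂μ
        = ∫ y, Set.indicator (ball K k : Set K) 1 y ∂μ := by
          refine integral_congr_ae (.of_forall fun y => ?_)
          by_cases hy : y ∈ ball K k
          · simp [hψ.eq_one hx hy]
          · simp [Set.indicator_of_notMem (show y ∉ (ball K k : Set K) from hy)]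
      _ = _ := by
          rw [integral_indicator_one_complex μ (measurableSet_ball k)]
  · rw [Set.indicator_of_notMem (by exact hx), mul_zero]
    exact fourier_eq_zero_of_notMem μ hψ (fun x b hb => ball_indicator_add k x hb) hx

lemma fourier_dilate (ψ : AddChar K Circle) (a : Kˣ) (f : testFunctions K) (x : K) :
    fourier μ ψ (dilate a f).1 x = (nabs (a : K) : ℂ) * fourier μ ψ f.1 (a * x) := by
  rw [fourier, fourier, ← integral_comp_mul_left']
  refine integral_congr_ae (.of_forall fun y => ?_)
  simp only [dilate_apply]
  congr 3
  rw [mul_mul_mul_comm, ← Units.val_mul, mul_inv_cancel, Units.val_one, one_mul]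

/-- The transform of f lives on a ball, so its indicator can be inserted and the integrals
exchanged. The transform of this indicator is supported on a ball by which f is invariant, so only
the value f(x) survives. -/
lemma isInversionConstant {ψ : AddChar K Circle} {e : ℤ} (hψ : IsConductor ψ e)
    (hc : Continuous ψ) :
    IsInversionConstant μ ψ ((resCard K : ℝ) ^ e * μ.real (ball K 0) ^ 2)⁻¹ := by
  intro f hf x
  obtain ⟨k, M, hk, hM⟩ := exists_invariant_of_mem_testFunctions hf
  set N := e - k with hN
  set I : K → ℂ := Set.indicator (ball K N : Set K) 1 with hI
  have hIc : Continuous I :=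
    (indicator_mem_testFunctions (isOpen_ball N) (isCompact_ball N)).1.continuous
  have hψc : Continuous fun x : K => ((ψ x : Circle) : ℂ) := continuous_subtype_val.comp hc
  have h1 : ∫ y, (ψ (-(x * y)) : ℂ) * fourier μ ψ f y ∂μ =
      ∫ y, ∫ z, I y * ψ ((z - x) * y) * f z ∂μ ∂μ := by
    refine integral_congr_ae (.of_forall fun y => ?_)
    simp only
    by_cases hy : y ∈ ball K N
    · rw [fourier, ← integral_const_mul]
      refine integral_congr_ae (.of_forall fun z => ?_)
      simp only
      rw [hI, Set.indicator_of_mem (by exact hy), Pi.one_apply, one_mul, ← mul_assoc,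
        ← Circle.coe_mul, ← AddChar.map_add_eq_mul]
      congr 3
      ring_nf
    · rw [fourier_eq_zero_of_notMem μ hψ hk hy, hI]
      simp [Set.indicator_of_notMem (show y ∉ (ball K N : Set K) from hy)]
  have hswap : ∫ y, ∫ z, I y * ψ ((z - x) * y) * f z ∂μ ∂μ =
      ∫ z, ∫ y, I y * ψ ((z - x) * y) * f z ∂μ ∂μ := by
    refine integral_integral_swap_of_hasCompactSupport ?_ ?_
    · have := hf.1.continuous
      simp only [Function.uncurry_def]
      fun_prop
    · refine HasCompactSupport.intro ((isCompact_ball N).prod (isCompact_ball M)) ?_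
      rintro ⟨y, z⟩ h
      rw [Set.mem_prod, not_and_or] at h
      rcases h with h | h
      · simp [Function.uncurry, hI, Set.indicator_of_notMem h]
      · have : f z = 0 := by_contra fun h' => h (hM z h')
        simp [Function.uncurry, this]
  have h2 : ∀ z, ∫ y, I y * ψ ((z - x) * y) * f z ∂μ =
      f x * (μ.real (ball K N) * Set.indicator (ball K k : Set K) 1 (z - x)) := by
    intro z
    rw [integral_mul_const]
    have h3 := fourier_indicator_ball μ hψ N (z - x)
    rw [fourier, hN, sub_sub_cancel, ← hN] at h3
    have h4 : ∫ y, I y * (ψ ((z - x) * y) : ℂ) ∂μ =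
        μ.real (ball K N) * Set.indicator (ball K k : Set K) 1 (z - x) := by
      rw [← h3]
      exact integral_congr_ae (.of_forall fun y => mul_comm _ _)
    rw [h4]
    by_cases hz : z - x ∈ ball K k
    · have hfz : f z = f x := by
        have := hk x (z - x) hz
        rwa [add_sub_cancel] at this
      rw [hfz, mul_comm]
    · rw [Set.indicator_of_notMem (by exact hz), mul_zero, mul_zero, zero_mul]
  rw [h1, hswap]
  simp only [h2]
  rw [integral_const_mul, integral_const_mul,
    integral_sub_right_eq_self (Set.indicator (ball K k : Set K) (1 : K → ℂ)) x,
    integral_indicator_one_complex μ (measurableSet_ball k)]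
  have hm : μ.real (ball K 0) ≠ 0 := (measureReal_ball_pos μ 0).ne'
  have hq := resCard_ne_zero K
  rw [measure_ball μ N, measure_ball μ k, hN]
  -- The volumes of the two dual balls have a product independent of f.
  have h4 : (resCard K : ℝ) ^ (e - k) * (resCard K : ℝ) ^ k = (resCard K : ℝ) ^ e := by
    rw [← zpow_add₀ hq, sub_add_cancel]
  have h5 : ((resCard K : ℝ) ^ (e - k) * μ.real (ball K 0)) *
      ((resCard K : ℝ) ^ k * μ.real (ball K 0)) = (resCard K : ℝ) ^ e * μ.real (ball K 0) ^ 2 := by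
    rw [← h4]; ring
  have h6 : (resCard K : ℝ) ^ e * μ.real (ball K 0) ^ 2 ≠ 0 :=
    mul_ne_zero (zpow_ne_zero _ hq) (pow_ne_zero _ hm)
  have h7 := inv_mul_cancel₀ h6
  rw [← h5] at h7 ⊢
  have h8 := congrArg (fun r : ℝ => (r : ℂ)) h7
  push_cast at h8 ⊢
  linear_combination (- f x) * h8

end Fourier

/-! ### Homogeneous distributions and existence of gamma factors. -/

section GammaExistence

variable {K : Type*} [Field K] [ValuativeRel K] [TopologicalSpace K] [IsNonarchimedeanLocalField K]

lemma ball_translate_isOpen (c : K) (k : ℤ) : IsOpen {x : K | x - c ∈ ball K k} :=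
  (isOpen_ball k).preimage (continuous_id.sub continuous_const)

lemma ball_translate_isCompact (c : K) (k : ℤ) : IsCompact {x : K | x - c ∈ ball K k} := by
  have : {x : K | x - c ∈ ball K k} = (fun x => x + c) '' (ball K k) := by
    ext x
    simp [sub_eq_add_neg]
  rw [this]
  exact (isCompact_ball k).image (continuous_id.add continuous_const)

variable (K) in
/-- The indicator function of `1 + B`, where `B` is the ball of radius `q ^ k`. -/
def unitIndicator (k : ℤ) : testFunctions K :=
  ⟨Set.indicator {x | x - 1 ∈ ball K k} 1,
    indicator_mem_testFunctions (ball_translate_isOpen 1 k) (ball_translate_isCompact 1 k)⟩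

lemma unitIndicator_apply (k : ℤ) (x : K) :
    (unitIndicator K k).1 x = Set.indicator {x | x - 1 ∈ ball K k} 1 x := rfl

lemma unitIndicator_zero {k : ℤ} (hk : k < 0) : (unitIndicator K k).1 0 = 0 := by
  refine Set.indicator_of_notMem (fun h => ?_) _
  have := nabs_eq_one_of_sub_one_mem hk h
  rw [nabs_zero] at this
  exact zero_ne_one this

/-- A test function that vanishes at 0 is invariant under multiplication by a small group of units,
and its support meets finitely many orbits. All sufficiently small k are allowed, so that two
functions can be decomposed with the same indicator. -/
lemma exists_unit_decomposition (f : testFunctions K) (h0 : f.1 0 = 0) :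
    ∃ k₀ : ℤ, ∀ k < 0, k ≤ k₀ → ∃ t : Finset Kˣ,
      f = ∑ a ∈ t, f.1 a • dilate a (unitIndicator K k) := by
  classical
  obtain ⟨j, M, hj, hM⟩ := exists_invariant_of_mem_testFunctions f.2
  -- For u - 1 in the ball of radius q^k and |y| ≤ q^M one has |(u - 1)y| ≤ q^(k + M) ≤ q^j, within
  -- the invariance radius of f.
  refine ⟨j - M, fun k hk hkj => ?_⟩
  set U := unitBall K k hk with hU
  let Φ : K → MulAction.orbitRel.Quotient U K := Quotient.mk _
  have hΦ : ∀ x y : K, Φ x = Φ y ↔ ∃ u : Kˣ, (u : K) - 1 ∈ ball K k ∧ u * y = x := by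
    intro x y
    rw [Quotient.eq, MulAction.orbitRel_apply, MulAction.mem_orbit_iff]
    constructor
    · rintro ⟨⟨u, hu⟩, h⟩
      exact ⟨u, hu, h⟩
    · rintro ⟨u, hu, h⟩
      exact ⟨⟨u, hu⟩, h⟩
  have hΦ' : ∀ (x : K) (a : Kˣ), Φ x = Φ a ↔ ((a⁻¹ : Kˣ) : K) * x - 1 ∈ ball K k := by
    intro x a
    rw [hΦ]
    constructor
    · rintro ⟨u, hu, rfl⟩
      rwa [mul_comm (u : K), ← mul_assoc, Units.inv_mul, one_mul]
    · intro h
      have hx : ((a⁻¹ : Kˣ) : K) * x ≠ 0 := fun h' => by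
        have := nabs_eq_one_of_sub_one_mem hk h
        rw [h', nabs_zero] at this
        exact zero_ne_one this
      refine ⟨Units.mk0 _ hx, h, ?_⟩
      rw [Units.val_mk0, mul_comm, ← mul_assoc, Units.mul_inv, one_mul]
  have hC : IsCompact (Function.support f.1) :=
    (HasCompactSupport.isCompact f.2.2).of_isClosed_subset
      (f.2.1.isOpen_fiber 0).isClosed_compl (subset_tsupport _)
  have hne : ∀ x ∈ Function.support f.1, x ≠ 0 := fun x hx h => hx (by rw [h, h0])
  obtain ⟨t, htC, ht⟩ := exists_finset_fiber_decomposition hC Φ fun x hx =>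
    mem_nhds_iff_ball.2 ⟨logAbs x + k, fun y hy => by
      have hx0 := hne x hx
      rw [Set.mem_ofPred_eq, ← Units.val_mk0 hx0, hΦ', Units.val_inv_eq_inv_val, Units.val_mk0,
        inv_mul_eq_div, div_sub_one hx0, mem_ball, nabs_div, nabs_eq_zpow hx0,
        div_le_iff₀ (zpow_pos (resCard_pos' K) _), ← zpow_add₀ (resCard_ne_zero K), add_comm]
      exact hy⟩
  have hfactor : ∀ x y, Φ x = Φ y → f.1 x = f.1 y := by
    intro x y h
    obtain ⟨u, hu, rfl⟩ := (hΦ x y).1 h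
    have hu1 := nabs_eq_one_of_sub_one_mem hk hu
    by_cases hy : y ∈ ball K M
    · have e : (u : K) * y = y + (u - 1) * y := by ring
      rw [e]
      refine hj y _ (ball_mono (by omega : k + M ≤ j) ?_)
      exact mul_mem_ball (mem_ball.1 hu) hy
    · have hy' : (u : K) * y ∉ ball K M := by
        rwa [mem_ball, nabs_mul, hu1, one_mul]
      rw [show f.1 y = 0 from by_contra fun h => hy (hM y h),
        show f.1 (u * y) = 0 from by_contra fun h => hy' (hM _ h)]
  refine ⟨t.preimage Units.val Units.val_injective.injOn, ?_⟩
  ext x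
  rw [ht f.1 hfactor (fun x hx => hx) x, AddSubmonoidClass.coe_finsetSum, Finset.sum_apply]
  rw [← Finset.sum_preimage Units.val t Units.val_injective.injOn
    (fun a => f.1 a * Set.indicator {y | Φ y = Φ a} 1 x)]
  · refine Finset.sum_congr rfl fun a _ => ?_
    change _ = f.1 a * Set.indicator {x | x - 1 ∈ ball K k} (1 : K → ℂ) ((a⁻¹ : Kˣ) * x)
    congr 1
    simp only [Set.indicator_apply, Set.mem_ofPred_eq, hΦ', Pi.one_apply]
  · intro a ha ha'
    exact absurd ⟨Units.mk0 a (hne a (htC ha)), rfl⟩ ha'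

variable [MeasurableSpace K] [BorelSpace K] (μ : Measure K) [μ.IsAddHaarMeasure]

lemma integral_charFun_mul_sum {ξ : Kˣ →* ℂˣ} (hξ : Continuous ξ) (t : Finset Kˣ) (c : Kˣ → ℂ)
    {φ : testFunctions K} (hφ : φ.1 0 = 0) :
    ∫ x, charFun ξ x * (∑ a ∈ t, c a • dilate a φ : testFunctions K).1 x ∂μ =
      (∑ a ∈ t, c a * ((ξ a : ℂ) * (nabs (a : K) : ℂ))) * ∫ x, charFun ξ x * φ.1 x ∂μ := by
  have h : ∀ x, charFun ξ x * (∑ a ∈ t, c a • dilate a φ : testFunctions K).1 x =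
      ∑ a ∈ t, c a * (charFun ξ x * (dilate a φ).1 x) := by
    intro x
    rw [AddSubmonoidClass.coe_finsetSum, Finset.sum_apply, Finset.mul_sum]
    refine Finset.sum_congr rfl fun a _ => ?_
    change charFun ξ x * (c a * (dilate a φ).1 x) = _
    ring
  simp only [h]
  rw [integral_finsetSum, Finset.sum_mul]
  · refine Finset.sum_congr rfl fun a _ => ?_
    rw [integral_const_mul, integral_charFun_mul_dilate]
    ring
  · intro a _
    refine (integrable_charFun_mul μ hξ (dilate a φ).2 ?_).const_mul _
    rw [dilate_apply_zero, hφ]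

lemma integral_charFun_mul_unitIndicator {ξ : Kˣ →* ℂˣ} {k : ℤ} (hk : k < 0)
    (hξ : ∀ u ∈ unitBall K k hk, ξ u = 1) :
    ∫ x, charFun ξ x * (unitIndicator K k).1 x ∂μ = μ.real (ball K k) := by
  have h1 : ∀ x, charFun ξ x * (unitIndicator K k).1 x =
      Set.indicator (ball K k : Set K) (1 : K → ℂ) (x - 1) := by
    intro x
    by_cases hx : x - 1 ∈ ball K k
    · have hx0 : x ≠ 0 := fun h => by
        have := nabs_eq_one_of_sub_one_mem hk hx
        rw [h, nabs_zero] at this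
        exact zero_ne_one this
      rw [unitIndicator_apply, Set.indicator_of_mem (show x - 1 ∈ (ball K k : Set K) from hx),
        Set.indicator_of_mem (show x ∈ {x | x - 1 ∈ ball K k} from hx), charFun_of_ne_zero ξ hx0, hξ _ (by exact hx)]
      simp
    · rw [unitIndicator_apply, Set.indicator_of_notMem (show x - 1 ∉ (ball K k : Set K) from hx),
        Set.indicator_of_notMem (show x ∉ {x | x - 1 ∈ ball K k} from hx), mul_zero]
  simp only [h1]
  rw [integral_sub_right_eq_self (Set.indicator (ball K k : Set K) (1 : K → ℂ)),
    integral_indicator_one_complex μ (measurableSet_ball k)]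

/-- A functional on the test functions on `Kˣ` that is homogeneous of the same degree as the
integral against `ξ` is proportional to it. -/
lemma exists_eq_mul_integral {ξ : Kˣ →* ℂˣ} (hξ : Continuous ξ) (T : testFunctions K →ₗ[ℂ] ℂ)
    (hT : ∀ (a : Kˣ) (f : testFunctions K), T (dilate a f) = (ξ a : ℂ) * (nabs (a : K) : ℂ) * T f) :
    ∃ γ : ℂ, ∀ f : testFunctions K, f.1 0 = 0 → T f = γ * ∫ x, charFun ξ x * f.1 x ∂μ := by
  obtain ⟨k₀, hk₀, htriv⟩ := exists_trivial_on_unitBall hξ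
  have hg0 := unitIndicator_zero (K := K) hk₀
  have hS : ∫ x, charFun ξ x * (unitIndicator K k₀).1 x ∂μ ≠ 0 := by
    rw [integral_charFun_mul_unitIndicator μ hk₀ htriv]
    exact_mod_cast (measureReal_ball_pos μ k₀).ne'
  refine ⟨T (unitIndicator K k₀) / ∫ x, charFun ξ x * (unitIndicator K k₀).1 x ∂μ, fun f hf => ?_⟩
  obtain ⟨k₁, h₁⟩ := exists_unit_decomposition f hf
  obtain ⟨k₂, h₂⟩ := exists_unit_decomposition _ hg0
  -- With a common indicator φ, `T` and the integral act on f and on the reference function by the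
  -- same coefficients times their values at φ, so the ratio does not depend on f.
  obtain ⟨t₁, ht₁⟩ := h₁ (min k₀ (min k₁ k₂)) (by omega) (by omega)
  obtain ⟨t₂, ht₂⟩ := h₂ (min k₀ (min k₁ k₂)) (by omega) (by omega)
  set φ := unitIndicator K (min k₀ (min k₁ k₂)) with hφ
  have hφ0 : φ.1 0 = 0 := unitIndicator_zero (by omega)
  have hTs : ∀ (t : Finset Kˣ) (c : Kˣ → ℂ), T (∑ a ∈ t, c a • dilate a φ) =
      (∑ a ∈ t, c a * ((ξ a : ℂ) * (nabs (a : K) : ℂ))) * T φ := by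
    intro t c
    rw [map_sum, Finset.sum_mul]
    refine Finset.sum_congr rfl fun a _ => ?_
    rw [map_smul, hT, smul_eq_mul]
    ring
  have e1 := hTs t₁ fun a => f.1 a
  have e2 := hTs t₂ fun a => (unitIndicator K k₀).1 a
  have e3 := integral_charFun_mul_sum μ hξ t₁ (fun a => f.1 a) hφ0
  have e4 := integral_charFun_mul_sum μ hξ t₂ (fun a => (unitIndicator K k₀).1 a) hφ0
  rw [← ht₁] at e1 e3
  rw [← ht₂] at e2 e4
  rw [eq_comm, div_mul_eq_mul_div, div_eq_iff hS, e1, e2, e3, e4]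
  ring

/-- The Fourier transform on test functions. -/
def fourierMap {ψ : AddChar K Circle} {e : ℤ} (hψ : IsConductor ψ e) (hc : Continuous ψ) :
    testFunctions K →ₗ[ℂ] testFunctions K where
  toFun f := ⟨fourier μ ψ f.1, fourier_mem_testFunctions μ hψ f.2⟩
  map_add' f g := by
    have hψc : Continuous fun x : K => ((ψ x : Circle) : ℂ) := continuous_subtype_val.comp hc
    have hint : ∀ (f : testFunctions K) (x : K),
        Integrable (fun y => (ψ (x * y) : ℂ) * f.1 y) μ := fun f x =>
      Continuous.integrable_of_hasCompactSupport
        ((hψc.comp (continuous_const.mul continuous_id)).mul f.2.1.continuous) f.2.2.mul_left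
    ext x
    change fourier μ ψ (f.1 + g.1) x = fourier μ ψ f.1 x + fourier μ ψ g.1 x
    rw [fourier, fourier, fourier, ← integral_add (hint f x) (hint g x)]
    exact integral_congr_ae (.of_forall fun y => mul_add _ _ _)
  map_smul' c f := by
    ext x
    change fourier μ ψ (c • f.1) x = c * fourier μ ψ f.1 x
    rw [fourier, fourier, ← integral_const_mul]
    exact integral_congr_ae (.of_forall fun y => mul_left_comm _ _ _)

/-- The homogeneous distribution on `K` that extends the function `κ` on `Kˣ`, regularized by
means of an element `a` with `κ(a) |a| ≠ 1`. -/
def homogeneousExtension {κ : Kˣ →* ℂˣ} (hκ : Continuous κ) (a : Kˣ) :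
    testFunctions K →ₗ[ℂ] ℂ where
  toFun f := (1 - (κ a : ℂ) * (nabs (a : K) : ℂ))⁻¹ *
    ∫ x, charFun κ x * (f - dilate a f).1 x ∂μ
  map_add' f g := by
    have h0 : ∀ f : testFunctions K, (f - dilate a f).1 0 = 0 := fun f => by
      change f.1 0 - (dilate a f).1 0 = 0
      rw [dilate_apply_zero, sub_self]
    rw [← mul_add, ← integral_add (integrable_charFun_mul μ hκ (f - dilate a f).2 (h0 f))
      (integrable_charFun_mul μ hκ (g - dilate a g).2 (h0 g))]
    congr 1
    refine integral_congr_ae (.of_forall fun x => ?_)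
    change charFun κ x * ((f.1 x + g.1 x) - (f.1 _ + g.1 _)) =
      charFun κ x * (f.1 x - f.1 _) + charFun κ x * (g.1 x - g.1 _)
    ring
  map_smul' c f := by
    have h : ∫ x, charFun κ x * (c • f - dilate a (c • f)).1 x ∂μ =
        c * ∫ x, charFun κ x * (f - dilate a f).1 x ∂μ := by
      rw [← integral_const_mul]
      refine integral_congr_ae (.of_forall fun x => ?_)
      change charFun κ x * (c * f.1 x - c * f.1 _) = c * (charFun κ x * (f.1 x - f.1 _))
      ring
    rw [h, RingHom.id_apply, smul_eq_mul, mul_left_comm c]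

lemma homogeneousExtension_isHomogeneous {κ : Kˣ →* ℂˣ} (hκ : Continuous κ) (a : Kˣ) :
    IsHomogeneous (homogeneousExtension μ hκ a) κ := by
  intro b f
  change (1 - (κ a : ℂ) * (nabs (a : K) : ℂ))⁻¹ *
      ∫ x, charFun κ x * (dilate b f - dilate a (dilate b f)).1 x ∂μ = _ *
    ((1 - (κ a : ℂ) * (nabs (a : K) : ℂ))⁻¹ * ∫ x, charFun κ x * (f - dilate a f).1 x ∂μ)
  rw [dilate_dilate, ← dilate_sub, integral_charFun_mul_dilate]
  ring

/-- Where the integral itself makes sense, dilation multiplies it by κ(a)|a|; the normalizing factor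
divides by the resulting 1 - κ(a)|a|. -/
lemma homogeneousExtension_apply {κ : Kˣ →* ℂˣ} (hκ : Continuous κ) {a : Kˣ}
    (ha : (κ a : ℂ) * (nabs (a : K) : ℂ) ≠ 1) (f : testFunctions K) (hf : f.1 0 = 0) :
    homogeneousExtension μ hκ a f = ∫ x, charFun κ x * f.1 x ∂μ := by
  change (1 - (κ a : ℂ) * (nabs (a : K) : ℂ))⁻¹ * ∫ x, charFun κ x * (f.1 x - (dilate a f).1 x) ∂μ = _
  simp only [mul_sub]
  rw [integral_sub (integrable_charFun_mul μ hκ f.2 hf)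
    (integrable_charFun_mul μ hκ (dilate a f).2 (by rw [dilate_apply_zero, hf])),
    integral_charFun_mul_dilate, inv_mul_eq_iff_eq_mul₀ (sub_ne_zero.2 ha.symm)]
  ring

lemma mul_absChar_neg_one_apply (ξ : Kˣ →* ℂˣ) (a : Kˣ) :
    (((ξ * absChar K (-1)) a : ℂˣ) : ℂ) * (nabs (a : K) : ℂ) = ξ a := by
  have h : (nabs (a : K) : ℂ) ≠ 0 := by exact_mod_cast (nabs_pos a.ne_zero).ne'
  rw [MonoidHom.mul_apply, Units.val_mul, ← charFun_units (absChar K (-1)), charFun_absChar_neg_one,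
    mul_assoc, inv_mul_cancel₀ h, mul_one]

/-- An element with ξ(a) ≠ 1 gives the homogeneous extension u. The Fourier transform turns dilation
by b into |b| times dilation by b⁻¹, so the transform of u scales like the integral against ξ⁻¹, and
`exists_eq_mul_integral` supplies the constant. -/
lemma exists_isGammaFactor {ψ : AddChar K Circle} (hψ : Continuous ψ) (hψ1 : ψ ≠ 1)
    {ξ : Kˣ →* ℂˣ} (hξ : Continuous ξ) (hξ1 : ξ ≠ 1) : ∃ γ, IsGammaFactor μ ψ ξ γ := by
  obtain ⟨e, he⟩ := exists_isConductor hψ hψ1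
  obtain ⟨a, ha⟩ := DFunLike.ne_iff.1 hξ1
  have hκ : Continuous (ξ * absChar K (-1)) := hξ.mul (continuous_absChar _)
  set u := homogeneousExtension μ hκ a with hu
  have hu1 : IsHomogeneous u (ξ * absChar K (-1)) := homogeneousExtension_isHomogeneous μ hκ a
  have hu2 := homogeneousExtension_apply μ hκ (a := a) (by
    rw [mul_absChar_neg_one_apply]
    exact fun h => ha (Units.ext h))
  obtain ⟨γ, hγ⟩ := exists_eq_mul_integral μ (ξ := ξ⁻¹) hξ.inv (u ∘ₗ fourierMap μ he hψ) (by
    intro b f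
    have h1 : fourierMap μ he hψ (dilate b f) =
        (nabs (b : K) : ℂ) • dilate b⁻¹ (fourierMap μ he hψ f) := by
      ext x
      change fourier μ ψ (dilate b f).1 x = (nabs (b : K) : ℂ) * fourier μ ψ f.1 (((b⁻¹)⁻¹ : Kˣ) * x)
      rw [fourier_dilate, inv_inv]
    rw [LinearMap.comp_apply, LinearMap.comp_apply, h1, map_smul, hu1, mul_absChar_neg_one_apply,
      smul_eq_mul, MonoidHom.inv_apply, map_inv]
    ring)
  exact ⟨γ, u, hu1, hu2, fun f hf => ⟨fourierMap μ he hψ f, rfl, hγ f hf⟩⟩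

lemma isGammaFactor_gammaFactor {ψ : AddChar K Circle} (hψ : Continuous ψ) (hψ1 : ψ ≠ 1)
    {ξ : Kˣ →* ℂˣ} (hξ : Continuous ξ) (hξ1 : ξ ≠ 1) :
    IsGammaFactor μ ψ ξ (gammaFactor μ ψ ξ) := by
  have h := exists_isGammaFactor μ hψ hψ1 hξ hξ1
  rw [gammaFactor, dif_pos h]
  exact h.choose_spec

end GammaExistence

/-! ### Coordinates, measure and Fourier transform on the quadratic extension. -/

section QuadraticExtension

variable {F E : Type*} [Field F] [ValuativeRel F] [TopologicalSpace F]
  [IsNonarchimedeanLocalField F] [Field E] [ValuativeRel E] [TopologicalSpace E]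
  [IsNonarchimedeanLocalField E] [Algebra F E] [ValuativeExtension F E]

lemma nabs_algebraMap_le_iff {a b : F} :
    nabs (algebraMap F E a) ≤ nabs (algebraMap F E b) ↔ nabs a ≤ nabs b := by
  rw [nabs_le_nabs_iff, nabs_le_nabs_iff, ← Valuation.Compatible.vle_iff_le,
    ← Valuation.Compatible.vle_iff_le, ValuativeExtension.vle_iff_vle]

-- The embedding preserves the order of absolute values, and the powers of an element of F of
-- absolute value below 1 become arbitrarily small in E.
variable (F E) in
lemma continuous_algebraMap_of_valuativeExtension : Continuous (algebraMap F E) := by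
  refine continuous_of_continuousAt_zero (algebraMap F E) ?_
  rw [ContinuousAt, map_zero]
  intro s hs
  obtain ⟨n, hn⟩ := mem_nhds_zero_iff_ball.1 hs
  obtain ⟨b, hb0, hb⟩ := exists_nabs_eq F (-1)
  have hb1 : nabs (algebraMap F E b) < 1 := by
    rw [← nabs_one (K := E), ← map_one (algebraMap F E), ← not_le, nabs_algebraMap_le_iff, not_le,
      hb, nabs_one]
    exact zpow_lt_one_of_neg₀ (one_lt_resCard F) (by norm_num)
  obtain ⟨m, hm⟩ := exists_pow_lt_of_lt_one (zpow_pos (resCard_pos' E) n) hb1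
  refine mem_nhds_zero_iff_ball.2 ⟨-m, fun x hx => hn ?_⟩
  rw [SetLike.mem_coe, mem_ball]
  refine le_trans ?_ hm.le
  rw [← nabs_pow, ← map_pow, nabs_algebraMap_le_iff, nabs_pow, hb, ← zpow_natCast, ← zpow_mul,
    neg_one_mul]
  exact hx

variable (hdim : Module.finrank F E = 2) {α : E} (hα : α ∉ (algebraMap F E).range)

/-- The coordinates `(x₁, x₂) ↦ x₁ + x₂ α` as an additive equivalence. -/
def quadAddEquiv : F × F ≃+ E where
  toFun x := algebraMap F E x.1 + algebraMap F E x.2 * α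
  invFun z := ((quadBasis hdim hα).repr z 0, (quadBasis hdim hα).repr z 1)
  left_inv x := by
    have h0 : quadBasis hdim hα 0 = 1 := by simp [quadBasis]
    have h1 : quadBasis hdim hα 1 = α := by simp [quadBasis]
    have h : algebraMap F E x.1 + algebraMap F E x.2 * α =
        x.1 • quadBasis hdim hα 0 + x.2 • quadBasis hdim hα 1 := by
      rw [h0, h1, Algebra.smul_def, Algebra.smul_def, mul_one]
    beta_reduce
    rw [h]
    ext <;> simp
  right_inv z := by
    have h0 : quadBasis hdim hα 0 = 1 := by simp [quadBasis]
    have h1 : quadBasis hdim hα 1 = α := by simp [quadBasis]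
    have h := (quadBasis hdim hα).sum_repr z
    rw [Fin.sum_univ_two, h0, h1, Algebra.smul_def, Algebra.smul_def, mul_one] at h
    exact h
  map_add' x y := by
    simp only [Prod.fst_add, Prod.snd_add, map_add]
    ring

lemma continuous_quadAddEquiv : Continuous (quadAddEquiv hdim hα) := by
  have h := continuous_algebraMap_of_valuativeExtension F E
  exact (h.comp continuous_fst).add ((h.comp continuous_snd).mul continuous_const)

/-- The coordinates `(x₁, x₂) ↦ x₁ + x₂ α` as a homeomorphism. -/
def quadHomeomorph : F × F ≃ₜ E :=
  (quadAddEquiv hdim hα).toEquiv.toHomeomorphOfContinuousOpen (continuous_quadAddEquiv hdim hα)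
    -- Open mapping theorem for σ-compact groups.
    (AddMonoidHom.isOpenMap_of_sigmaCompact (quadAddEquiv hdim hα).toAddMonoidHom
      (quadAddEquiv hdim hα).surjective (continuous_quadAddEquiv hdim hα))

lemma quadHomeomorph_apply (x y : F) :
    quadHomeomorph hdim hα (x, y) = algebraMap F E x + algebraMap F E y * α := rfl

lemma extendAddChar_quadHomeomorph (ψ : AddChar F Circle) (x : F × F) :
    extendAddChar hdim hα ψ (quadHomeomorph hdim hα x) = ψ x.1 :=
  congrArg (fun z : F × F => ψ z.1) ((quadHomeomorph hdim hα).symm_apply_apply x)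

lemma continuous_extendAddChar {ψ : AddChar F Circle} (hψ : Continuous ψ) :
    Continuous (extendAddChar hdim hα ψ) := by
  rw [← (quadHomeomorph hdim hα).comp_continuous_iff']
  refine (hψ.comp continuous_fst).congr fun x => ?_
  exact (extendAddChar_quadHomeomorph hdim hα ψ x).symm

lemma extendAddChar_ne_one {ψ : AddChar F Circle} (hψ : ψ ≠ 1) :
    extendAddChar hdim hα ψ ≠ 1 := by
  obtain ⟨y, hy⟩ := AddChar.ne_one_iff.1 hψ
  refine AddChar.ne_one_iff.2 ⟨quadHomeomorph hdim hα (y, 0), ?_⟩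
  rwa [extendAddChar_quadHomeomorph]

variable [MeasurableSpace F] [BorelSpace F] [MeasurableSpace E] [BorelSpace E]
  (μ : Measure F) [μ.IsAddHaarMeasure]

include hdim hα in
lemma prodMeasure_isAddHaarMeasure : (prodMeasure μ α).IsAddHaarMeasure :=
  (quadAddEquiv hdim hα).isAddHaarMeasure_map (μ.prod μ) (continuous_quadAddEquiv hdim hα)
    (quadHomeomorph hdim hα).symm.continuous

lemma integral_prodMeasure (G : E → ℂ) :
    ∫ z, G z ∂(prodMeasure μ α) = ∫ x, G (quadHomeomorph hdim hα x) ∂(μ.prod μ) :=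
  (quadHomeomorph hdim hα).measurableEmbedding.integral_map G

lemma prodMeasure_image (A B : Set F) :
    prodMeasure μ α (quadHomeomorph hdim hα '' (A ×ˢ B)) = μ A * μ B := by
  have h : prodMeasure μ α = (μ.prod μ).map (quadHomeomorph hdim hα) := rfl
  rw [h, (quadHomeomorph hdim hα).measurableEmbedding.map_apply,
    Set.preimage_image_eq _ (quadHomeomorph hdim hα).injective, Measure.prod_prod]

-- Multiplication by a scales both coordinates in F, hence the product measure by |a|_F²; as a
-- multiplication on E it scales this Haar measure by the absolute value of E.
omit [MeasurableSpace F] [BorelSpace F] [MeasurableSpace E] [BorelSpace E] in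
include hdim hα in
lemma nabs_algebraMap (a : F) : nabs (algebraMap F E a) = nabs a ^ 2 := by
  borelize F
  borelize E
  by_cases ha : a = 0
  · simp [ha, nabs_zero]
  have := prodMeasure_isAddHaarMeasure hdim hα (Measure.addHaar (G := F))
  set μ : Measure F := Measure.addHaar
  have ha' : algebraMap F E a ≠ 0 := by simpa using ha
  set A : Set F := (ball F 0 : Set F)
  set s : Set E := quadHomeomorph hdim hα '' (A ×ˢ A) with hs
  open scoped Pointwise in
  have h1 : Units.mk0 _ ha' • s =
      quadHomeomorph hdim hα '' ((Units.mk0 a ha • A) ×ˢ (Units.mk0 a ha • A)) := by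
    rw [hs, ← Set.image_smul, ← Set.image_smul, Set.image_image, Set.prod_image_image_eq,
      Set.image_image]
    refine Set.image_congr fun x _ => ?_
    change algebraMap F E a * (algebraMap F E x.1 + algebraMap F E x.2 * α) =
      algebraMap F E (a * x.1) + algebraMap F E (a * x.2) * α
    rw [map_mul, map_mul]
    ring
  have h2 := measure_smul (prodMeasure μ α) (Units.mk0 _ ha') s
  rw [h1, prodMeasure_image, hs, prodMeasure_image, measure_smul] at h2
  have h3 := congrArg ENNReal.toReal h2
  simp only [ENNReal.toReal_mul, ENNReal.coe_toReal, coe_distribHaarChar, Units.val_mk0] at h3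
  have h4 : (μ A).toReal ≠ 0 :=
    ENNReal.toReal_ne_zero.2 ⟨measure_ball_ne_zero μ _, measure_ball_ne_top μ _⟩
  have h5 : nabs a ^ 2 * ((μ A).toReal * (μ A).toReal) =
      nabs (algebraMap F E a) * ((μ A).toReal * (μ A).toReal) := by rw [← h3]; ring
  exact (mul_right_cancel₀ (mul_ne_zero h4 h4) h5).symm

/-- The function `x₁ + x₂ α ↦ g(x₁) h(x₂)`. -/
def tensor (g h : testFunctions F) : testFunctions E :=
  ⟨fun z => g.1 ((quadHomeomorph hdim hα).symm z).1 * h.1 ((quadHomeomorph hdim hα).symm z).2, by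
    refine ⟨?_, ?_⟩
    · exact (g.2.1.comp_continuous (continuous_fst.comp
        (quadHomeomorph hdim hα).symm.continuous)).mul (h.2.1.comp_continuous
        (continuous_snd.comp (quadHomeomorph hdim hα).symm.continuous))
    · refine HasCompactSupport.intro
        (((HasCompactSupport.isCompact g.2.2).prod (HasCompactSupport.isCompact h.2.2)).image
          (quadHomeomorph hdim hα).continuous) fun z hz => ?_
      by_contra hne
      refine hz ⟨(quadHomeomorph hdim hα).symm z, ⟨subset_tsupport _ ?_, subset_tsupport _ ?_⟩,
        (quadHomeomorph hdim hα).apply_symm_apply z⟩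
      · exact left_ne_zero_of_mul hne
      · exact right_ne_zero_of_mul hne⟩

lemma tensor_apply (g h : testFunctions F) (x : F × F) :
    (tensor hdim hα g h).1 (quadHomeomorph hdim hα x) = g.1 x.1 * h.1 x.2 := by
  simp [tensor]

lemma tensor_zero {g h : testFunctions F} (hg : g.1 0 = 0) : (tensor hdim hα g h).1 0 = 0 := by
  have h0 : quadHomeomorph hdim hα (0, 0) = 0 := by simp [quadHomeomorph_apply]
  rw [← h0, tensor_apply, hg, zero_mul]

/-- As α² = d, the first coordinate of (x₁ + x₂α)(y₁ + y₂α) is x₁y₁ + d x₂y₂, without mixed terms,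
so the kernel factors. -/
lemma fourier_tensor {d : F} (hd : α ^ 2 = algebraMap F E d) (ψ : AddChar F Circle)
    (g h : testFunctions F) (x : F × F) :
    fourier (prodMeasure μ α) (extendAddChar hdim hα ψ) (tensor hdim hα g h).1
      (quadHomeomorph hdim hα x) = fourier μ ψ g.1 x.1 * fourier μ ψ h.1 (d * x.2) := by
  rw [fourier, integral_prodMeasure hdim hα, fourier, fourier, ← integral_prod_mul]
  refine integral_congr_ae (.of_forall fun y => ?_)
  have e : quadHomeomorph hdim hα x * quadHomeomorph hdim hα y =
      quadHomeomorph hdim hα (x.1 * y.1 + d * x.2 * y.2, x.1 * y.2 + x.2 * y.1) := by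
    change (algebraMap F E x.1 + algebraMap F E x.2 * α) *
      (algebraMap F E y.1 + algebraMap F E y.2 * α) = algebraMap F E (x.1 * y.1 + d * x.2 * y.2) +
        algebraMap F E (x.1 * y.2 + x.2 * y.1) * α
    simp only [map_add, map_mul]
    rw [← hd]
    ring
  simp only [e, extendAddChar_quadHomeomorph, tensor_apply, AddChar.map_add_eq_mul, Circle.coe_mul]
  ring

end QuadraticExtension

/-! ### Integrals of a character over spheres. -/

section SphereIntegrals

variable {K : Type*} [Field K] [ValuativeRel K] [TopologicalSpace K] [IsNonarchimedeanLocalField K]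

variable (K) in
/-- The sphere of radius `q ^ n`. -/
def sphere (n : ℤ) : Set K := {x | nabs x = (resCard K : ℝ) ^ n}

lemma mem_sphere {n : ℤ} {x : K} : x ∈ sphere K n ↔ nabs x = (resCard K : ℝ) ^ n := Iff.rfl

lemma ne_zero_of_mem_sphere {n : ℤ} {x : K} (hx : x ∈ sphere K n) : x ≠ 0 := by
  rintro rfl
  rw [mem_sphere, nabs_zero] at hx
  exact (zpow_pos (resCard_pos' K) n).ne hx

lemma mem_sphere_zero {x : K} : x ∈ sphere K 0 ↔ nabs x = 1 := by
  rw [mem_sphere, zpow_zero]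

lemma isOpen_sphere (n : ℤ) : IsOpen (sphere K n) :=
  isOpen_iff_mem_nhds.2 fun _ hx =>
    (eventually_nabs_eq (ne_zero_of_mem_sphere hx)).mono fun _ hy => hy.trans hx

lemma isClosed_sphere (n : ℤ) : IsClosed (sphere K n) :=
  isClosed_eq continuous_nabs continuous_const

lemma sphere_subset_ball (n : ℤ) : sphere K n ⊆ ball K n := fun _ hx => le_of_eq hx

lemma isCompact_sphere (n : ℤ) : IsCompact (sphere K n) :=
  (isCompact_ball n).of_isClosed_subset (isClosed_sphere n) (sphere_subset_ball n)

lemma ball_succ_eq_union (n : ℤ) :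
    (ball K (n + 1) : Set K) = (ball K n : Set K) ∪ sphere K (n + 1) := by
  ext x
  have h := nabs_lt_zpow_iff (x := x) (n := n + 1)
  rw [add_sub_cancel_right] at h
  rw [Set.mem_union, SetLike.mem_coe, SetLike.mem_coe, mem_ball, mem_ball, ← h, mem_sphere, le_iff_lt_or_eq]

lemma disjoint_ball_sphere (n : ℤ) : Disjoint (ball K n : Set K) (sphere K (n + 1)) := by
  rw [Set.disjoint_left]
  intro x hx hx'
  have h : nabs x ≤ (resCard K : ℝ) ^ n := hx
  rw [mem_sphere] at hx'
  rw [hx', zpow_le_zpow_iff_right₀ (one_lt_resCard K)] at h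
  omega

/-- The unit sphere is a compact group, so the powers of ξ(x) and of ξ(x)⁻¹ are bounded. -/
lemma norm_charFun_eq_one {ξ : Kˣ →* ℂˣ} (hξ : Continuous ξ) {x : K} (hx : nabs x = 1) :
    ‖charFun ξ x‖ = 1 := by
  have hcont : ContinuousOn (charFun ξ) (sphere K 0) := fun y hy =>
    (continuousAt_const.congr ((eventually_charFun_eq hξ (ne_zero_of_mem_sphere hy)).mono
      fun z hz => hz.symm)).continuousWithinAt
  obtain ⟨B, hB⟩ := (isCompact_sphere (K := K) 0).exists_bound_of_continuousOn hcont
  have hpow : ∀ (y : K) (n : ℕ), charFun ξ (y ^ n) = charFun ξ y ^ n := by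
    intro y n
    induction n with
    | zero => rw [pow_zero, pow_zero, charFun_one]
    | succ n ih => rw [pow_succ, pow_succ, charFun_mul, ih]
  have hle : ∀ y : K, nabs y = 1 → ‖charFun ξ y‖ ≤ 1 := by
    intro y hy
    by_contra h
    obtain ⟨n, hn⟩ := pow_unbounded_of_one_lt B (not_le.1 h)
    have := hB (y ^ n) (by rw [mem_sphere_zero, nabs_pow, hy, one_pow])
    rw [hpow, norm_pow] at this
    exact absurd this (not_le.2 hn)
  refine le_antisymm (hle x hx) ?_
  have h1 := hle x⁻¹ (by rw [nabs_inv, hx, inv_one])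
  have hx0 : x ≠ 0 := by
    rintro rfl
    rw [nabs_zero] at hx
    exact zero_ne_one hx
  rw [charFun_inv, norm_inv] at h1
  exact (inv_le_one₀ (norm_pos_iff.2 (charFun_ne_zero ξ hx0))).1 h1

variable (K) in
/-- An element of absolute value `q`. -/
def invUniformizer : Kˣ := Units.mk0 (exists_nabs_eq K 1).choose (exists_nabs_eq K 1).choose_spec.1

variable (K) in
lemma nabs_invUniformizer : nabs (invUniformizer K : K) = resCard K := by
  exact (exists_nabs_eq K 1).choose_spec.2.trans (zpow_one _)

lemma exists_eq_zpow_mul (x : Kˣ) :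
    ∃ u : Kˣ, nabs (u : K) = 1 ∧ x = invUniformizer K ^ logAbs (x : K) * u := by
  refine ⟨(invUniformizer K ^ logAbs (x : K))⁻¹ * x, ?_, by group⟩
  rw [Units.val_mul, nabs_mul, Units.val_inv_eq_inv_val, nabs_inv, Units.val_zpow_eq_zpow_val,
    nabs_zpow, nabs_invUniformizer, ← nabs_eq_zpow x.ne_zero,
    inv_mul_cancel₀ (nabs_pos x.ne_zero).ne']

/-- The real exponent of a multiplicative character. -/
lemma exists_norm_eq_rpow {ξ : Kˣ →* ℂˣ} (hξ : Continuous ξ) :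
    ∃ σ : ℝ, ∀ x : Kˣ, ‖(ξ x : ℂ)‖ = nabs (x : K) ^ σ := by
  have hq := one_lt_resCard K
  have hq0 := resCard_pos' K
  have hb : 0 < ‖(ξ (invUniformizer K) : ℂ)‖ := norm_pos_iff.2 (Units.ne_zero _)
  refine ⟨Real.logb (resCard K) ‖(ξ (invUniformizer K) : ℂ)‖, fun x => ?_⟩
  obtain ⟨u, hu, hx⟩ := exists_eq_zpow_mul x
  have h1 := norm_charFun_eq_one hξ hu
  rw [charFun_units] at h1
  conv_lhs => rw [hx]
  rw [map_mul, map_zpow, Units.val_mul, norm_mul, h1, mul_one, Units.val_zpow_eq_zpow_val,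
    norm_zpow, nabs_eq_zpow x.ne_zero, ← Real.rpow_intCast, ← Real.rpow_intCast, ← Real.rpow_mul
    hq0.le, mul_comm, Real.rpow_mul hq0.le, Real.rpow_logb hq0 hq.ne' hb]

/-- The ratio `r = q ξ(ϖ)⁻¹` of the integrals of `ξ` over two consecutive spheres. -/
def sphereRatio (ξ : Kˣ →* ℂˣ) : ℂ := resCard K * ξ (invUniformizer K)

lemma sphereRatio_ne_zero (ξ : Kˣ →* ℂˣ) : sphereRatio ξ ≠ 0 :=
  mul_ne_zero (by exact_mod_cast resCard_ne_zero K) (Units.ne_zero _)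

variable [MeasurableSpace K] [BorelSpace K] (μ : Measure K) [μ.IsAddHaarMeasure]

/-- The integral of `ξ` over the unit sphere. -/
def sphereIntegral (ξ : Kˣ →* ℂˣ) : ℂ := ∫ x in sphere K 0, charFun ξ x ∂μ

lemma setIntegral_sphere (ξ : Kˣ →* ℂˣ) (n : ℤ) :
    ∫ x in sphere K n, charFun ξ x ∂μ = sphereRatio ξ ^ n * sphereIntegral μ ξ := by
  set a : Kˣ := invUniformizer K ^ n with ha
  have hna : nabs (a : K) = (resCard K : ℝ) ^ n := by
    rw [ha, Units.val_zpow_eq_zpow_val, nabs_zpow, nabs_invUniformizer]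
  have h := integral_comp_mul_left' μ a ((sphere K 0).indicator (charFun ξ))
  have e : ∀ x, (sphere K 0).indicator (charFun ξ) ((a⁻¹ : Kˣ) * x) =
      (ξ a : ℂ)⁻¹ * (sphere K n).indicator (charFun ξ) x := by
    intro x
    have hmem : ((a⁻¹ : Kˣ) : K) * x ∈ sphere K 0 ↔ x ∈ sphere K n := by
      rw [mem_sphere_zero, nabs_mul, Units.val_inv_eq_inv_val, nabs_inv, hna, mem_sphere, inv_mul_eq_one₀ (zpow_ne_zero _ (resCard_ne_zero K)), eq_comm]
    by_cases hx : x ∈ sphere K n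
    · rw [Set.indicator_of_mem hx, Set.indicator_of_mem (hmem.2 hx), charFun_mul, charFun_units,
        map_inv, Units.val_inv_eq_inv_val]
    · rw [Set.indicator_of_notMem hx, Set.indicator_of_notMem (hmem.not.2 hx), mul_zero]
  simp only [e] at h
  rw [integral_const_mul, integral_indicator (isOpen_sphere n).measurableSet,
    integral_indicator (isOpen_sphere 0).measurableSet,
    inv_mul_eq_iff_eq_mul₀ (Units.ne_zero _), hna] at h
  rw [h, sphereRatio, sphereIntegral, mul_zpow, ha, map_zpow, Units.val_zpow_eq_zpow_val]
  push_cast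
  ring

/-- The measure-preserving substitution x ↦ ux multiplies the integral by ξ(u) ≠ 1. -/
lemma sphereIntegral_eq_zero {ξ : Kˣ →* ℂˣ} {u : K} (hu : nabs u = 1) (hξ : charFun ξ u ≠ 1) :
    sphereIntegral μ ξ = 0 := by
  have hu0 : u ≠ 0 := ne_zero_of_mem_sphere (mem_sphere_zero.2 hu)
  have h := integral_comp_mul_left μ (Units.mk0 u hu0) ((sphere K 0).indicator (charFun ξ))
  have e : ∀ x, (sphere K 0).indicator (charFun ξ) ((Units.mk0 u hu0 : Kˣ) * x) =
      charFun ξ u * (sphere K 0).indicator (charFun ξ) x := by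
    intro x
    have hmem : ((Units.mk0 u hu0 : Kˣ) : K) * x ∈ sphere K 0 ↔ x ∈ sphere K 0 := by
      rw [mem_sphere_zero, mem_sphere_zero, nabs_mul, Units.val_mk0, hu, one_mul]
    by_cases hx : x ∈ sphere K 0
    · rw [Set.indicator_of_mem hx, Set.indicator_of_mem (hmem.2 hx), charFun_mul, Units.val_mk0]
    · rw [Set.indicator_of_notMem hx, Set.indicator_of_notMem (hmem.not.2 hx), mul_zero]
  simp only [e] at h
  rw [integral_const_mul, Units.val_mk0, hu, inv_one, one_smul,
    integral_indicator (isOpen_sphere 0).measurableSet] at h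
  exact (mul_left_eq_self₀.1 h).resolve_left hξ

lemma sphereIntegral_ne_zero {ξ : Kˣ →* ℂˣ} (hξ : ∀ u : K, nabs u = 1 → charFun ξ u = 1) :
    sphereIntegral μ ξ ≠ 0 := by
  have h : sphereIntegral μ ξ = ∫ x in sphere K 0, (1 : ℂ) ∂μ :=
    setIntegral_congr_fun (isOpen_sphere 0).measurableSet fun x hx => hξ x (mem_sphere_zero.1 hx)
  have h1 : 0 < μ.real (sphere K 0) :=
    ENNReal.toReal_pos ((isOpen_sphere 0).measure_pos μ ⟨1, mem_sphere_zero.2 nabs_one⟩).ne'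
      (isCompact_sphere 0).measure_lt_top.ne
  rw [h, setIntegral_const, Complex.real_smul, mul_one]
  exact_mod_cast h1.ne'

lemma sphereIntegral_eq_zero_iff {ξ : Kˣ →* ℂˣ} :
    sphereIntegral μ ξ = 0 ↔ ∃ u : K, nabs u = 1 ∧ charFun ξ u ≠ 1 := by
  refine ⟨fun h => ?_, fun ⟨u, hu, hξ⟩ => sphereIntegral_eq_zero μ hu hξ⟩
  by_contra hcon
  push Not at hcon
  exact sphereIntegral_ne_zero μ hcon h

/-- A nonzero sphere integral forces ξ to be trivial on units, so that ξ(x)|x| depends only on |x|.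
-/
lemma charFun_mul_nabs_eq {ξ : Kˣ →* ℂˣ} (hξ : sphereIntegral μ ξ ≠ 0) {x : K} (hx : x ≠ 0) :
    charFun ξ x * (nabs x : ℂ) = sphereRatio ξ ^ logAbs x := by
  obtain ⟨u, hu, h⟩ := exists_eq_zpow_mul (Units.mk0 x hx)
  have hu1 : charFun ξ (u : K) = 1 := by
    by_contra hne
    exact hξ (sphereIntegral_eq_zero μ hu hne)
  rw [charFun_units] at hu1
  rw [charFun_of_ne_zero ξ hx, h, Units.val_mk0, map_mul, map_zpow, Units.val_mul, hu1, mul_one,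
    nabs_eq_zpow hx, sphereRatio, mul_zpow, Units.val_zpow_eq_zpow_val]
  push_cast
  ring

end SphereIntegrals

/-! ### The absolute value of a character, used for absolute convergence. -/

section NormChar

variable {K : Type*} [Field K] [ValuativeRel K] [TopologicalSpace K] [IsNonarchimedeanLocalField K]

/-- The absolute value of a multiplicative character. -/
def normChar (ξ : Kˣ →* ℂˣ) : Kˣ →* ℂˣ where
  toFun x := Units.mk0 ((‖(ξ x : ℂ)‖ : ℝ) : ℂ) (by simp)
  map_one' := by ext; simp
  map_mul' x y := by ext; simp

lemma charFun_normChar (ξ : Kˣ →* ℂˣ) (x : K) : charFun (normChar ξ) x = ‖charFun ξ x‖ := by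
  by_cases hx : x = 0
  · simp [hx, charFun_zero]
  · rw [charFun_of_ne_zero _ hx, charFun_of_ne_zero _ hx]
    rfl

lemma continuous_normChar {ξ : Kˣ →* ℂˣ} (hξ : Continuous ξ) : Continuous (normChar ξ) := by
  obtain ⟨k, hk, h⟩ := exists_trivial_on_unitBall hξ
  refine continuous_of_trivial_on_unitBall (k := k) (hk := hk) fun u hu => ?_
  ext
  simp [normChar, h u hu]

end NormChar

/-! ### Integrals over balls: geometric tails and convergence. -/

section PartialIntegrals

variable {F E : Type*} [Field F] [ValuativeRel F] [TopologicalSpace F]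
  [IsNonarchimedeanLocalField F] [Field E] [ValuativeRel E] [TopologicalSpace E]
  [IsNonarchimedeanLocalField E] [Algebra F E] [ValuativeExtension F E]

variable (F) in
/-- The restriction of a character of `Eˣ` to `Fˣ`. -/
def restrictChar (χ : Eˣ →* ℂˣ) : Fˣ →* ℂˣ := χ.comp (Units.map (algebraMap F E : F →* E))

lemma charFun_restrictChar (χ : Eˣ →* ℂˣ) (x : F) :
    charFun (restrictChar F χ) x = charFun χ (algebraMap F E x) := by
  by_cases hx : x = 0
  · simp [hx, charFun_zero]
  · have hx' : algebraMap F E x ≠ 0 := by simpa using hx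
    rw [charFun_of_ne_zero _ hx, charFun_of_ne_zero _ hx', restrictChar, MonoidHom.comp_apply]
    congr 2
    ext
    rfl

lemma continuous_restrictChar {χ : Eˣ →* ℂˣ} (hχ : Continuous χ) :
    Continuous (restrictChar F χ) :=
  hχ.comp (Continuous.units_map _ (continuous_algebraMap_of_valuativeExtension F E))

lemma restrictChar_mul (χ η : Eˣ →* ℂˣ) :
    restrictChar F (χ * η) = restrictChar F χ * restrictChar F η := rfl

lemma one_add_algebraMap_mul_ne_zero {α : E} (hα : α ∉ (algebraMap F E).range) (y : F) :
    1 + algebraMap F E y * α ≠ 0 := by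
  intro h
  have hy : algebraMap F E y ≠ 0 := by
    intro hy
    rw [hy, zero_mul, add_zero] at h
    exact one_ne_zero h
  refine hα ⟨-y⁻¹, ?_⟩
  rw [map_neg, map_inv₀]
  field_simp
  linear_combination -h

variable (hdim : Module.finrank F E = 2) {α : E} (hα : α ∉ (algebraMap F E).range)

include hα in
lemma eventually_charFun_one_add_eq {χ : Eˣ →* ℂˣ} (hχ : Continuous χ) (y : F) :
    ∀ᶠ z in 𝓝 y, charFun χ (1 + algebraMap F E z * α) = charFun χ (1 + algebraMap F E y * α) :=
  (continuous_const.add ((continuous_algebraMap_of_valuativeExtension F E).mul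
    continuous_const)).continuousAt.eventually
    (eventually_charFun_eq hχ (one_add_algebraMap_mul_ne_zero hα y))

include hα in
lemma continuous_charFun_one_add {χ : Eˣ →* ℂˣ} (hχ : Continuous χ) :
    Continuous fun y : F => charFun χ (1 + algebraMap F E y * α) :=
  continuous_iff_continuousAt.2 fun y => continuousAt_const.congr
    ((eventually_charFun_one_add_eq hα hχ y).mono fun _ hz => hz.symm)

include hdim hα in
/-- Far out, `χ(1 + yα)` equals `χ(y) χ(α)`, in a range that depends only on a group of units on
which `χ` is trivial. -/
lemma exists_charFun_one_add_eq {k : ℤ} (hk : k < 0) :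
    ∃ N : ℕ, ∀ χ : Eˣ →* ℂˣ, (∀ u ∈ unitBall E k hk, χ u = 1) →
      ∀ n : ℤ, N ≤ n → ∀ y : F, n ≤ logAbs y → y ≠ 0 →
      charFun χ (1 + algebraMap F E y * α) = charFun (restrictChar F χ) y * charFun χ α := by
  have hα0 : α ≠ 0 := fun h => hα ⟨0, by rw [h, map_zero]⟩
  have hpos : 0 < nabs α := nabs_pos hα0
  -- It suffices that 1 = (1 + yα) - yα is at most q_E^k |yα|_E in absolute value. For |y|_F ≥ q^N ≥
  -- 1 one has |y|_E = |y|_F² ≥ q^N, so this choice of N is enough.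
  obtain ⟨N, hN⟩ := pow_unbounded_of_one_lt ((resCard E : ℝ) ^ (-k) / nabs α) (one_lt_resCard F)
  rw [div_lt_iff₀ hpos] at hN
  refine ⟨N, fun χ hχ n hn y hy hy0 => ?_⟩
  have hz0 : algebraMap F E y * α ≠ 0 := mul_ne_zero (by simpa using hy0) hα0
  rw [charFun_restrictChar, ← charFun_mul]
  refine charFun_eq_of_sub_mem hχ hz0 ?_
  rw [add_sub_cancel_right, mem_ball, nabs_one, zpow_add₀ (resCard_ne_zero E), ← nabs_eq_zpow hz0,
    nabs_mul, nabs_algebraMap hdim hα]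
  have h1 : (resCard F : ℝ) ^ N ≤ nabs y := by
    rw [nabs_eq_zpow hy0, ← zpow_natCast]
    exact zpow_le_zpow_right₀ (one_lt_resCard F).le (hn.trans hy)
  have h2 : (1 : ℝ) ≤ (resCard F : ℝ) ^ N := one_le_pow₀ (one_lt_resCard F).le
  have h3 : (resCard F : ℝ) ^ N ≤ nabs y ^ 2 := by nlinarith
  have h4 : (resCard E : ℝ) ^ (-k) * (resCard E : ℝ) ^ k = 1 := by
    rw [← zpow_add₀ (resCard_ne_zero E), neg_add_cancel, zpow_zero]
  rw [← h4]
  refine mul_le_mul_of_nonneg_right ?_ (zpow_pos (resCard_pos' E) _).le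
  exact hN.le.trans (mul_le_mul_of_nonneg_right h3 hpos.le)

variable [MeasurableSpace F] [BorelSpace F] (μ : Measure F) [μ.IsAddHaarMeasure]

/-- The integral of `χ(1 + yα)` over the ball of radius `q ^ n`. -/
def partialIntegral (α : E) (χ : Eˣ →* ℂˣ) (n : ℤ) : ℂ :=
  ∫ y in (ball F n : Set F), charFun χ (1 + algebraMap F E y * α) ∂μ

/-- `N` is large enough for `χ(1 + yα) = χ(y) χ(α)` to hold outside the ball of radius `q ^ N`. -/
def IsTailBound (F : Type*) [Field F] [ValuativeRel F] [TopologicalSpace F]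
    [IsNonarchimedeanLocalField F] [Algebra F E] (α : E) (χ : Eˣ →* ℂˣ) (N : ℤ) : Prop :=
  ∀ y : F, y ≠ 0 → N ≤ logAbs y →
    charFun χ (1 + algebraMap F E y * α) = charFun (restrictChar F χ) y * charFun χ α

include hα in
lemma partialIntegral_succ {χ : Eˣ →* ℂˣ} (hχ : Continuous χ) {N n : ℤ}
    (hN : IsTailBound F α χ N) (hn : N ≤ n) :
    partialIntegral μ α χ (n + 1) = partialIntegral μ α χ n + charFun χ α *
      sphereIntegral μ (restrictChar F χ) * sphereRatio (restrictChar F χ) ^ (n + 1) := by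
  have hc := continuous_charFun_one_add hα hχ
  have h1 : ∫ y in sphere F (n + 1), charFun χ (1 + algebraMap F E y * α) ∂μ =
      ∫ y in sphere F (n + 1), charFun (restrictChar F χ) y * charFun χ α ∂μ :=
    setIntegral_congr_fun (isOpen_sphere _).measurableSet fun y hy =>
      hN y (ne_zero_of_mem_sphere hy) (by rw [logAbs_eq hy]; omega)
  rw [partialIntegral, ball_succ_eq_union, setIntegral_union (disjoint_ball_sphere n)
    (isOpen_sphere _).measurableSet (hc.continuousOn.integrableOn_compact (isCompact_ball n))
    (hc.continuousOn.integrableOn_compact (isCompact_sphere _)), h1, integral_mul_const,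
    setIntegral_sphere, partialIntegral]
  ring

/-- The coefficient of the geometric term in the integrals over balls. -/
def tailCoeff (α : E) (χ : Eˣ →* ℂˣ) : ℂ :=
  charFun χ α * sphereIntegral μ (restrictChar F χ) * sphereRatio (restrictChar F χ) /
    (sphereRatio (restrictChar F χ) - 1)

/-- The regularized value of the integral of `χ(1 + yα)`. -/
def regularizedValue (α : E) (χ : Eˣ →* ℂˣ) (N : ℤ) : ℂ :=
  partialIntegral μ α χ N - tailCoeff μ α χ * sphereRatio (restrictChar F χ) ^ N

-- Sum of the geometric series of `partialIntegral_succ`. In the first alternative of `hreg` the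
-- increments vanish, and so does `tailCoeff` whatever its denominator; the second keeps the
-- denominator nonzero.
include hα in
lemma partialIntegral_eq {χ : Eˣ →* ℂˣ} (hχ : Continuous χ) {N : ℤ} (hN : IsTailBound F α χ N)
    (hreg : sphereIntegral μ (restrictChar F χ) = 0 ∨ sphereRatio (restrictChar F χ) ≠ 1)
    {n : ℤ} (hn : N ≤ n) :
    partialIntegral μ α χ n = regularizedValue μ α χ N +
      tailCoeff μ α χ * sphereRatio (restrictChar F χ) ^ n := by
  induction n, hn using Int.leInduction with
  | base => rw [regularizedValue, sub_add_cancel]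
  | succ n hn ih =>
    rw [partialIntegral_succ hα μ hχ hN hn, ih, zpow_add_one₀ (sphereRatio_ne_zero _), tailCoeff]
    rcases hreg with h | h
    · rw [h]; simp
    · have h' : sphereRatio (restrictChar F χ) - 1 ≠ 0 := sub_ne_zero.2 h
      field_simp
      ring

lemma hasImproperIntegral_iff (χ : Eˣ →* ℂˣ) (L : ℂ) :
    HasImproperIntegral μ (fun y => charFun χ (1 + algebraMap F E y * α)) L ↔
      Tendsto (fun n : ℕ => partialIntegral μ α χ n) atTop (𝓝 L) := by
  have h : ∀ n : ℕ, ({y : F | nabs y ≤ (resCard F : ℝ) ^ n}) = (ball F (n : ℤ) : Set F) := by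
    intro n
    ext y
    rw [SetLike.mem_coe, mem_ball, zpow_natCast]
    rfl
  simp only [HasImproperIntegral, partialIntegral, h]

lemma tendsto_tail {r : ℂ} (hr : ‖r‖ < 1) : Tendsto (fun n : ℕ => r ^ (n : ℤ)) atTop (𝓝 0) := by
  simpa using tendsto_pow_atTop_nhds_zero_of_norm_lt_one hr

include hα in
lemma tendsto_partialIntegral {χ : Eˣ →* ℂˣ} (hχ : Continuous χ) {N : ℕ}
    (hN : IsTailBound F α χ N)
    (h : sphereIntegral μ (restrictChar F χ) = 0 ∨ ‖sphereRatio (restrictChar F χ)‖ < 1) :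
    Tendsto (fun n : ℕ => partialIntegral μ α χ n) atTop (𝓝 (regularizedValue μ α χ N)) := by
  have hreg : sphereIntegral μ (restrictChar F χ) = 0 ∨ sphereRatio (restrictChar F χ) ≠ 1 :=
    h.imp_right fun h h1 => by rw [h1, norm_one] at h; exact lt_irrefl _ h
  have hlim : Tendsto (fun n : ℕ => regularizedValue μ α χ N +
      tailCoeff μ α χ * sphereRatio (restrictChar F χ) ^ (n : ℤ)) atTop
      (𝓝 (regularizedValue μ α χ N)) := by
    rcases h with h | h
    · have h0 : tailCoeff μ α χ = 0 := by rw [tailCoeff, h]; simp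
      simp only [h0, zero_mul, add_zero]
      exact tendsto_const_nhds
    · simpa using ((tendsto_tail h).const_mul (tailCoeff μ α χ)).const_add
        (regularizedValue μ α χ N)
  refine hlim.congr' ?_
  filter_upwards [eventually_ge_atTop N] with n hn
  rw [partialIntegral_eq hα μ hχ hN hreg (by exact_mod_cast hn)]

-- The increments of a convergent sequence tend to 0, while here they are a nonzero constant times
-- powers of r. Only increments are used, so the resonant case r = 1 is covered as well.
include hα in
lemma sphereRatio_lt_one_of_tendsto {χ : Eˣ →* ℂˣ} (hχ : Continuous χ) {N : ℕ}
    (hN : IsTailBound F α χ N) {L : ℂ}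
    (hL : Tendsto (fun n : ℕ => partialIntegral μ α χ n) atTop (𝓝 L)) :
    sphereIntegral μ (restrictChar F χ) = 0 ∨ ‖sphereRatio (restrictChar F χ)‖ < 1 := by
  by_contra! hcon
  obtain ⟨h0, h1⟩ := hcon
  have hα0 : α ≠ 0 := fun h => hα ⟨0, by rw [h, map_zero]⟩
  have h2 := ((tendsto_add_atTop_iff_nat 1).2 hL).sub hL
  rw [sub_self] at h2
  have h3 : Tendsto (fun n : ℕ => charFun χ α * sphereIntegral μ (restrictChar F χ) *
      sphereRatio (restrictChar F χ) ^ ((n : ℤ) + 1)) atTop (𝓝 0) := by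
    refine h2.congr' ?_
    filter_upwards [eventually_ge_atTop N] with n hn
    push_cast
    rw [partialIntegral_succ hα μ hχ hN (by exact_mod_cast hn)]
    ring
  have h4 := h3.norm
  rw [norm_zero] at h4
  have h5 : 0 < ‖charFun χ α * sphereIntegral μ (restrictChar F χ)‖ :=
    norm_pos_iff.2 (mul_ne_zero (charFun_ne_zero χ hα0) h0)
  have h6 := h4.eventually (gt_mem_nhds h5)
  obtain ⟨n, hn⟩ := h6.exists
  rw [norm_mul, norm_zpow] at hn
  have h7 : 1 ≤ ‖sphereRatio (restrictChar F χ)‖ ^ ((n : ℤ) + 1) := by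
    exact_mod_cast one_le_pow₀ h1 (n := n + 1)
  nlinarith

lemma restrictChar_normChar (χ : Eˣ →* ℂˣ) :
    restrictChar F (normChar χ) = normChar (restrictChar F χ) := rfl

lemma sphereRatio_normChar (ξ : Fˣ →* ℂˣ) : sphereRatio (normChar ξ) = ‖sphereRatio ξ‖ := by
  simp [sphereRatio, normChar]

lemma sphereIntegral_normChar_ne_zero {ξ : Fˣ →* ℂˣ} (hξ : Continuous ξ) :
    sphereIntegral μ (normChar ξ) ≠ 0 :=
  sphereIntegral_ne_zero μ fun u hu => by
    rw [charFun_normChar, norm_charFun_eq_one hξ hu, Complex.ofReal_one]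

lemma IsTailBound.normChar {χ : Eˣ →* ℂˣ} {N : ℤ} (h : IsTailBound F α χ N) :
    IsTailBound F α (normChar χ) N := fun y hy hn => by
  rw [restrictChar_normChar, charFun_normChar, charFun_normChar, charFun_normChar, h y hy hn,
    norm_mul, Complex.ofReal_mul]

lemma aecover_ball : AECover μ atTop fun n : ℕ => (ball F (n : ℤ) : Set F) where
  ae_eventually_mem := .of_forall fun x => by
    obtain ⟨m, hm⟩ := exists_mem_ball x
    filter_upwards [eventually_ge_atTop m] with n hn
    exact ball_mono (by exact_mod_cast hn) hm
  measurableSet n := measurableSet_ball n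

-- Absolute convergence means convergence of the partial integrals of the character |χ|. Its sphere
-- integral never vanishes and its ratio is |r|, so the improper criteria apply and leave only |r| <
-- 1.
include hα in
lemma integrable_iff_sphereRatio_lt_one {χ : Eˣ →* ℂˣ} (hχ : Continuous χ) {N : ℕ}
    (hN : IsTailBound F α χ N) :
    Integrable (fun y : F => charFun χ (1 + algebraMap F E y * α)) μ ↔
      ‖sphereRatio (restrictChar F χ)‖ < 1 := by
  have hc := continuous_charFun_one_add hα hχ
  have hJ : ∀ n : ℕ, partialIntegral μ α (normChar χ) n =
      ((∫ y in (ball F (n : ℤ) : Set F), ‖charFun χ (1 + algebraMap F E y * α)‖ ∂μ : ℝ) : ℂ) := by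
    intro n
    rw [← integral_complex_ofReal]
    simp only [partialIntegral, charFun_normChar]
  have h1 : ‖sphereRatio (restrictChar F (normChar χ))‖ = ‖sphereRatio (restrictChar F χ)‖ := by
    rw [restrictChar_normChar, sphereRatio_normChar, Complex.norm_real, norm_norm]
  constructor
  · intro hint
    have h2 := (aecover_ball μ).integral_tendsto_of_countably_generated hint.norm
    have h3 : Tendsto (fun n : ℕ => partialIntegral μ α (normChar χ) n) atTop
        (𝓝 ((∫ y, ‖charFun χ (1 + algebraMap F E y * α)‖ ∂μ : ℝ) : ℂ)) := by
      simp only [hJ]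
      exact (Complex.continuous_ofReal.tendsto _).comp h2
    have h4 := sphereRatio_lt_one_of_tendsto hα μ (continuous_normChar hχ) hN.normChar h3
    rw [h1] at h4
    exact h4.resolve_left
      (sphereIntegral_normChar_ne_zero μ (continuous_restrictChar (F := F) hχ))
  · intro hr
    have h2 := tendsto_partialIntegral hα μ (continuous_normChar hχ) hN.normChar
      (.inr (by rwa [h1]))
    have h3 := (Complex.continuous_re.tendsto _).comp h2
    refine (aecover_ball μ).integrable_of_integral_norm_tendsto _
      (fun n => hc.continuousOn.integrableOn_compact (isCompact_ball _)) (h3.congr fun n => ?_)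
    rw [Function.comp_apply, hJ, Complex.ofReal_re]

include hα in
lemma tendsto_integral_of_integrable {χ : Eˣ →* ℂˣ}
    (hint : Integrable (fun y : F => charFun χ (1 + algebraMap F E y * α)) μ) :
    Tendsto (fun n : ℕ => partialIntegral μ α χ n) atTop
      (𝓝 (∫ y, charFun χ (1 + algebraMap F E y * α) ∂μ)) :=
  (aecover_ball μ).integral_tendsto_of_countably_generated hint

end PartialIntegrals

/-! ### Analytic continuation in the twist by a power of the absolute value. -/

section Continuation

variable {F E : Type*} [Field F] [ValuativeRel F] [TopologicalSpace F]
  [IsNonarchimedeanLocalField F] [Field E] [ValuativeRel E] [TopologicalSpace E]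
  [IsNonarchimedeanLocalField E] [Algebra F E] [ValuativeExtension F E]

lemma continuous_mul_absChar {χ : Eˣ →* ℂˣ} (hχ : Continuous χ) (s : ℂ) :
    Continuous (χ * absChar E s : Eˣ →* ℂˣ) := hχ.mul (continuous_absChar s)

variable (hdim : Module.finrank F E = 2) {α : E} (hα : α ∉ (algebraMap F E).range)

-- Twisting by |·|_E^s does not change the character on units near 1, so one bound serves all s.
include hdim hα in
lemma exists_isTailBound {χ : Eˣ →* ℂˣ} (hχ : Continuous χ) :
    ∃ N : ℕ, ∀ s : ℂ, IsTailBound F α (χ * absChar E s) N := by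
  obtain ⟨k, hk, h⟩ := exists_trivial_on_unitBall hχ
  obtain ⟨N, hN⟩ := exists_charFun_one_add_eq hdim hα hk
  refine ⟨N, fun s y hy hn => hN _ (fun u hu => ?_) N le_rfl y hn hy⟩
  rw [MonoidHom.mul_apply, h u hu,
    absChar_apply_of_nabs_eq_one s (nabs_eq_one_of_sub_one_mem hk hu), mul_one]

include hdim hα in
lemma nabs_algebraMap_invUniformizer :
    nabs (algebraMap F E (invUniformizer F)) = (resCard F : ℝ) ^ 2 := by
  rw [nabs_algebraMap hdim hα, nabs_invUniformizer]

include hdim hα in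
lemma sphereRatio_restrictChar_mul_absChar (χ : Eˣ →* ℂˣ) (s : ℂ) :
    sphereRatio (restrictChar F (χ * absChar E s)) =
      sphereRatio (restrictChar F χ) * (((resCard F : ℝ) ^ 2 : ℝ) : ℂ) ^ s := by
  rw [sphereRatio, restrictChar_mul, MonoidHom.mul_apply, Units.val_mul,
    ← charFun_units (restrictChar F (absChar E s)), charFun_restrictChar,
    charFun_absChar _ (by simp), nabs_algebraMap_invUniformizer hdim hα, sphereRatio, mul_assoc]

variable [MeasurableSpace F] [BorelSpace F] (μ : Measure F) [μ.IsAddHaarMeasure]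

include hdim hα in
lemma sphereIntegral_restrictChar_mul_absChar (χ : Eˣ →* ℂˣ) (s : ℂ) :
    sphereIntegral μ (restrictChar F (χ * absChar E s)) =
      sphereIntegral μ (restrictChar F χ) := by
  refine setIntegral_congr_fun (isOpen_sphere 0).measurableSet fun y hy => ?_
  have hy0 : algebraMap F E y ≠ 0 := by simpa using ne_zero_of_mem_sphere hy
  have hy1 : nabs (algebraMap F E y) = 1 := by
    rw [nabs_algebraMap hdim hα, mem_sphere_zero.1 hy, one_pow]
  rw [charFun_restrictChar, charFun_mul_char, charFun_absChar _ hy0, hy1, Complex.ofReal_one,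
    Complex.one_cpow, mul_one, charFun_restrictChar]

-- On a compact ball the pair (χ(1 + yα), |1 + yα|_E) is locally constant and takes finitely many
-- values. The integral is therefore a finite sum of exponentials in s.
include hα in
lemma differentiable_partialIntegral {χ : Eˣ →* ℂˣ} (hχ : Continuous χ) (N : ℤ) :
    Differentiable ℂ fun s => partialIntegral μ α (χ * absChar E s) N := by
  classical
  -- The first component keeps the fibres inside the ball. `Φ` does not involve s, so neither do the
  -- representatives.
  set Φ : F → Prop × ℂ × ℝ := fun y => (y ∈ ball F N, charFun χ (1 + algebraMap F E y * α),
    nabs (1 + algebraMap F E y * α)) with hΦ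
  have hloc : ∀ x ∈ (ball F N : Set F), ∀ᶠ y in 𝓝 x, Φ y = Φ x := by
    intro x hx
    have hcont : Continuous fun z : F => 1 + algebraMap F E z * α :=
      continuous_const.add ((continuous_algebraMap_of_valuativeExtension F E).mul continuous_const)
    filter_upwards [(isOpen_ball N).mem_nhds hx, eventually_charFun_one_add_eq hα hχ x,
      hcont.continuousAt.eventually (eventually_nabs_eq (one_add_algebraMap_mul_ne_zero hα x))]
      with y h1 h2 h3
    simp only [hΦ, h2, h3, Prod.mk.injEq, and_true, eq_iff_iff]
    exact ⟨fun _ => hx, fun _ => h1⟩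
  obtain ⟨t, htC, ht⟩ := exists_finset_fiber_decomposition (isCompact_ball N) Φ hloc
  have hfib : ∀ a ∈ t, IsOpen {y | Φ y = Φ a} ∧ {y | Φ y = Φ a} ⊆ ball F N := by
    intro a ha
    have hsub : {y | Φ y = Φ a} ⊆ ball F N := by
      intro y hy
      have : (y ∈ ball F N) = (a ∈ ball F N) := congrArg Prod.fst hy
      exact this.symm ▸ htC ha
    refine ⟨isOpen_iff_mem_nhds.2 fun y hy => ?_, hsub⟩
    filter_upwards [hloc y (hsub hy)] with z hz
    exact hz.trans hy
  have key : ∀ s, partialIntegral μ α (χ * absChar E s) N = ∑ a ∈ t,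
      charFun χ (1 + algebraMap F E a * α) * (nabs (1 + algebraMap F E a * α) : ℂ) ^ s *
        μ.real {y | Φ y = Φ a} := by
    intro s
    have hdec := ht ((ball F N : Set F).indicator
      fun y => charFun (χ * absChar E s) (1 + algebraMap F E y * α)) ?_ ?_
    · rw [partialIntegral, ← integral_indicator (measurableSet_ball N)]
      rw [integral_congr_ae (.of_forall hdec), integral_finsetSum]
      · refine Finset.sum_congr rfl fun a ha => ?_
        rw [integral_const_mul, integral_indicator_one_complex μ (hfib a ha).1.measurableSet,
          Set.indicator_of_mem (htC ha), charFun_mul_char,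
          charFun_absChar _ (one_add_algebraMap_mul_ne_zero hα a)]
      · intro a ha
        refine Integrable.const_mul ?_ _
        refine IntegrableOn.integrable_indicator ?_ (hfib a ha).1.measurableSet
        exact (integrableOn_const (C := (1 : ℂ)) (isCompact_ball N).measure_lt_top.ne).mono_set
          (hfib a ha).2
    · intro x y hxy
      have h1 : (x ∈ (ball F N : Set F)) = (y ∈ (ball F N : Set F)) := congrArg Prod.fst hxy
      have h2 : charFun χ (1 + algebraMap F E x * α) = charFun χ (1 + algebraMap F E y * α) :=
        congrArg (fun p => p.2.1) hxy
      have h3 : nabs (1 + algebraMap F E x * α) = nabs (1 + algebraMap F E y * α) :=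
        congrArg (fun p => p.2.2) hxy
      have h4 : charFun (χ * absChar E s) (1 + algebraMap F E x * α) =
          charFun (χ * absChar E s) (1 + algebraMap F E y * α) := by
        rw [charFun_mul_char, charFun_mul_char, h2,
          charFun_absChar _ (one_add_algebraMap_mul_ne_zero hα x),
          charFun_absChar _ (one_add_algebraMap_mul_ne_zero hα y), h3]
      rw [Set.indicator_apply, Set.indicator_apply, h4]
      exact if_congr (iff_of_eq h1) rfl rfl
    · intro x hx
      by_contra h
      exact hx (Set.indicator_of_notMem h _)
  rw [show (fun s => partialIntegral μ α (χ * absChar E s) N) = _ from funext key]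
  refine Differentiable.fun_sum fun a _ => ?_
  refine Differentiable.mul_const (Differentiable.const_mul ?_ _) _
  intro s
  refine DifferentiableAt.const_cpow differentiableAt_id (.inl ?_)
  exact_mod_cast (nabs_pos (one_add_algebraMap_mul_ne_zero hα a)).ne'

include hdim hα in
lemma regularizedValue_mul_absChar (χ : Eˣ →* ℂˣ) (N : ℤ) (s : ℂ) :
    regularizedValue μ α (χ * absChar E s) N = partialIntegral μ α (χ * absChar E s) N -
      (charFun χ α * (nabs α : ℂ) ^ s * sphereIntegral μ (restrictChar F χ) *
        (sphereRatio (restrictChar F χ) * (((resCard F : ℝ) ^ 2 : ℝ) : ℂ) ^ s) /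
        (sphereRatio (restrictChar F χ) * (((resCard F : ℝ) ^ 2 : ℝ) : ℂ) ^ s - 1)) *
      (sphereRatio (restrictChar F χ) * (((resCard F : ℝ) ^ 2 : ℝ) : ℂ) ^ s) ^ N := by
  have hα0 : α ≠ 0 := fun h => hα ⟨0, by rw [h, map_zero]⟩
  rw [regularizedValue, tailCoeff, sphereRatio_restrictChar_mul_absChar hdim hα,
    sphereIntegral_restrictChar_mul_absChar hdim hα, charFun_mul_char, charFun_absChar _ hα0]

lemma analyticAt_const_cpow {c : ℝ} (hc : 0 < c) (z : ℂ) :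
    AnalyticAt ℂ (fun s : ℂ => (c : ℂ) ^ s) z :=
  Differentiable.analyticAt (fun _ => DifferentiableAt.const_cpow differentiableAt_id
    (.inl (by exact_mod_cast hc.ne'))) z

include hdim hα in
lemma meromorphicOn_regularizedValue {χ : Eˣ →* ℂˣ} (hχ : Continuous χ) (N : ℤ) :
    MeromorphicOn (fun s => regularizedValue μ α (χ * absChar E s) N) Set.univ := by
  intro z _
  have hα0 : α ≠ 0 := fun h => hα ⟨0, by rw [h, map_zero]⟩
  simp only [regularizedValue_mul_absChar hdim hα]
  have h1 := ((differentiable_partialIntegral hα μ hχ N).analyticAt z).meromorphicAt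
  have h2 := (analyticAt_const_cpow (nabs_pos hα0) z).meromorphicAt
  have h3 := (analyticAt_const_cpow (pow_pos (resCard_pos' F) 2) z).meromorphicAt
  have h4 := (MeromorphicAt.const (sphereRatio (restrictChar F χ)) z).fun_mul h3
  exact h1.fun_sub (((((((MeromorphicAt.const (charFun χ α) z).fun_mul h2).fun_mul
    (MeromorphicAt.const (sphereIntegral μ (restrictChar F χ)) z)).fun_mul h4).fun_div
    (h4.fun_sub (MeromorphicAt.const 1 z)))).fun_mul (h4.fun_zpow N))

-- The only possible pole at s = 0 comes from the denominator r q^{2s} - 1. It is nonzero there, or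
-- else its numerator vanishes identically.
include hdim hα in
lemma analyticAt_regularizedValue {χ : Eˣ →* ℂˣ} (hχ : Continuous χ) (N : ℕ)
    (hreg : sphereIntegral μ (restrictChar F χ) = 0 ∨ sphereRatio (restrictChar F χ) ≠ 1) :
    AnalyticAt ℂ (fun s => regularizedValue μ α (χ * absChar E s) N) 0 := by
  have hα0 : α ≠ 0 := fun h => hα ⟨0, by rw [h, map_zero]⟩
  simp only [regularizedValue_mul_absChar hdim hα]
  have h1 := (differentiable_partialIntegral hα μ hχ N).analyticAt 0
  rcases hreg with h | h
  · simpa [h] using h1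
  · have h2 := analyticAt_const_cpow (nabs_pos hα0) 0
    have h3 := analyticAt_const_cpow (pow_pos (resCard_pos' F) 2) 0
    have h4 := (analyticAt_const (v := sphereRatio (restrictChar F χ)) (x := (0 : ℂ))).fun_mul h3
    simp only [zpow_natCast]
    refine h1.fun_sub ((((((analyticAt_const (v := charFun χ α)).fun_mul h2).fun_mul
      (analyticAt_const (v := sphereIntegral μ (restrictChar F χ)))).fun_mul h4).fun_div
      (h4.fun_sub (analyticAt_const (v := 1))) ?_).fun_mul (h4.fun_pow N))
    simpa using sub_ne_zero.2 h

lemma mul_absChar_zero (χ : Eˣ →* ℂˣ) : χ * absChar E 0 = χ := by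
  ext
  simp [absChar_zero]

include hα in
lemma integral_eq_regularizedValue {χ : Eˣ →* ℂˣ} (hχ : Continuous χ) {N : ℕ}
    (hN : IsTailBound F α χ N)
    (hint : Integrable (fun y : F => charFun χ (1 + algebraMap F E y * α)) μ) :
    ∫ y, charFun χ (1 + algebraMap F E y * α) ∂μ = regularizedValue μ α χ N :=
  tendsto_nhds_unique (tendsto_integral_of_integrable hα μ hint) (tendsto_partialIntegral hα μ hχ hN
    (.inr ((integrable_iff_sphereRatio_lt_one hα μ hχ hN).1 hint)))

-- The regularized value is itself the continuation: it agrees with the integral as soon as |r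
-- q^{2s}| < 1, and any improper limit must equal it because the tail then vanishes in the limit.
include hdim hα in
lemma integralHasValue_regularizedValue {χ : Eˣ →* ℂˣ} (hχ : Continuous χ) {N : ℕ}
    (hN : ∀ s : ℂ, IsTailBound F α (χ * absChar E s) N)
    (hreg : sphereIntegral μ (restrictChar F χ) = 0 ∨ sphereRatio (restrictChar F χ) ≠ 1) :
    IntegralHasValue μ (fun s y => charFun (χ * absChar E s) (1 + algebraMap F E y * α))
      (regularizedValue μ α χ N) := by
  have hN0 : IsTailBound F α χ N := by simpa only [mul_absChar_zero] using hN 0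
  refine ⟨⟨fun s => regularizedValue μ α (χ * absChar E s) N,
    meromorphicOn_regularizedValue hdim hα μ hχ N, ?_,
    analyticAt_regularizedValue hdim hα μ hχ N hreg, by simp only [mul_absChar_zero]⟩, ?_, ?_⟩
  · have hq := one_lt_resCard F
    have hq0 := resCard_pos' F
    set ρ := ‖sphereRatio (restrictChar F χ)‖ with hρ
    have hρ0 : 0 < ρ := norm_pos_iff.2 (sphereRatio_ne_zero _)
    -- The solution of ρ (q²)^σ₀ = 1.
    refine ⟨-Real.logb ((resCard F : ℝ) ^ 2) ρ, fun s hs => ?_⟩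
    have hlt : ‖sphereRatio (restrictChar F (χ * absChar E s))‖ < 1 := by
      rw [sphereRatio_restrictChar_mul_absChar hdim hα, norm_mul,
        Complex.norm_cpow_eq_rpow_re_of_pos (pow_pos hq0 2), ← hρ]
      have h2 : ((resCard F : ℝ) ^ 2) ^ s.re < ρ⁻¹ := by
        rw [← Real.lt_logb_iff_rpow_lt (one_lt_pow₀ hq two_ne_zero) (inv_pos.2 hρ0), Real.logb_inv]
        exact hs
      rw [mul_comm]
      exact (lt_inv_mul_iff₀' hρ0).1 (by rwa [mul_one])
    have hint := (integrable_iff_sphereRatio_lt_one hα μ (continuous_mul_absChar hχ s) (hN s)).2 hlt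
    exact ⟨hint, (integral_eq_regularizedValue hα μ (continuous_mul_absChar hχ s) (hN s) hint).symm⟩
  · intro hint
    simp only [mul_absChar_zero] at hint ⊢
    exact integral_eq_regularizedValue hα μ hχ hN0 hint
  · intro L hL
    simp only [mul_absChar_zero] at hL
    rw [hasImproperIntegral_iff] at hL
    exact tendsto_nhds_unique hL (tendsto_partialIntegral hα μ hχ hN0
      (sphereRatio_lt_one_of_tendsto hα μ hχ hN0 hL))

omit [MeasurableSpace F] [BorelSpace F] in
lemma restrictedDual_eq (χ : Eˣ →* ℂˣ) (x : F) :
    charFun (restrictedDual χ : Fˣ →* ℂˣ) x =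
      (charFun (restrictChar F χ) x)⁻¹ * (nabs x : ℂ)⁻¹ := by
  rw [← charFun_absChar_neg_one, ← charFun_inv_char, ← charFun_mul_char]
  rfl

/-- In the resonant case χ(x)|x|_F is a power of r = 1 on Fˣ, so the dual character is trivial:
resonance occurs only at the pole of the gamma factor on F. -/
lemma regular_of_restrictedDual_ne_one {χ : Eˣ →* ℂˣ}
    (h : (restrictedDual χ : Fˣ →* ℂˣ) ≠ 1) :
    sphereIntegral μ (restrictChar F χ) = 0 ∨ sphereRatio (restrictChar F χ) ≠ 1 := by
  by_contra! hcon
  refine h (MonoidHom.ext fun x => Units.ext ?_)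
  rw [← charFun_units, restrictedDual_eq, ← mul_inv, charFun_mul_nabs_eq μ hcon.1 x.ne_zero,
    hcon.2]
  simp

end Continuation

/-! ### A test function that separates the character from the trivial one. -/

section TestVector

variable {K : Type*} [Field K] [ValuativeRel K] [TopologicalSpace K] [IsNonarchimedeanLocalField K]
  [MeasurableSpace K] [BorelSpace K] (μ : Measure K) [μ.IsAddHaarMeasure]

/-- If φ is the indicator of a small group of units and ξ(a) ≠ 1, the dilate of φ by a minus |a|φ
has integral 0 and pairs with ξ to (ξ(a) - 1)|a| times a volume. The vanishing integral will kill
both the geometric tail and the transform at 0. -/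
lemma exists_testFunction_integral_eq_zero {ξ : Kˣ →* ℂˣ} (hξ : Continuous ξ) (hξ1 : ξ ≠ 1) :
    ∃ h : testFunctions K, h.1 0 = 0 ∧ ∫ x, h.1 x ∂μ = 0 ∧ ∫ x, charFun ξ x * h.1 x ∂μ ≠ 0 := by
  obtain ⟨a, ha⟩ := DFunLike.ne_iff.1 hξ1
  obtain ⟨k, hk, htriv⟩ := exists_trivial_on_unitBall hξ
  set φ := unitIndicator K k with hφ
  have hφ0 : φ.1 0 = 0 := unitIndicator_zero hk
  have hd0 : (dilate a φ).1 0 = 0 := by rw [dilate_apply_zero, hφ0]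
  have hval : ∀ x, (dilate a φ - (nabs (a : K) : ℂ) • φ).1 x =
      (dilate a φ).1 x - (nabs (a : K) : ℂ) * φ.1 x := fun x => rfl
  refine ⟨dilate a φ - (nabs (a : K) : ℂ) • φ, ?_, ?_, ?_⟩
  · rw [hval, hd0, hφ0, mul_zero, sub_zero]
  · simp only [hval]
    rw [integral_sub (integrable_of_mem_testFunctions μ (dilate a φ).2)
      ((integrable_of_mem_testFunctions μ φ.2).const_mul _), integral_const_mul]
    have h := integral_comp_mul_left' μ a φ.1
    exact sub_eq_zero.2 h
  · simp only [hval, mul_sub, mul_left_comm (charFun ξ _)]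
    rw [integral_sub (integrable_charFun_mul μ hξ (dilate a φ).2 hd0)
      ((integrable_charFun_mul μ hξ φ.2 hφ0).const_mul _), integral_const_mul,
      integral_charFun_mul_dilate, integral_charFun_mul_unitIndicator μ hk htriv]
    have h1 : (ξ a : ℂ) - 1 ≠ 0 := sub_ne_zero.2 fun h => ha (Units.ext h)
    have h2 : (nabs (a : K) : ℂ) ≠ 0 := by exact_mod_cast (nabs_pos a.ne_zero).ne'
    have h3 : (μ.real (ball K k) : ℂ) ≠ 0 := by exact_mod_cast (measureReal_ball_pos μ k).ne'
    have e : (ξ a : ℂ) * (nabs (a : K) : ℂ) * (μ.real (ball K k) : ℂ) -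
        (nabs (a : K) : ℂ) * (μ.real (ball K k) : ℂ) =
        ((ξ a : ℂ) - 1) * (nabs (a : K) : ℂ) * (μ.real (ball K k) : ℂ) := by ring
    rw [e]
    exact mul_ne_zero (mul_ne_zero h1 h2) h3

variable (K) in
/-- The indicator function of the ball of radius `q ^ n`. -/
def ballIndicator (n : ℤ) : testFunctions K :=
  ⟨Set.indicator (ball K n : Set K) 1, indicator_mem_testFunctions (isOpen_ball n) (isCompact_ball n)⟩

lemma ballIndicator_apply (n : ℤ) (x : K) :
    (ballIndicator K n).1 x = Set.indicator (ball K n : Set K) 1 x := rfl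

lemma charFun_neg_one_mul_self (ξ : Kˣ →* ℂˣ) : charFun ξ (-1) * charFun ξ (-1) = 1 := by
  rw [← charFun_mul, neg_mul_neg, mul_one, charFun_one]

end TestVector

/-! ### Integrals of characters over long and thin strips. -/

section CoreIdentity

variable {F E : Type*} [Field F] [ValuativeRel F] [TopologicalSpace F]
  [IsNonarchimedeanLocalField F] [Field E] [ValuativeRel E] [TopologicalSpace E]
  [IsNonarchimedeanLocalField E] [Algebra F E] [ValuativeExtension F E]
  [MeasurableSpace F] [BorelSpace F] (μ : Measure F) [μ.IsAddHaarMeasure]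
  (hdim : Module.finrank F E = 2) {α : E} (hα : α ∉ (algebraMap F E).range)

/-- Write x + yα = x(1 + x⁻¹yα) and substitute; the radius of the ball is divided by |x|. -/
lemma setIntegral_charFun_add (χ : Eˣ →* ℂˣ) (M : ℤ) {x : F} (hx : x ≠ 0) :
    ∫ y in (ball F M : Set F), charFun χ (algebraMap F E x + algebraMap F E y * α) ∂μ =
      charFun (restrictChar F χ) x * (nabs x : ℂ) * partialIntegral μ α χ (M - logAbs x) := by
  have h := integral_comp_mul_left' μ (Units.mk0 x hx) ((ball F (M - logAbs x) : Set F).indicator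
    fun y => charFun χ (1 + algebraMap F E y * α))
  have hx' : algebraMap F E x ≠ 0 := by simpa using hx
  have e : ∀ y, (ball F (M - logAbs x) : Set F).indicator
      (fun y => charFun χ (1 + algebraMap F E y * α)) (((Units.mk0 x hx)⁻¹ : Fˣ) * y) =
      (charFun (restrictChar F χ) x)⁻¹ * (ball F M : Set F).indicator
        (fun y => charFun χ (algebraMap F E x + algebraMap F E y * α)) y := by
    intro y
    have hmem : x⁻¹ * y ∈ (ball F (M - logAbs x) : Set F) ↔ y ∈ (ball F M : Set F) := by
      rw [SetLike.mem_coe, SetLike.mem_coe, mem_ball, mem_ball, nabs_mul, nabs_inv,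
        zpow_sub₀ (resCard_ne_zero F), ← nabs_eq_zpow hx, inv_mul_eq_div,
        div_le_div_iff_of_pos_right (nabs_pos hx)]
    rw [Units.val_inv_eq_inv_val, Units.val_mk0]
    by_cases hy : y ∈ (ball F M : Set F)
    · have e' : 1 + algebraMap F E (x⁻¹ * y) * α =
          (algebraMap F E x)⁻¹ * (algebraMap F E x + algebraMap F E y * α) := by
        rw [map_mul, map_inv₀]
        field_simp
      rw [Set.indicator_of_mem hy, Set.indicator_of_mem (hmem.2 hy), charFun_restrictChar, e',
        charFun_mul, charFun_inv]
    · rw [Set.indicator_of_notMem hy, Set.indicator_of_notMem (hmem.not.2 hy), mul_zero]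
  simp only [e] at h
  rw [integral_const_mul, integral_indicator (measurableSet_ball _),
    integral_indicator (measurableSet_ball _), Units.val_mk0,
    inv_mul_eq_iff_eq_mul₀ (charFun_ne_zero _ hx)] at h
  rw [h, partialIntegral, mul_assoc]

-- The cancellation on which the formula rests: when the tail is present, χ(x)|x|_F is r to the
-- power log_q |x|, which turns the tail r^(M - log_q |x|) into r^M, independent of x.
include hα in
lemma mul_partialIntegral_eq {χ : Eˣ →* ℂˣ} (hχ : Continuous χ) {N : ℤ} (hN : IsTailBound F α χ N)
    (hreg : sphereIntegral μ (restrictChar F χ) = 0 ∨ sphereRatio (restrictChar F χ) ≠ 1)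
    {M : ℤ} {x : F} (hx : x ≠ 0) (hM : N ≤ M - logAbs x) :
    charFun (restrictChar F χ) x * (nabs x : ℂ) * partialIntegral μ α χ (M - logAbs x) =
      charFun (restrictChar F χ) x * (nabs x : ℂ) * regularizedValue μ α χ N +
        tailCoeff μ α χ * sphereRatio (restrictChar F χ) ^ M := by
  rw [partialIntegral_eq hα μ hχ hN hreg hM, mul_add]
  congr 1
  by_cases h : sphereIntegral μ (restrictChar F χ) = 0
  · rw [tailCoeff, h]
    simp
  · have hr := sphereRatio_ne_zero (restrictChar F χ)
    rw [charFun_mul_nabs_eq μ h hx, zpow_sub₀ hr]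
    field_simp

include hα in
/-- The integral of `χ` against a function concentrated on a long strip around a test function
`h` on the first coordinate axis. -/
lemma integral_mul_setIntegral_charFun {χ : Eˣ →* ℂˣ} (hχ : Continuous χ) {N : ℤ}
    (hN : IsTailBound F α χ N)
    (hreg : sphereIntegral μ (restrictChar F χ) = 0 ∨ sphereRatio (restrictChar F χ) ≠ 1)
    (h : testFunctions F) (h0 : h.1 0 = 0) (hint : ∫ x, h.1 x ∂μ = 0) {B M : ℤ}
    (hB : ∀ x, h.1 x ≠ 0 → x ∈ ball F B) (hM : N ≤ M - B) :
    ∫ x, h.1 x * ∫ y in (ball F M : Set F),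
        charFun χ (algebraMap F E x + algebraMap F E y * α) ∂μ ∂μ =
      regularizedValue μ α χ N *
        ∫ x, charFun (restrictChar F χ * absChar F 1) x * h.1 x ∂μ := by
  have hη : Continuous (restrictChar F χ * absChar F 1 : Fˣ →* ℂˣ) :=
    (continuous_restrictChar hχ).mul (continuous_absChar 1)
  -- The tail contributes a constant multiple of h, which integrates to 0.
  have e : ∀ x, h.1 x * ∫ y in (ball F M : Set F),
      charFun χ (algebraMap F E x + algebraMap F E y * α) ∂μ =
      regularizedValue μ α χ N * (charFun (restrictChar F χ * absChar F 1) x * h.1 x) +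
        tailCoeff μ α χ * sphereRatio (restrictChar F χ) ^ M * h.1 x := by
    intro x
    by_cases hx : h.1 x = 0
    · simp [hx]
    · have hx0 : x ≠ 0 := fun h' => hx (by rw [h', h0])
      have hxB : logAbs x ≤ B := by
        have := mem_ball.1 (hB x hx)
        rwa [nabs_eq_zpow hx0, zpow_le_zpow_iff_right₀ (one_lt_resCard F)] at this
      rw [setIntegral_charFun_add μ χ M hx0,
        mul_partialIntegral_eq μ hα hχ hN hreg hx0 (by omega), charFun_mul_char,
        charFun_absChar_one]
      ring
  simp only [e]
  rw [integral_add ((integrable_charFun_mul μ hη h.2 h0).const_mul _)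
    ((integrable_of_mem_testFunctions μ h.2).const_mul _), integral_const_mul, integral_const_mul,
    hint, mul_zero, add_zero]

variable [MeasurableSpace E] [BorelSpace E]

include hdim in
/-- The integral of a character against a test function concentrated on a thin strip around
the first coordinate axis. -/
lemma exists_integral_charFun_mul_tensor {η : Eˣ →* ℂˣ} (hη : Continuous η) (g : testFunctions F)
    (hg : g.1 0 = 0) : ∃ n₀ : ℤ, ∀ n ≤ n₀,
      ∫ z, charFun η z * (tensor hdim hα g (ballIndicator F n)).1 z ∂(prodMeasure μ α) =
        μ.real (ball F n) * ∫ x, charFun (restrictChar F η) x * g.1 x ∂μ := by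
  obtain ⟨k, hk, htriv⟩ := exists_trivial_on_unitBall hη
  obtain ⟨j, -, hj, -⟩ := exists_invariant_of_mem_testFunctions g.2
  have hα0 : α ≠ 0 := fun h => hα ⟨0, by rw [h, map_zero]⟩
  have hαpos := nabs_pos hα0
  have hq0 := resCard_pos' F
  -- Chosen so that |y|_F² ≤ R and |x|_F ≥ q^j imply |yα|_E ≤ |x|_E q_E^k, which gives η(x + yα) =
  -- η(x). The additional bound |y|_F ≤ 1 below yields |y|_F² ≤ |y|_F.
  set R : ℝ := ((resCard F : ℝ) ^ j) ^ 2 * (resCard E : ℝ) ^ k / nabs α with hR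
  have hRpos : 0 < R := div_pos (mul_pos (pow_pos (zpow_pos hq0 j) 2)
    (zpow_pos (resCard_pos' E) k)) hαpos
  obtain ⟨n₀, hn₀⟩ := exists_zpow_lt F (lt_min hRpos one_pos)
  refine ⟨n₀, fun n hn => ?_⟩
  have hqn : (resCard F : ℝ) ^ n ≤ (resCard F : ℝ) ^ n₀ :=
    zpow_le_zpow_right₀ (one_lt_resCard F).le hn
  have hqn1 : (resCard F : ℝ) ^ n ≤ 1 := hqn.trans (hn₀.le.trans (min_le_right _ _))
  have hqnR : (resCard F : ℝ) ^ n ≤ R := hqn.trans (hn₀.le.trans (min_le_left _ _))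
  rw [integral_prodMeasure hdim hα]
  have e : ∀ z : F × F, charFun η (quadHomeomorph hdim hα z) *
      (tensor hdim hα g (ballIndicator F n)).1 (quadHomeomorph hdim hα z) =
      (charFun (restrictChar F η) z.1 * g.1 z.1) * (ballIndicator F n).1 z.2 := by
    rintro ⟨x, y⟩
    rw [tensor_apply]
    by_cases hgx : g.1 x = 0
    · simp [hgx]
    by_cases hy : y ∈ (ball F n : Set F)
    · have hx0 : x ≠ 0 := fun h => hgx (by rw [h, hg])
      have hx' : algebraMap F E x ≠ 0 := by simpa using hx0
      -- g vanishes at 0 and is invariant under the ball of radius q^j, hence vanishes on it.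
      have hxj : (resCard F : ℝ) ^ j ≤ nabs x := by
        by_contra hlt
        have := hj 0 x (mem_ball.2 (not_le.1 hlt).le)
        rw [zero_add, hg] at this
        exact hgx this
      have hyn : nabs y ≤ (resCard F : ℝ) ^ n := hy
      have key : charFun η (quadHomeomorph hdim hα (x, y)) = charFun η (algebraMap F E x) := by
        refine charFun_eq_of_sub_mem htriv hx' ?_
        rw [quadHomeomorph_apply, add_sub_cancel_left, mem_ball, zpow_add₀ (resCard_ne_zero E),
          ← nabs_eq_zpow hx', nabs_mul, nabs_algebraMap hdim hα, nabs_algebraMap hdim hα]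
        have h1 : nabs y ^ 2 ≤ R := by
          have := nabs_nonneg y
          nlinarith
        rw [hR, le_div_iff₀ hαpos] at h1
        refine h1.trans (mul_le_mul_of_nonneg_right ?_ (zpow_pos (resCard_pos' E) k).le)
        exact pow_le_pow_left₀ (zpow_pos hq0 j).le hxj 2
      rw [key, charFun_restrictChar, mul_assoc]
    · rw [ballIndicator_apply, Set.indicator_of_notMem hy, mul_zero, mul_zero, mul_zero]
  rw [integral_congr_ae (.of_forall e), integral_prod_mul
    (fun x => charFun (restrictChar F η) x * g.1 x) (ballIndicator F n).1, mul_comm]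
  congr 1
  exact integral_indicator_one_complex μ (measurableSet_ball n)

include hdim in
/-- The integral of a character against `x₁ + x₂ α ↦ h(x₁) 1_B(x₂)` as an iterated integral. -/
lemma integral_charFun_mul_tensor {η : Eˣ →* ℂˣ} (hη : Continuous η) (h : testFunctions F)
    (h0 : h.1 0 = 0) (M : ℤ) :
    ∫ z, charFun η z * (tensor hdim hα h (ballIndicator F M)).1 z ∂(prodMeasure μ α) =
      ∫ x, h.1 x * ∫ y in (ball F M : Set F),
        charFun η (algebraMap F E x + algebraMap F E y * α) ∂μ ∂μ := by
  have := prodMeasure_isAddHaarMeasure hdim hα μ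
  have hint := integrable_charFun_mul (prodMeasure μ α) hη
    (tensor hdim hα h (ballIndicator F M)).2 (tensor_zero hdim hα h0)
  have hint' := (quadHomeomorph hdim hα).measurableEmbedding.integrable_map_iff.1 hint
  rw [integral_prodMeasure hdim hα]
  refine (integral_prod _ hint').trans (integral_congr_ae (.of_forall fun x => ?_))
  simp only [Function.comp_apply, tensor_apply]
  rw [← integral_indicator (measurableSet_ball M), ← integral_const_mul]
  refine integral_congr_ae (.of_forall fun y => ?_)
  simp only [ballIndicator_apply]
  by_cases hy : y ∈ (ball F M : Set F)
  · rw [Set.indicator_of_mem hy, Set.indicator_of_mem hy, quadHomeomorph_apply, Pi.one_apply]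
    ring
  · rw [Set.indicator_of_notMem hy, Set.indicator_of_notMem hy]
    ring

end CoreIdentity

/-! ### The regularized integral as a product of gamma factors. -/

section GammaProduct

variable {F E : Type*} [Field F] [ValuativeRel F] [TopologicalSpace F]
  [IsNonarchimedeanLocalField F] [Field E] [ValuativeRel E] [TopologicalSpace E]
  [IsNonarchimedeanLocalField E] [Algebra F E] [ValuativeExtension F E]
  [MeasurableSpace F] [BorelSpace F] (μ : Measure F) [μ.IsAddHaarMeasure]
  [MeasurableSpace E] [BorelSpace E]
  (hdim : Module.finrank F E = 2) {α : E} (hα : α ∉ (algebraMap F E).range)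

lemma dilate_neg_one_apply (h : testFunctions F) (x : F) : (dilate (-1) h).1 x = h.1 (-x) := by
  simp [dilate_apply]

lemma fourier_fourier {ψ : AddChar F Circle} {c : ℝ} (hc0 : c ≠ 0)
    (hc : IsInversionConstant μ ψ c) (h : testFunctions F) (x : F) :
    fourier μ ψ (fourier μ ψ h.1) x = (c : ℂ)⁻¹ * (dilate (-1) h).1 x := by
  have h1 := hc h.1 h.2 (-x)
  simp only [neg_mul, neg_neg] at h1
  rw [dilate_neg_one_apply, h1, ← mul_assoc, inv_mul_cancel₀ (by exact_mod_cast hc0), one_mul]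
  rfl

lemma fourier_ballIndicator_mul {ψ : AddChar F Circle} {e : ℤ} (hψ : IsConductor ψ e) {d : F}
    (hd : d ≠ 0) (n : ℤ) (y : F) :
    fourier μ ψ (ballIndicator F n).1 (d * y) =
      μ.real (ball F n) * (ballIndicator F (e - n - logAbs d)).1 y := by
  have h := fourier_indicator_ball μ hψ n (d * y)
  have hmem : d * y ∈ (ball F (e - n) : Set F) ↔ y ∈ (ball F (e - n - logAbs d) : Set F) := by
    rw [SetLike.mem_coe, SetLike.mem_coe, mem_ball, mem_ball, nabs_mul,
      zpow_sub₀ (resCard_ne_zero F) (e - n), ← nabs_eq_zpow hd, le_div_iff₀ (nabs_pos hd), mul_comm]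
  rw [ballIndicator_apply]
  refine h.trans ?_
  congr 1
  by_cases hy : y ∈ (ball F (e - n - logAbs d) : Set F)
  · rw [Set.indicator_of_mem hy, Set.indicator_of_mem (hmem.2 hy), Pi.one_apply, Pi.one_apply]
  · rw [Set.indicator_of_notMem hy, Set.indicator_of_notMem (hmem.not.2 hy)]

lemma continuous_restrictedDual {χ : Eˣ →* ℂˣ} (hχ : Continuous χ) :
    Continuous (restrictedDual χ : Fˣ →* ℂˣ) :=
  (continuous_restrictChar (F := F) hχ).inv.mul (continuous_absChar (-1))

lemma mul_absChar_mul_absChar (χ : Eˣ →* ℂˣ) (s t : ℂ) :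
    χ * absChar E s * absChar E t = χ * absChar E (s + t) := by
  ext
  simp [absChar_add, mul_assoc]

/-- The regularized integral of `χ(1 + yα)` as a product of gamma factors. -/
theorem regularizedValue_eq_gammaProduct {d : F} (hd : α ^ 2 = algebraMap F E d)
    {ψ : AddChar F Circle} (hψ : Continuous ψ) (hψ1 : ψ ≠ 1) {c : ℝ} (hc0 : c ≠ 0)
    (hc : IsInversionConstant μ ψ c) {χ : Eˣ →* ℂˣ} (hχ : Continuous χ)
    (hχ1 : (restrictedDual χ : Fˣ →* ℂˣ) ≠ 1) (hχ2 : χ * absChar E 1 ≠ 1)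
    {N : ℤ} (hN : IsTailBound F α χ N) :
    regularizedValue μ α χ N = c * charFun χ (-1) * gammaProduct hdim hα μ ψ χ := by
  have hα0 : α ≠ 0 := fun h => hα ⟨0, by rw [h, map_zero]⟩
  have hd0 : d ≠ 0 := by
    rintro rfl
    rw [map_zero] at hd
    exact hα0 (pow_eq_zero_iff two_ne_zero |>.1 hd)
  have := prodMeasure_isAddHaarMeasure hdim hα μ
  obtain ⟨e, he⟩ := exists_isConductor hψ hψ1
  have hξ := continuous_restrictedDual (F := F) hχ
  obtain ⟨v, -, v2, v3⟩ := isGammaFactor_gammaFactor μ hψ hψ1 hξ hχ1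
  obtain ⟨u, -, u2, u3⟩ := isGammaFactor_gammaFactor (prodMeasure μ α)
    (continuous_extendAddChar hdim hα hψ) (extendAddChar_ne_one hdim hα hψ1)
    (continuous_mul_absChar hχ 1) hχ2
  have hreg := regular_of_restrictedDual_ne_one μ hχ1
  rw [gammaProduct]
  set ξ : Fˣ →* ℂˣ := restrictedDual χ with hξdef
  set ΓF := gammaFactor μ ψ ξ
  set ΓE := gammaFactor (prodMeasure μ α) (extendAddChar hdim hα ψ) (χ * absChar E 1)
  have hξ1 : ξ⁻¹ ≠ 1 := fun h => hχ1 (MonoidHom.ext fun x => by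
    simpa using DFunLike.congr_fun h x)
  obtain ⟨h, h0, hint, hS⟩ := exists_testFunction_integral_eq_zero μ (ξ := ξ⁻¹) hξ.inv hξ1
  set S := ∫ x, charFun ξ⁻¹ x * h.1 x ∂μ with hSdef
  -- the side of `F`
  obtain ⟨g, hg, hvg⟩ := v3 h h0
  -- The transform at 0 is ∫ h = 0. Thus v evaluated at g is an actual integral, unaffected by the
  -- extension across 0.
  have hg0 : g.1 0 = 0 := by
    rw [hg, fourier, ← hint]
    simp
  have hF : ∫ x, charFun (ξ * absChar F (-1)) x * g.1 x ∂μ = ΓF * S := by rw [← v2 g hg0, hvg]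
  -- a thin strip around the support of `g`
  have hη : Continuous ((χ * absChar E 1)⁻¹ : Eˣ →* ℂˣ) := (continuous_mul_absChar hχ 1).inv
  obtain ⟨n₀, hn₀⟩ := exists_integral_charFun_mul_tensor μ hdim hα hη g hg0
  obtain ⟨-, B, -, hB⟩ := exists_invariant_of_mem_testFunctions (dilate (-1) h).2
  -- The first bound makes the strip thin enough. The second makes the dual strip long enough: N ≤ M
  -- - B for M = e - n - `logAbs d`.
  set n := min n₀ (e - logAbs d - N - B) with hn
  set M := e - n - logAbs d with hM
  set G := tensor hdim hα g (ballIndicator F n) with hG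
  obtain ⟨G', hG', huG'⟩ := u3 G (tensor_zero hdim hα hg0)
  set h' := dilate (-1) h with hh'
  have hh0 : h'.1 0 = 0 := by rw [hh', dilate_apply_zero, h0]
  -- The first factor is transformed twice in all and becomes a reflection of h; the thin ball
  -- becomes the dual long one.
  have hG'eq : G' = ((c : ℂ)⁻¹ * μ.real (ball F n)) • tensor hdim hα h' (ballIndicator F M) := by
    ext z
    obtain ⟨x, rfl⟩ := (quadHomeomorph hdim hα).surjective z
    change G'.1 _ = ((c : ℂ)⁻¹ * μ.real (ball F n)) *
      (tensor hdim hα h' (ballIndicator F M)).1 (quadHomeomorph hdim hα x)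
    rw [hG', hG, fourier_tensor hdim hα μ hd, hg, fourier_fourier μ hc0 hc,
      fourier_ballIndicator_mul μ he hd0, tensor_apply]
    ring
  -- The absolute value of E is |x|_F² on F: one factor belongs to ξ, the other to the degree of the
  -- distribution on F.
  have hrestr : ∀ x, charFun (restrictChar F (χ * absChar E 1)⁻¹) x =
      charFun (ξ * absChar F (-1)) x := by
    intro x
    by_cases hx : x = 0
    · simp [hx, charFun_zero]
    rw [charFun_restrictChar, charFun_inv_char, charFun_mul_char, charFun_absChar_one,
      nabs_algebraMap hdim hα, charFun_mul_char, hξdef, restrictedDual_eq, charFun_restrictChar,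
      charFun_absChar_neg_one, Complex.ofReal_pow, pow_two, mul_inv, mul_inv, mul_assoc]
  have hE1 : u G' = ΓE * (μ.real (ball F n) * (ΓF * S)) := by
    rw [huG', hn₀ n (min_le_left _ _)]
    simp only [hrestr]
    rw [hF]
  have hint' : ∫ x, h'.1 x ∂μ = 0 := by
    simp only [hh', dilate_neg_one_apply]
    rw [integral_neg_eq_self (fun x => h.1 x), hint]
  have hE2 : u G' = (c : ℂ)⁻¹ * μ.real (ball F n) *
      (regularizedValue μ α χ N * (charFun χ (-1) * S)) := by
    rw [hG'eq, map_smul, smul_eq_mul, u2 _ (tensor_zero hdim hα hh0)]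
    congr 1
    have hcancel : χ * absChar E 1 * absChar E (-1) = χ := by
      rw [mul_absChar_mul_absChar, add_neg_cancel, mul_absChar_zero]
    rw [hcancel, integral_charFun_mul_tensor μ hdim hα hχ h' hh0,
      integral_mul_setIntegral_charFun μ hα hχ hN hreg h' hh0 hint' hB (by omega), hSdef, hh',
      integral_charFun_mul_dilate]
    have hneg : charFun (restrictChar F χ * absChar F 1) (-1) = charFun χ (-1) := by
      rw [charFun_mul_char, charFun_restrictChar, charFun_absChar_one, map_neg, map_one, nabs_neg,
        nabs_one, Complex.ofReal_one, mul_one]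
    have hinv : ξ⁻¹ = restrictChar F χ * absChar F 1 := by
      refine MonoidHom.ext fun x => Units.ext ?_
      rw [← charFun_units, ← charFun_units, charFun_inv_char, hξdef, restrictedDual_eq, mul_inv,
        inv_inv, inv_inv, charFun_mul_char, charFun_absChar_one]
    rw [← charFun_units, Units.val_neg, Units.val_one, hneg, nabs_neg, nabs_one, Complex.ofReal_one,
      mul_one, hinv]
  have hcC : (c : ℂ) ≠ 0 := by exact_mod_cast hc0
  have hm : (μ.real (ball F n) : ℂ) ≠ 0 := by exact_mod_cast (measureReal_ball_pos μ n).ne'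
  -- The sign χ(-1) arises from the reflection of h and is its own inverse.
  have hsq := charFun_neg_one_mul_self χ
  rw [hE1] at hE2
  have h1 : (μ.real (ball F n) : ℂ) * S * (ΓF * ΓE) =
      (μ.real (ball F n) : ℂ) * S * ((c : ℂ)⁻¹ * regularizedValue μ α χ N * charFun χ (-1)) := by
    linear_combination hE2
  have h2 := mul_left_cancel₀ (mul_ne_zero hm hS) h1
  rw [h2]
  have h3 := mul_inv_cancel₀ hcC
  linear_combination (-(regularizedValue μ α χ N)) * hsq - regularizedValue μ α χ N *
    charFun χ (-1) * charFun χ (-1) * h3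

end GammaProduct

/-! ### Invariance of the three kinds of integrals under dilation. -/

section Rescaling

variable {K : Type*} [Field K] [ValuativeRel K] [TopologicalSpace K] [IsNonarchimedeanLocalField K]
  [MeasurableSpace K] [BorelSpace K] (μ : Measure K) [μ.IsAddHaarMeasure]

/-- Integer exponents are convenient because a dilation shifts the index by an arbitrary integer. -/
lemma hasImproperIntegral_iff_tendsto (g : K → ℂ) (L : ℂ) :
    HasImproperIntegral μ g L ↔
      Tendsto (fun n : ℤ => ∫ y in (ball K n : Set K), g y ∂μ) atTop (𝓝 L) := by
  have h : ∀ n : ℕ, ({y : K | nabs y ≤ (resCard K : ℝ) ^ n}) = (ball K (n : ℤ) : Set K) := by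
    intro n
    ext y
    rw [SetLike.mem_coe, mem_ball, zpow_natCast]
    rfl
  rw [← Nat.map_cast_int_atTop, tendsto_map'_iff]
  simp only [HasImproperIntegral, h, Function.comp_def]

lemma setIntegral_ball_rescale (c : ℂ) (a : Kˣ) (g : K → ℂ) (n : ℤ) :
    ∫ y in (ball K n : Set K), c * g ((a⁻¹ : Kˣ) * y) ∂μ =
      c * (nabs (a : K) : ℂ) * ∫ y in (ball K (n - logAbs (a : K)) : Set K), g y ∂μ := by
  rw [← integral_indicator (measurableSet_ball (n - logAbs (a : K))), mul_assoc,
    ← integral_comp_mul_left' μ a, ← integral_indicator (measurableSet_ball n),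
    ← integral_const_mul]
  refine integral_congr_ae (.of_forall fun y => ?_)
  have hmem : ((a⁻¹ : Kˣ) : K) * y ∈ (ball K (n - logAbs (a : K)) : Set K) ↔
      y ∈ (ball K n : Set K) := by
    rw [SetLike.mem_coe, SetLike.mem_coe, mem_ball, mem_ball, nabs_mul, Units.val_inv_eq_inv_val,
      nabs_inv, zpow_sub₀ (resCard_ne_zero K), ← nabs_eq_zpow a.ne_zero, inv_mul_eq_div,
      div_le_div_iff_of_pos_right (nabs_pos a.ne_zero)]
  by_cases hy : y ∈ (ball K n : Set K)
  · simp only [Set.indicator_of_mem hy, Set.indicator_of_mem (hmem.2 hy)]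
  · simp only [Set.indicator_of_notMem hy, Set.indicator_of_notMem (hmem.not.2 hy), mul_zero]

lemma integral_rescale (c : ℂ) (a : Kˣ) (g : K → ℂ) :
    ∫ y, c * g ((a⁻¹ : Kˣ) * y) ∂μ = c * (nabs (a : K) : ℂ) * ∫ y, g y ∂μ := by
  rw [integral_const_mul, integral_comp_mul_left', mul_assoc]

lemma integrable_rescale_iff {c : ℂ} (hc : c ≠ 0) (a : Kˣ) (g : K → ℂ) :
    Integrable (fun y => c * g ((a⁻¹ : Kˣ) * y)) μ ↔ Integrable g μ := by
  rw [integrable_const_mul_iff hc.isUnit, integrable_comp_mul_left_iff]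

lemma tendsto_atTop_sub_int {X : Type*} {f : ℤ → X} {l : Filter X} (m : ℤ) :
    Tendsto (fun n => f (n - m)) atTop l ↔ Tendsto f atTop l := by
  have h : map (fun n : ℤ => n - m) atTop = atTop := (OrderIso.subRight m).map_atTop
  conv_rhs => rw [← h]
  rw [tendsto_map'_iff]
  rfl

lemma hasImproperIntegral_rescale_iff {c : ℂ} (hc : c ≠ 0) (a : Kˣ) (g : K → ℂ) (L : ℂ) :
    HasImproperIntegral μ (fun y => c * g ((a⁻¹ : Kˣ) * y)) (c * (nabs (a : K) : ℂ) * L) ↔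
      HasImproperIntegral μ g L := by
  have h : c * (nabs (a : K) : ℂ) ≠ 0 :=
    mul_ne_zero hc (by exact_mod_cast (nabs_pos a.ne_zero).ne')
  rw [hasImproperIntegral_iff_tendsto, hasImproperIntegral_iff_tendsto]
  simp only [setIntegral_ball_rescale]
  rw [tendsto_atTop_sub_int (f := fun n => c * (nabs (a : K) : ℂ) *
    ∫ y in (ball K n : Set K), g y ∂μ)]
  refine ⟨fun hL => ?_, fun hL => hL.const_mul _⟩
  simpa only [inv_mul_cancel_left₀ h] using hL.const_mul (c * (nabs (a : K) : ℂ))⁻¹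

lemma exists_hasImproperIntegral_rescale_iff {c : ℂ} (hc : c ≠ 0) (a : Kˣ) (g : K → ℂ) :
    (∃ L, HasImproperIntegral μ (fun y => c * g ((a⁻¹ : Kˣ) * y)) L) ↔
      ∃ L, HasImproperIntegral μ g L := by
  have h : c * (nabs (a : K) : ℂ) ≠ 0 :=
    mul_ne_zero hc (by exact_mod_cast (nabs_pos a.ne_zero).ne')
  constructor
  · rintro ⟨L, hL⟩
    refine ⟨(c * (nabs (a : K) : ℂ))⁻¹ * L, (hasImproperIntegral_rescale_iff μ hc a g _).1 ?_⟩
    rwa [mul_inv_cancel_left₀ h]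
  · rintro ⟨L, hL⟩
    exact ⟨_, (hasImproperIntegral_rescale_iff μ hc a g L).2 hL⟩

/-- The factor c depends on s because it will be the value of χ|·|_E^s at α; being entire and
without zeros, it affects neither regularity nor convergence. -/
lemma IntegralHasValue.rescale {g : ℂ → K → ℂ} {I : ℂ} (hg : IntegralHasValue μ g I) {c : ℂ → ℂ}
    (hc : Differentiable ℂ c) (hc0 : ∀ s, c s ≠ 0) (a : Kˣ) :
    IntegralHasValue μ (fun s y => c s * g s ((a⁻¹ : Kˣ) * y)) (c 0 * (nabs (a : K) : ℂ) * I) := by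
  obtain ⟨⟨Φ, hmer, ⟨σ, hσ⟩, han, hΦ⟩, hint, himp⟩ := hg
  have hne : c 0 * (nabs (a : K) : ℂ) ≠ 0 :=
    mul_ne_zero (hc0 0) (by exact_mod_cast (nabs_pos a.ne_zero).ne')
  have hcan : ∀ z, AnalyticAt ℂ (fun s => c s * (nabs (a : K) : ℂ)) z := fun z =>
    (hc.analyticAt z).fun_mul analyticAt_const
  refine ⟨⟨fun s => c s * (nabs (a : K) : ℂ) * Φ s, fun z hz => (hcan z).meromorphicAt.fun_mul
    (hmer z hz), ⟨σ, fun s hs => ⟨(integrable_rescale_iff μ (hc0 s) a _).2 (hσ s hs).1, ?_⟩⟩,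
    (hcan 0).fun_mul han, congrArg _ hΦ⟩, fun h => ?_, fun L hL => ?_⟩
  · rw [integral_rescale, ← (hσ s hs).2]
  · rw [integral_rescale, hint ((integrable_rescale_iff μ (hc0 0) a _).1 h)]
  · have h := himp ((c 0 * (nabs (a : K) : ℂ))⁻¹ * L)
      ((hasImproperIntegral_rescale_iff μ (hc0 0) a _ _).1 (by rwa [mul_inv_cancel_left₀ hne]))
    rw [← h, mul_inv_cancel_left₀ hne]

end Rescaling

/-! ### The second integral, the exponent of convergence and the point χ = |·|⁻¹. -/

section Conclusion

variable {F E : Type*} [Field F] [ValuativeRel F] [TopologicalSpace F]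
  [IsNonarchimedeanLocalField F] [Field E] [ValuativeRel E] [TopologicalSpace E]
  [IsNonarchimedeanLocalField E] [Algebra F E] [ValuativeExtension F E]
  {α : E}

/-- From α² = d follows y + α = α(1 + d⁻¹yα). -/
lemma charFun_algebraMap_add {d : F} (hd : α ^ 2 = algebraMap F E d) (hd0 : d ≠ 0)
    (χ : Eˣ →* ℂˣ) (y : F) :
    charFun χ (algebraMap F E y + α) = charFun χ α *
      charFun χ (1 + algebraMap F E (((Units.mk0 d hd0)⁻¹ : Fˣ) * y) * α) := by
  have hd' : algebraMap F E d ≠ 0 := by simpa using hd0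
  rw [← charFun_mul]
  congr 1
  rw [Units.val_inv_eq_inv_val, Units.val_mk0, map_mul, map_inv₀, mul_add, mul_one, add_comm]
  congr 1
  have : α * ((algebraMap F E d)⁻¹ * algebraMap F E y * α) =
      α ^ 2 * (algebraMap F E d)⁻¹ * algebraMap F E y := by ring
  rw [this, hd, mul_inv_cancel₀ hd', one_mul]

lemma charFun_neg (χ : Eˣ →* ℂˣ) (x : E) : charFun χ (-x) = charFun χ (-1) * charFun χ x := by
  rw [← charFun_mul, neg_one_mul]

variable (hdim : Module.finrank F E = 2) (hα : α ∉ (algebraMap F E).range)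

-- An element of F of absolute value q has absolute value q² in E, so |r| = q^(1 + 2σ).
include hdim hα in
lemma norm_sphereRatio_lt_one_iff {χ : Eˣ →* ℂˣ} {σ : ℝ}
    (hσ : ∀ x : Eˣ, ‖(χ x : ℂ)‖ = nabs (x : E) ^ σ) :
    ‖sphereRatio (restrictChar F χ)‖ < 1 ↔ σ < -1 / 2 := by
  have hq := one_lt_resCard F
  have h : ‖sphereRatio (restrictChar F χ)‖ = (resCard F : ℝ) ^ (1 + 2 * σ) := by
    have h1 : ‖(restrictChar F χ (invUniformizer F) : ℂ)‖ = ((resCard F : ℝ) ^ 2) ^ σ := by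
      rw [← nabs_algebraMap_invUniformizer hdim hα]
      exact hσ _
    rw [sphereRatio, norm_mul, h1, Complex.norm_natCast, Real.rpow_add (resCard_pos' F),
      Real.rpow_one, Real.rpow_mul (resCard_pos' F).le, Real.rpow_two]
  rw [h, ← Real.rpow_zero (resCard F : ℝ), Real.rpow_lt_rpow_left_iff hq]
  constructor <;> intro <;> linarith

lemma sphereRatio_eq_one_of_restrictedDual_eq_one {χ : Eˣ →* ℂˣ}
    (h : (restrictedDual χ : Fˣ →* ℂˣ) = 1) : sphereRatio (restrictChar F χ) = 1 := by
  have h1 := restrictedDual_eq χ (invUniformizer F : F)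
  rw [h, charFun_units, charFun_units, nabs_invUniformizer, ← mul_inv, MonoidHom.one_apply,
    Units.val_one, eq_comm, inv_eq_one, mul_comm] at h1
  exact_mod_cast h1

include hdim hα in
/-- Near `χ = |·|⁻¹`, along `χ |·| ^ s`, the two gamma factors are at regular points. -/
lemma eventually_ne_one_of_mul_absChar_eq_one {χ : Eˣ →* ℂˣ} (hχ : χ * absChar E 1 = 1) :
    ‖sphereRatio (restrictChar F χ)‖ < 1 ∧ ∀ᶠ s in 𝓝[≠] (0 : ℂ),
      (restrictedDual (χ * absChar E s) : Fˣ →* ℂˣ) ≠ 1 ∧ χ * absChar E s * absChar E 1 ≠ 1 := by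
  have hχ' : ∀ x : Eˣ, (χ x : ℂ) * (nabs (x : E) : ℂ) = 1 := by
    intro x
    have h := congrArg (Units.val) (DFunLike.congr_fun hχ x)
    rwa [MonoidHom.mul_apply, Units.val_mul, ← charFun_units (absChar E 1), charFun_absChar_one,
      MonoidHom.one_apply, Units.val_one] at h
  have hr : ‖sphereRatio (restrictChar F χ)‖ < 1 := by
    refine (norm_sphereRatio_lt_one_iff hdim hα (σ := -1) fun x => ?_).2 (by norm_num)
    have h := congrArg norm (hχ' x)
    rw [norm_mul, norm_one, Complex.norm_real, Real.norm_of_nonneg (nabs_nonneg _)] at h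
    rw [Real.rpow_neg_one]
    exact eq_inv_of_mul_eq_one_left h
  have hr1 : sphereRatio (restrictChar F χ) ≠ 1 := fun h => by
    rw [h, norm_one] at hr
    exact lt_irrefl _ hr
  refine ⟨hr, ?_⟩
  have h1 : ∀ᶠ s in 𝓝[≠] (0 : ℂ), sphereRatio (restrictChar F (χ * absChar E s)) ≠ 1 := by
    have hcont : ContinuousAt (fun s : ℂ => sphereRatio (restrictChar F χ) *
        (((resCard F : ℝ) ^ 2 : ℝ) : ℂ) ^ s) 0 :=
      continuousAt_const.mul
        (analyticAt_const_cpow (pow_pos (resCard_pos' F) 2) 0).continuousAt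
    have h2 := hcont.eventually_ne (y := 1) (by simpa using hr1)
    refine (h2.filter_mono nhdsWithin_le_nhds).mono fun s hs => ?_
    rwa [sphereRatio_restrictChar_mul_absChar hdim hα]
  -- The derivative of q_E^s at 0 is log q_E ≠ 0, so s = 0 is an isolated solution.
  have h2 : ∀ᶠ s in 𝓝[≠] (0 : ℂ), ((resCard E : ℝ) : ℂ) ^ s ≠ 1 := by
    have hq : ((resCard E : ℝ) : ℂ) ≠ 0 := by exact_mod_cast resCard_ne_zero E
    have hd := (hasDerivAt_id (0 : ℂ)).const_cpow (c := ((resCard E : ℝ) : ℂ)) (.inl hq)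
    have hlog : Complex.log ((resCard E : ℝ) : ℂ) ≠ 0 := by
      rw [← Complex.ofReal_log (resCard_pos' E).le]
      exact_mod_cast (Real.log_pos (one_lt_resCard E)).ne'
    refine hd.eventually_ne ?_
    simpa using hlog
  filter_upwards [h1, h2] with s hs1 hs2
  refine ⟨fun h => hs1 (sphereRatio_eq_one_of_restrictedDual_eq_one h), fun h => hs2 ?_⟩
  have h3 := congrArg (Units.val) (DFunLike.congr_fun h (invUniformizer E))
  rw [MonoidHom.mul_apply, MonoidHom.mul_apply, Units.val_mul, Units.val_mul,
    ← charFun_units (absChar E 1), charFun_absChar_one, mul_right_comm, hχ', one_mul,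
    ← charFun_units, charFun_absChar _ (Units.ne_zero _), nabs_invUniformizer,
    MonoidHom.one_apply, Units.val_one] at h3
  exact h3

end Conclusion

end LocalGamma

end

/-! ### The main theorem. -/

theorem mainTheorem10
    {F E : Type*}
    [Field F] [ValuativeRel F] [TopologicalSpace F] [IsNonarchimedeanLocalField F]
    [MeasurableSpace F] [BorelSpace F]
    [Field E] [ValuativeRel E] [TopologicalSpace E] [IsNonarchimedeanLocalField E]
    [MeasurableSpace E] [BorelSpace E]
    [Algebra F E] [ValuativeExtension F E]
    (hdim : Module.finrank F E = 2)
    (α : E) (hα : α ∉ (algebraMap F E).range) (d : F) (hd : α ^ 2 = algebraMap F E d)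
    (μ : Measure F) [μ.IsAddHaarMeasure]
    (ψ : AddChar F Circle) (hψ : Continuous ψ) (hψ_nontrivial : ψ ≠ 1) :
    ∃ cF : ℝ, 0 < cF ∧ LocalGamma.IsInversionConstant μ ψ cF ∧
      ∀ χ : Eˣ →* ℂˣ, Continuous χ →
        -- the two formulas, for all `χ` at which neither gamma factor has its pole
        ((LocalGamma.restrictedDual χ : Fˣ →* ℂˣ) ≠ 1 → χ * LocalGamma.absChar E 1 ≠ 1 →
          LocalGamma.IntegralHasValue μ
            (fun s y => LocalGamma.charFun (χ * LocalGamma.absChar E s) (1 + algebraMap F E y * α))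
            (cF * LocalGamma.charFun χ (-1) * LocalGamma.gammaProduct hdim hα μ ψ χ) ∧
          LocalGamma.IntegralHasValue μ
            (fun s y => LocalGamma.charFun (χ * LocalGamma.absChar E s) (algebraMap F E y + α))
            (cF * LocalGamma.charFun χ (-α) * (LocalGamma.nabs d : ℂ) *
              LocalGamma.gammaProduct hdim hα μ ψ χ)) ∧
        -- at the pole of `Γ(χ |·|_E)`, where `Γ(χ⁻¹|_{Fˣ} |·|_F⁻¹)` vanishes, the right-hand
        -- sides are regular along `χ |·|_E ^ s` and their limits for `s → 0` are the integrals
        (χ * LocalGamma.absChar E 1 = 1 →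
          Tendsto
            (fun s : ℂ => cF * LocalGamma.charFun (χ * LocalGamma.absChar E s) (-1) *
              LocalGamma.gammaProduct hdim hα μ ψ (χ * LocalGamma.absChar E s))
            (𝓝[≠] 0) (𝓝 (∫ y, LocalGamma.charFun χ (1 + algebraMap F E y * α) ∂μ)) ∧
          Tendsto
            (fun s : ℂ => cF * LocalGamma.charFun (χ * LocalGamma.absChar E s) (-α) *
              (LocalGamma.nabs d : ℂ) *
              LocalGamma.gammaProduct hdim hα μ ψ (χ * LocalGamma.absChar E s))
            (𝓝[≠] 0) (𝓝 (∫ y, LocalGamma.charFun χ (algebraMap F E y + α) ∂μ))) ∧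
        -- the exact ranges of absolute and of improper convergence of the two integrals
        ∃ σ : ℝ, (∀ x : Eˣ, ‖(χ x : ℂ)‖ = LocalGamma.nabs (x : E) ^ σ) ∧
          (Integrable (fun y => LocalGamma.charFun χ (1 + algebraMap F E y * α)) μ ↔
            σ < -1 / 2) ∧
          (Integrable (fun y => LocalGamma.charFun χ (algebraMap F E y + α)) μ ↔
            σ < -1 / 2) ∧
          ((∃ L, LocalGamma.HasImproperIntegral μ
              (fun y => LocalGamma.charFun χ (1 + algebraMap F E y * α)) L) ↔
            (σ < -1 / 2 ∨ ∃ y : F, LocalGamma.nabs y = 1 ∧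
              LocalGamma.charFun χ (algebraMap F E y) ≠ 1)) ∧
          ((∃ L, LocalGamma.HasImproperIntegral μ
              (fun y => LocalGamma.charFun χ (algebraMap F E y + α)) L) ↔
            (σ < -1 / 2 ∨ ∃ y : F, LocalGamma.nabs y = 1 ∧
              LocalGamma.charFun χ (algebraMap F E y) ≠ 1)) := by
  have hα0 : α ≠ 0 := fun h => hα ⟨0, by rw [h, map_zero]⟩
  have hd0 : d ≠ 0 := by
    rintro rfl
    rw [map_zero] at hd
    exact hα0 (pow_eq_zero_iff two_ne_zero |>.1 hd)
  obtain ⟨e, he⟩ := LocalGamma.exists_isConductor hψ hψ_nontrivial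
  have hcpos : 0 < ((LocalGamma.resCard F : ℝ) ^ e * μ.real (LocalGamma.ball F 0) ^ 2)⁻¹ :=
    inv_pos.2 (mul_pos (zpow_pos (LocalGamma.resCard_pos' F) e)
      (pow_pos (LocalGamma.measureReal_ball_pos μ 0) 2))
  have hinv := LocalGamma.isInversionConstant μ he hψ
  generalize ((LocalGamma.resCard F : ℝ) ^ e * μ.real (LocalGamma.ball F 0) ^ 2)⁻¹ = cF
    at hcpos hinv
  refine ⟨cF, hcpos, hinv, fun χ hχ => ?_⟩
  obtain ⟨N, hN⟩ := LocalGamma.exists_isTailBound (F := F) hdim hα hχ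
  have hN0 : LocalGamma.IsTailBound F α χ N := by
    simpa only [LocalGamma.mul_absChar_zero] using hN 0
  have hκ : ∀ s, LocalGamma.charFun (χ * LocalGamma.absChar E s) α =
      LocalGamma.charFun χ α * (LocalGamma.nabs α : ℂ) ^ s := fun s => by
    rw [LocalGamma.charFun_mul_char, LocalGamma.charFun_absChar _ hα0]
  have hκd : Differentiable ℂ fun s => LocalGamma.charFun (χ * LocalGamma.absChar E s) α := by
    simp only [hκ]
    exact fun z => (LocalGamma.analyticAt_const_cpow (LocalGamma.nabs_pos hα0)
      z).differentiableAt.const_mul _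
  have hκ0 : ∀ s, LocalGamma.charFun (χ * LocalGamma.absChar E s) α ≠ 0 :=
    fun s => LocalGamma.charFun_ne_zero _ hα0
  have hκ1 : LocalGamma.charFun χ α ≠ 0 := LocalGamma.charFun_ne_zero _ hα0
  have key : ∀ s, (LocalGamma.restrictedDual (χ * LocalGamma.absChar E s) : Fˣ →* ℂˣ) ≠ 1 →
      χ * LocalGamma.absChar E s * LocalGamma.absChar E 1 ≠ 1 →
      LocalGamma.regularizedValue μ α (χ * LocalGamma.absChar E s) N =
        cF * LocalGamma.charFun (χ * LocalGamma.absChar E s) (-1) *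
          LocalGamma.gammaProduct hdim hα μ ψ (χ * LocalGamma.absChar E s) := fun s h1 h2 =>
    LocalGamma.regularizedValue_eq_gammaProduct μ hdim hα hd hψ hψ_nontrivial hcpos.ne' hinv
      (LocalGamma.continuous_mul_absChar hχ s) h1 h2 (hN s)
  -- From here on the second integrand is the first one dilated by d and multiplied by χ(α), so each
  -- of its assertions follows by rescaling.
  simp only [LocalGamma.charFun_algebraMap_add hd hd0]
  refine ⟨fun h1 h2 => ?_, fun h => ?_, ?_⟩
  · have hval := LocalGamma.integralHasValue_regularizedValue hdim hα μ hχ hN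
      (LocalGamma.regular_of_restrictedDual_ne_one μ h1)
    have hkey := key 0 (by rwa [LocalGamma.mul_absChar_zero]) (by rwa [LocalGamma.mul_absChar_zero])
    rw [LocalGamma.mul_absChar_zero] at hkey
    refine ⟨hkey ▸ hval, ?_⟩
    have hval' := hval.rescale μ hκd hκ0 (Units.mk0 d hd0)
    rw [LocalGamma.mul_absChar_zero, hkey, Units.val_mk0] at hval'
    rw [LocalGamma.charFun_neg]
    convert hval' using 1
    ring
  · obtain ⟨hr, hev⟩ := LocalGamma.eventually_ne_one_of_mul_absChar_eq_one hdim hα h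
    have hint := (LocalGamma.integrable_iff_sphereRatio_lt_one hα μ hχ hN0).2 hr
    have hI := LocalGamma.integral_eq_regularizedValue hα μ hχ hN0 hint
    have hr1 : LocalGamma.sphereRatio (LocalGamma.restrictChar F χ) ≠ 1 := fun h => by
      rw [h, norm_one] at hr
      exact lt_irrefl _ hr
    have hlim : Tendsto (fun s : ℂ => cF * LocalGamma.charFun (χ * LocalGamma.absChar E s) (-1) *
        LocalGamma.gammaProduct hdim hα μ ψ (χ * LocalGamma.absChar E s)) (𝓝[≠] 0)
        (𝓝 (∫ y, LocalGamma.charFun χ (1 + algebraMap F E y * α) ∂μ)) := by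
      -- The regularized value is continuous at s = 0, where it is the convergent integral, and for
      -- small s ≠ 0 it equals the expression with gamma factors.
      have h1 := (LocalGamma.analyticAt_regularizedValue hdim hα μ hχ N
        (.inr hr1)).continuousAt.tendsto.mono_left (nhdsWithin_le_nhds (s := {0}ᶜ))
      rw [LocalGamma.mul_absChar_zero, ← hI] at h1
      exact h1.congr' (hev.mono fun s hs => key s hs.1 hs.2)
    refine ⟨hlim, ?_⟩
    have h2 := (hκd.continuous.tendsto 0).mono_left (nhdsWithin_le_nhds (s := {0}ᶜ))
    have h3 := (h2.mul_const (LocalGamma.nabs d : ℂ)).mul hlim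
    rw [LocalGamma.mul_absChar_zero] at h3
    have h4 := LocalGamma.integral_rescale μ (LocalGamma.charFun χ α) (Units.mk0 d hd0)
      fun y => LocalGamma.charFun χ (1 + algebraMap F E y * α)
    rw [Units.val_mk0] at h4
    rw [← h4] at h3
    refine h3.congr fun s => ?_
    rw [LocalGamma.charFun_neg _ α]
    ring
  · obtain ⟨σ, hσ⟩ := LocalGamma.exists_norm_eq_rpow hχ
    have hiff := LocalGamma.norm_sphereRatio_lt_one_iff hdim hα hσ
    have hint : Integrable (fun y => LocalGamma.charFun χ (1 + algebraMap F E y * α)) μ ↔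
        σ < -1 / 2 := (LocalGamma.integrable_iff_sphereRatio_lt_one hα μ hχ hN0).trans hiff
    have himp : (∃ L, LocalGamma.HasImproperIntegral μ
        (fun y => LocalGamma.charFun χ (1 + algebraMap F E y * α)) L) ↔
        (σ < -1 / 2 ∨ ∃ y : F, LocalGamma.nabs y = 1 ∧
          LocalGamma.charFun χ (algebraMap F E y) ≠ 1) := by
      simp only [LocalGamma.hasImproperIntegral_iff, ← LocalGamma.charFun_restrictChar]
      rw [← hiff, ← LocalGamma.sphereIntegral_eq_zero_iff μ, or_comm]
      exact ⟨fun ⟨L, hL⟩ => LocalGamma.sphereRatio_lt_one_of_tendsto hα μ hχ hN0 hL,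
        fun h => ⟨_, LocalGamma.tendsto_partialIntegral hα μ hχ hN0 h⟩⟩
    exact ⟨σ, hσ, hint, (LocalGamma.integrable_rescale_iff μ hκ1 (Units.mk0 d hd0) _).trans hint,
      himp, (LocalGamma.exists_hasImproperIntegral_rescale_iff μ hκ1 (Units.mk0 d hd0) _).trans
        himp⟩
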